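/- Let $k$ be a field, let $S$ be a $k$-scheme and let $g\colon Y\to S$ be a flat morphism of schemes. For a $k$-scheme $T$, a $T$-scheme $X$ and an Artinian local $k$-algebra $A$ with residue field $k$, a \emph{$T$-deformation} of $X$ over $A$ is a scheme $\mathcal X$ with a closed immersion $X\hookrightarrow\mathcal X$ and a flat morphism $\mathcal X\to T\times_k\operatorname{Spec}A$ such that the square $$\begin{array}{ccc} X&\to&\mathcal X\\ \downarrow&&\downarrow\\ T&\to&T\times_k\operatorname{Spec}A\end{array}$$ is cartesian, where the lower morphism is induced by the residue map $A\to k$. An isomorphism of $T$-deformations is an isomorphism over $T\times_k\operatorname{Spec}A$ that is compatible with the closed immersions of $X$; let $D^T_X(A)$ be the set of isomorphism classes, which is functorial in $A$ by base change. On $D^T_X(k[\epsilon])$ the sum of the classes of $\mathcal X_1$ and $\mathcal X_2$ is the base change of the fibred sum $\mathcal X_1\cup_X\mathcal X_2$, a $T$-deformation of $X$ over $k[\epsilon]\times_k k[\epsilon]$, along the addition $k[\epsilon]\times_kk[\epsilon]\to k[\epsilon]$, $(a+b\epsilon,a+c\epsilon)\mapsto a+(b+c)\epsilon$, and multiplication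 by $c\in k$ is base change along $\epsilon\mapsto c\epsilon$. Then the functor $F\colon \mathrm{Sch}/S\to\mathrm{Sch}/Y$, $F(X)=X\times_SY$, is smooth in the following sense. (1) For every $S$-scheme $X$, every Artinian local $k$-algebra $A$ with residue field $k$ and every $S$-deformation $\mathcal X$ of $X$ over $A$, the scheme $\mathcal X\times_SY$, with the induced morphisms $X\times_SY\to\mathcal X\times_SY$ and $\mathcal X\times_SY\to Y\times_k\operatorname{Spec}A$, is a $Y$-deformation of $X\times_SY$ over $A$; and with the induced morphism $\mathcal X\times_SY\to S\times_k\operatorname{Spec}A$ it is an $S$-deformation of the $S$-scheme $X\times_SY$ over $A$. (2) For every flat $S$-scheme $X$, the operations above are well defined and make $D^S_X(k[\epsilon])$, $D^Y_{X\times_SY}(k[\epsilon])$ and $D^S_{X\times_SY}(k[\epsilon])$ into $k$-vector spaces, and $\mathcal X\mapsto\mathcal X\times_SY$ induces well-defined $k$-linear maps $$D^S_X(k[\epsilon])\to D^Y_{X\times_SY}(k[\epsilon]),\qquad D^S_X(k[\epsilon])\to D^S_{X\times_SY}(k[\epsilon]).$$ -/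

import Mathlib

open CategoryTheory Limits AlgebraicGeometry

universe u

namespace SmoothFunctor

noncomputable section

/-- `A` is an Artinian local `k`-algebra with residue field `k`. -/
class IsArtAlg (k A : Type u) [Field k] [CommRing A] [Algebra k A] : Prop
    extends IsLocalRing A, IsArtinianRing A where
  bijective_residue : Function.Bijective (algebraMap k (IsLocalRing.ResidueField A))

section Art

variable (k A B : Type u) [Field k] [CommRing A] [Algebra k A] [IsArtAlg k A]
  [CommRing B] [Algebra k B] [IsArtAlg k B]

/-- The augmentation `A → k`, i.e. the residue map of `A`. -/
def aug : A →ₐ[k] k :=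
  (AlgEquiv.ofBijective (Algebra.ofId k (IsLocalRing.ResidueField A))
      (IsArtAlg.bijective_residue (k := k) (A := A))).symm.toAlgHom.comp
    (IsScalarTower.toAlgHom k A (IsLocalRing.ResidueField A))

variable {k A B}

theorem algHom_eq_aug (ψ : A →ₐ[k] k) : ψ = aug k A := by
  have surj : ∀ χ : A →ₐ[k] k, Function.Surjective χ := fun χ c =>
    ⟨algebraMap k A c, by simp⟩
  have ker : ∀ χ : A →ₐ[k] k, RingHom.ker χ.toRingHom = IsLocalRing.maximalIdeal A := fun χ =>
    IsLocalRing.eq_maximalIdeal (RingHom.ker_isMaximal_of_surjective _ (surj χ))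
  ext a
  have h : a - algebraMap k A (aug k A a) ∈ RingHom.ker (aug k A).toRingHom := by
    rw [RingHom.mem_ker]; simp
  rw [ker, ← ker ψ, RingHom.mem_ker] at h
  simpa [sub_eq_zero] using h

theorem aug_comp (φ : A →ₐ[k] B) : (aug k B).comp φ = aug k A := algHom_eq_aug _

instance isArtAlg_trivSqZeroExt (V : Type u) [AddCommGroup V] [Module k V] [Module kᵐᵒᵖ V]
    [IsCentralScalar k V] [Module.Finite k V] : IsArtAlg k (TrivSqZeroExt k V) := by
  have hloc : IsLocalRing (TrivSqZeroExt k V) := by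
    refine IsLocalRing.of_nonunits_add fun a b ha hb => ?_
    simp only [mem_nonunits_iff, TrivSqZeroExt.isUnit_iff_isUnit_fst, isUnit_iff_ne_zero,
      not_not, TrivSqZeroExt.fst_add] at *
    simp [ha, hb]
  have hfin : Module.Finite k (TrivSqZeroExt k V) :=
    inferInstanceAs (Module.Finite k (k × V))
  have hart : IsArtinianRing (TrivSqZeroExt k V) := IsArtinianRing.of_finite k _
  refine { hloc, hart with bijective_residue := ⟨(algebraMap k _).injective, fun x => ?_⟩ }
  obtain ⟨a, rfl⟩ := IsLocalRing.residue_surjective x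
  refine ⟨a.fst, ?_⟩
  rw [IsScalarTower.algebraMap_apply k (TrivSqZeroExt k V)]
  change IsLocalRing.residue _ _ = _
  rw [← sub_eq_zero, ← map_sub, IsLocalRing.residue_eq_zero_iff, IsLocalRing.mem_maximalIdeal,
    mem_nonunits_iff, TrivSqZeroExt.isUnit_iff_isUnit_fst]
  simp [TrivSqZeroExt.algebraMap_eq_inl]

end Art

section Deformations

variable {k : Type u} [Field k] {S : Scheme.{u}} (s : S ⟶ Spec (.of k))

/-- The product `S ×ₖ Spec A`. -/
abbrev prodSpec (A : Type u) [CommRing A] [Algebra k A] : Scheme.{u} :=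
  pullback s (Spec.map (CommRingCat.ofHom (algebraMap k A)))

/-- The morphism `S ×ₖ Spec B ⟶ S ×ₖ Spec A` induced by `A → B`. -/
def prodSpecMap {A B : Type u} [CommRing A] [Algebra k A] [CommRing B] [Algebra k B]
    (φ : A →ₐ[k] B) : prodSpec s B ⟶ prodSpec s A :=
  pullback.lift (pullback.fst _ _)
    (pullback.snd _ _ ≫ Spec.map (CommRingCat.ofHom φ.toRingHom)) (by
      rw [pullback.condition, Category.assoc, ← Spec.map_comp, ← CommRingCat.ofHom_comp]
      congr 4
      exact φ.comp_algebraMap.symm)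

/-- The closed embedding `S ⟶ S ×ₖ Spec A` induced by `A → k`. -/
def closedPt (A : Type u) [CommRing A] [Algebra k A] [IsArtAlg k A] : S ⟶ prodSpec s A :=
  pullback.lift (𝟙 S) (s ≫ Spec.map (CommRingCat.ofHom (aug k A).toRingHom)) (by
    rw [Category.id_comp, Category.assoc, ← Spec.map_comp, ← CommRingCat.ofHom_comp]
    have : (aug k A).toRingHom.comp (algebraMap k A) = RingHom.id k :=
      (aug k A).comp_algebraMap
    rw [this]
    simp)

@[simp]
theorem prodSpecMap_fst {A B : Type u} [CommRing A] [Algebra k A] [CommRing B] [Algebra k B]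
    (φ : A →ₐ[k] B) : prodSpecMap s φ ≫ pullback.fst _ _ = pullback.fst _ _ :=
  pullback.lift_fst _ _ _

@[simp]
theorem closedPt_fst (A : Type u) [CommRing A] [Algebra k A] [IsArtAlg k A] :
    closedPt s A ≫ pullback.fst _ _ = 𝟙 S :=
  pullback.lift_fst _ _ _

theorem closedPt_map {A B : Type u} [CommRing A] [Algebra k A] [IsArtAlg k A]
    [CommRing B] [Algebra k B] [IsArtAlg k B] (φ : A →ₐ[k] B) :
    closedPt s B ≫ prodSpecMap s φ = closedPt s A := by
  apply pullback.hom_ext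
  · rw [Category.assoc, prodSpecMap_fst, closedPt_fst, closedPt_fst]
  · simp only [closedPt, prodSpecMap, Category.assoc, pullback.lift_snd,
      pullback.lift_snd_assoc]
    rw [← Spec.map_comp, ← CommRingCat.ofHom_comp, ← aug_comp φ]
    rfl

instance isClosedImmersion_closedPt (A : Type u) [CommRing A] [Algebra k A] [IsArtAlg k A] :
    IsClosedImmersion (closedPt s A) := by
  have : IsClosedImmersion (closedPt s A ≫ pullback.fst s
      (Spec.map (CommRingCat.ofHom (algebraMap k A)))) := by
    rw [closedPt_fst]; infer_instance
  exact IsClosedImmersion.of_comp _ (pullback.fst s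
      (Spec.map (CommRingCat.ofHom (algebraMap k A))))

/-- The morphisms `incl : X ⟶ Z` and `hom : Z ⟶ S ×ₖ Spec A` make `Z` an `S`-deformation
of the `S`-scheme `X` over `A`. -/
structure IsDeformation (X : Over S) (A : Type u) [CommRing A] [Algebra k A] [IsArtAlg k A]
    {Z : Scheme.{u}} (incl : X.left ⟶ Z) (hom : Z ⟶ prodSpec s A) : Prop where
  isClosedImmersion : IsClosedImmersion incl
  flat : Flat hom
  isPullback : IsPullback incl X.hom hom (closedPt s A)

/-- An `S`-deformation of the `S`-scheme `X` over `A`. -/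
structure Deformation (X : Over S) (A : Type u) [CommRing A] [Algebra k A] [IsArtAlg k A] where
  total : Scheme.{u}
  incl : X.left ⟶ total
  hom : total ⟶ prodSpec s A
  isDeformation : IsDeformation s X A incl hom

namespace Deformation

variable {s} {X : Over S} {A B : Type u} [CommRing A] [Algebra k A] [IsArtAlg k A]
  [CommRing B] [Algebra k B] [IsArtAlg k B]

/-- The total space of a deformation as an `S`-scheme. -/
abbrev toOver (D : Deformation s X A) : Over S := Over.mk (D.hom ≫ pullback.fst _ _)

/-- The inclusion `X ⟶ Z` as a morphism of `S`-schemes. -/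
def inclOver (D : Deformation s X A) : X ⟶ D.toOver :=
  Over.homMk D.incl (by
    change D.incl ≫ D.hom ≫ pullback.fst _ _ = X.hom
    rw [← Category.assoc, D.isDeformation.isPullback.w, Category.assoc, closedPt_fst,
      Category.comp_id])

/-- Isomorphism of deformations: over `S ×ₖ Spec A`, and inducing the identity on `X`. -/
instance setoid (s : S ⟶ Spec (.of k)) (X : Over S) (A : Type u) [CommRing A] [Algebra k A]
    [IsArtAlg k A] : Setoid (Deformation s X A) where
  r D E := ∃ e : D.total ≅ E.total, e.hom ≫ E.hom = D.hom ∧ D.incl ≫ e.hom = E.incl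
  iseqv :=
    { refl := fun D => ⟨Iso.refl _, by simp, by simp⟩
      symm := by
        rintro D E ⟨e, h₁, h₂⟩
        exact ⟨e.symm, by simp [← h₁], by simp [← h₂]⟩
      trans := by
        rintro D E F ⟨e, h₁, h₂⟩ ⟨e', h₁', h₂'⟩
        exact ⟨e ≪≫ e', by simp [h₁, h₁'], by simp [← h₂', ← h₂]⟩ }

/-- Base change of a deformation along a morphism `A → B`. -/
def baseChange (φ : A →ₐ[k] B) (D : Deformation s X A) : Deformation s X B where
  total := pullback D.hom (prodSpecMap s φ)
  incl := pullback.lift D.incl (X.hom ≫ closedPt s B) (by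
    rw [D.isDeformation.isPullback.w, Category.assoc, closedPt_map])
  hom := pullback.snd _ _
  isDeformation := by
    have hD := D.isDeformation
    have hw : D.incl ≫ D.hom = (X.hom ≫ closedPt s B) ≫ prodSpecMap s φ := by
      rw [hD.isPullback.w, Category.assoc, closedPt_map]
    have hp : IsPullback (pullback.lift D.incl (X.hom ≫ closedPt s B) hw) X.hom
        (pullback.snd D.hom (prodSpecMap s φ)) (closedPt s B) := by
      refine IsPullback.of_right ?_ (pullback.lift_snd _ _ _)
        (IsPullback.of_hasPullback D.hom (prodSpecMap s φ))
      rw [closedPt_map, pullback.lift_fst]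
      exact hD.isPullback
    have := hD.flat
    exact ⟨MorphismProperty.of_isPullback hp.flip inferInstance, inferInstance, hp⟩

end Deformation

/-- The set `D_X(A)` of isomorphism classes of `S`-deformations of `X` over `A`. -/
def DefClass (X : Over S) (A : Type u) [CommRing A] [Algebra k A] [IsArtAlg k A] : Type (u + 1) :=
  Quotient (Deformation.setoid s X A)

/-- The isomorphism class of a deformation. -/
def Deformation.cls {s : S ⟶ Spec (.of k)} {X : Over S} {A : Type u} [CommRing A] [Algebra k A]
    [IsArtAlg k A] (D : Deformation s X A) : DefClass s X A :=
  Quotient.mk _ D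

theorem exists_pullback_iso {W Z Z' P Q : Scheme.{u}} {f : Z ⟶ P} {f' : Z' ⟶ P} (m : Q ⟶ P)
    (e : Z ≅ Z') (h : e.hom ≫ f' = f) {a : W ⟶ Z} {a' : W ⟶ Z'} (ha : a ≫ e.hom = a')
    (b : W ⟶ Q) (w : a ≫ f = b ≫ m) (w' : a' ≫ f' = b ≫ m) :
    ∃ i : pullback f m ≅ pullback f' m, i.hom ≫ pullback.snd f' m = pullback.snd f m ∧
      pullback.lift a b w ≫ i.hom = pullback.lift a' b w' := by
  subst h ha
  have w₁ : (pullback.fst (e.hom ≫ f') m ≫ e.hom) ≫ f' = pullback.snd (e.hom ≫ f') m ≫ m := by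
    rw [Category.assoc, pullback.condition]
  have w₂ : (pullback.fst f' m ≫ e.inv) ≫ e.hom ≫ f' = pullback.snd f' m ≫ m := by
    rw [Category.assoc, e.inv_hom_id_assoc, pullback.condition]
  refine ⟨⟨pullback.lift _ _ w₁, pullback.lift _ _ w₂, ?_, ?_⟩, pullback.lift_snd _ _ _, ?_⟩
  all_goals
    apply pullback.hom_ext <;>
      simp [pullback.lift_fst, pullback.lift_snd, pullback.lift_fst_assoc]

/-- Functoriality of `D_X` in the Artinian algebra. -/
def DefClass.map {s : S ⟶ Spec (.of k)} {X : Over S} {A B : Type u} [CommRing A] [Algebra k A]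
    [IsArtAlg k A] [CommRing B] [Algebra k B] [IsArtAlg k B] (φ : A →ₐ[k] B) :
    DefClass s X A → DefClass s X B :=
  Quotient.map (Deformation.baseChange φ) (by
    rintro D E ⟨e, h₁, h₂⟩
    exact exists_pullback_iso (prodSpecMap s φ) e h₁ h₂ _ _ _)

end Deformations

section Tangent

open scoped DualNumber

variable (k : Type u) [Field k]

/-- The algebra `k[ε] ×ₖ k[ε] = k[ε₁, ε₂] / (ε₁, ε₂)²`, as the trivial square zero extension
of `k` by `k × k`. -/
abbrev DualSq : Type u := TrivSqZeroExt k (k × k)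

/-- The first projection `k[ε] ×ₖ k[ε] → k[ε]`. -/
def DualSq.proj₁ : DualSq k →ₐ[k] k[ε] := TrivSqZeroExt.map (LinearMap.fst k k k)

/-- The second projection `k[ε] ×ₖ k[ε] → k[ε]`. -/
def DualSq.proj₂ : DualSq k →ₐ[k] k[ε] := TrivSqZeroExt.map (LinearMap.snd k k k)

/-- The addition `k[ε] ×ₖ k[ε] → k[ε]`, `(a + b ε, a + c ε) ↦ a + (b + c) ε`. -/
def DualSq.sum : DualSq k →ₐ[k] k[ε] :=
  TrivSqZeroExt.map (LinearMap.fst k k k + LinearMap.snd k k k)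

variable {k}

/-- The endomorphism `a + b ε ↦ a + c b ε` of `k[ε]`. -/
def dualScale (c : k) : k[ε] →ₐ[k] k[ε] := TrivSqZeroExt.map (c • LinearMap.id)

variable {S : Scheme.{u}} {s : S ⟶ Spec (.of k)} {X : Over S}

/-- The deformation `Z` over `k[ε] ×ₖ k[ε]` is the fibred sum `D₁ ∪_X D₂` of two first order
deformations along `X`. -/
def IsGluing (D₁ D₂ : Deformation s X k[ε]) (Z : Deformation s X (DualSq k)) : Prop :=
  ∃ (i₁ : D₁.total ⟶ Z.total) (i₂ : D₂.total ⟶ Z.total),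
    IsPushout D₁.incl D₂.incl i₁ i₂ ∧ D₁.incl ≫ i₁ = Z.incl ∧
    i₁ ≫ Z.hom = D₁.hom ≫ prodSpecMap s (DualSq.proj₁ k) ∧
    i₂ ≫ Z.hom = D₂.hom ≫ prodSpecMap s (DualSq.proj₂ k)

/-- The class `c` is the sum of `a` and `b`: it is obtained from the fibred sum along `X` of
representatives of `a` and `b` by base change along the addition `k[ε] ×ₖ k[ε] → k[ε]`. -/
def IsSum (a b c : DefClass s X k[ε]) : Prop :=
  ∃ (D₁ D₂ : Deformation s X k[ε]) (Z : Deformation s X (DualSq k)),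
    D₁.cls = a ∧ D₂.cls = b ∧ IsGluing D₁ D₂ Z ∧ (Z.baseChange (DualSq.sum k)).cls = c

variable (s X) in
/-- A `k`-vector space structure on `D_X(k[ε])` is the tangent space structure if its addition
is the one by fibred sums and its scalar multiplication is the one induced by `ε ↦ c ε`.
There is at most one such structure. -/
structure IsTangentSpace [AddCommGroup (DefClass s X k[ε])] [Module k (DefClass s X k[ε])] :
    Prop where
  add_eq_iff : ∀ a b c : DefClass s X k[ε], a + b = c ↔ IsSum a b c
  smul_eq : ∀ (c : k) (a : DefClass s X k[ε]), c • a = a.map (dualScale c)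

end Tangent

section Smooth

open scoped DualNumber

variable {k : Type u} [Field k] {S T : Scheme.{u}}

/-- Natural `k`-morphisms `F X ⟶ X`, for a functor `F` from `S`-schemes to `T`-schemes, where
`S` and `T` are `k`-schemes. They turn a family `Z ⟶ S ×ₖ B` over a `k`-scheme `B` into a family
`F Z ⟶ T ×ₖ B` over the same `B`. -/
structure NatProj (s : S ⟶ Spec (.of k)) (t : T ⟶ Spec (.of k)) (F : Over S ⥤ Over T) where
  app : ∀ X : Over S, (F.obj X).left ⟶ X.left
  naturality : ∀ {X X' : Over S} (f : X ⟶ X'), (F.map f).left ≫ app X' = app X ≫ f.left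
  comm : ∀ X : Over S, app X ≫ X.hom ≫ s = (F.obj X).hom ≫ t

variable {s : S ⟶ Spec (.of k)} {t : T ⟶ Spec (.of k)} {F : Over S ⥤ Over T}

/-- The structure morphism `F Z ⟶ T ×ₖ Spec A`, for a deformation `Z ⟶ S ×ₖ Spec A`. -/
def imageHom (p : NatProj s t F) {A : Type u} [CommRing A] [Algebra k A] [IsArtAlg k A]
    {X : Over S} (D : Deformation s X A) : (F.obj D.toOver).left ⟶ prodSpec t A :=
  pullback.lift (F.obj D.toOver).hom (p.app D.toOver ≫ D.hom ≫ pullback.snd _ _) (by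
    rw [← p.comm, Category.assoc, Category.assoc, ← pullback.condition]
    change _ ≫ (D.hom ≫ _) ≫ s = _
    rw [Category.assoc])

/-- `F` sends deformations to deformations: if `Z` is an `S`-deformation of `X` over `A`, then
`F Z` is a `T`-deformation of `F X` over `A`. -/
def PreservesDeformations (p : NatProj s t F) : Prop :=
  ∀ (X : Over S) (A : Type u) [CommRing A] [Algebra k A] [IsArtAlg k A] (D : Deformation s X A),
    IsDeformation t (F.obj X) A (F.map D.inclOver).left (imageHom p D)

/-- The deformation `F Z` of `F X`, for a deformation `Z` of `X`. -/
def PreservesDeformations.image {p : NatProj s t F} (h : PreservesDeformations p) {A : Type u}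
    [CommRing A] [Algebra k A] [IsArtAlg k A] {X : Over S} (D : Deformation s X A) :
    Deformation t (F.obj X) A where
  total := (F.obj D.toOver).left
  incl := (F.map D.inclOver).left
  hom := imageHom p D
  isDeformation := h X A D

/-- Smoothness of `F` (first notion): `F` sends deformations to deformations, and for every flat
`S`-scheme `X` the assignment `Z ↦ F Z` induces a well defined `k`-linear map
`D_X(k[ε]) → D_{F X}(k[ε])` of tangent spaces.
(If `X` is not flat over `S`, it has no deformations and `D_X(k[ε])` is empty.) -/
def IsSmoothFunctor (p : NatProj s t F) : Prop :=
  ∃ h : PreservesDeformations p, ∀ (X : Over S), Flat X.hom →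
    ∃ (_ : AddCommGroup (DefClass s X k[ε])) (_ : Module k (DefClass s X k[ε]))
      (_ : AddCommGroup (DefClass t (F.obj X) k[ε])) (_ : Module k (DefClass t (F.obj X) k[ε])),
      IsTangentSpace s X ∧ IsTangentSpace t (F.obj X) ∧
      ∃ L : DefClass s X k[ε] →ₗ[k] DefClass t (F.obj X) k[ε],
        ∀ D : Deformation s X k[ε], L D.cls = (h.image D).cls

/-- The functor `X ↦ X ×_S Y` from `S`-schemes to `Y`-schemes, with the projections
`X ×_S Y ⟶ X`. -/
def fibreProduct (s : S ⟶ Spec (.of k)) {Y : Scheme.{u}} (g : Y ⟶ S) :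
    NatProj s (g ≫ s) (Over.pullback g) where
  app X := pullback.fst X.hom g
  naturality _ := pullback.lift_fst _ _ _
  comm _ := pullback.condition_assoc _

/-- The functor `X ↦ X ×_S Y` with values in `S`-schemes, with the projections
`X ×_S Y ⟶ X`. -/
def fibreProductOver (s : S ⟶ Spec (.of k)) {Y : Scheme.{u}} (g : Y ⟶ S) :
    NatProj s s (Over.pullback g ⋙ Over.map g) where
  app X := pullback.fst X.hom g
  naturality _ := pullback.lift_fst _ _ _
  comm _ := (pullback.condition_assoc _).trans (Category.assoc _ _ _).symm

end Smooth

end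

end SmoothFunctor

/-!
A deformation of `X` over `k[V × W]`, the trivial square zero extension of `k` by `V × W`, is the
fibred sum along `X` of its restrictions to `k[V]` and `k[W]`, and every pair of deformations over
`k[V]` and `k[W]` arises in this way. Indeed all closed immersions involved are homeomorphisms, so
on suitable affine charts the fibred sum is a fibre product of rings. Flatness of the fibred sum is
the local criterion for a square zero ideal: it suffices that in every relation `∑ εᵢ rᵢ = 0`
between basis vectors `εᵢ` of `V × W` the coefficients `rᵢ` vanish on `X`, and this can be checked
on the two restrictions.

Hence `V ↦ D_X(k[V])` turns products into products, and the linear maps between the spaces `kⁿ`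
induce the vector space structure on `D_X(k[ε])`. A functor that preserves deformations and their
base change therefore induces linear maps. The fibre product with `g` has both properties, since the
square formed by `g × Spec A` and `g` is cartesian for every `A`; viewing the result over `S`
amounts to composing with the flat morphism `g × Spec A`.
-/

namespace SmoothFunctor

open TopologicalSpace Opposite

noncomputable section

section Functoriality

variable {k : Type u} [Field k] {S : Scheme.{u}} {s : S ⟶ Spec (.of k)} {X : Over S}
  {A B C : Type u} [CommRing A] [Algebra k A] [CommRing B] [Algebra k B] [CommRing C] [Algebra k C]

theorem prodSpecMap_id : prodSpecMap s (AlgHom.id k A) = 𝟙 _ := by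
  apply pullback.hom_ext
  · simp
  · rw [prodSpecMap, pullback.lift_snd, Category.id_comp]
    exact (congrArg _ (Spec.map_id _)).trans (Category.comp_id _)

theorem prodSpecMap_comp (φ : A →ₐ[k] B) (ψ : B →ₐ[k] C) :
    prodSpecMap s (ψ.comp φ) = prodSpecMap s ψ ≫ prodSpecMap s φ := by
  apply pullback.hom_ext
  · simp
  · simp only [prodSpecMap, pullback.lift_snd, Category.assoc, pullback.lift_snd_assoc]
    rw [← Spec.map_comp]
    rfl

theorem prodSpecMap_ofId_comp_aug [IsArtAlg k A] :
    prodSpecMap s ((Algebra.ofId k B).comp (aug k A)) = pullback.fst _ _ ≫ closedPt s A := by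
  apply pullback.hom_ext
  · simp
  · simp only [prodSpecMap, closedPt, pullback.lift_snd, Category.assoc]
    rw [pullback.condition_assoc, ← Spec.map_comp, ← CommRingCat.ofHom_comp]
    rfl

variable [IsArtAlg k A] [IsArtAlg k B] [IsArtAlg k C]

theorem Deformation.cls_eq_of_isPullback {D : Deformation s X A} {E : Deformation s X B}
    {φ : A →ₐ[k] B} {f : E.total ⟶ D.total}
    (h : IsPullback f E.hom D.hom (prodSpecMap s φ)) (hf : E.incl ≫ f = D.incl) :
    E.cls = DefClass.map φ D.cls := by
  have w : D.incl ≫ D.hom = (X.hom ≫ closedPt s B) ≫ prodSpecMap s φ := by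
    rw [D.isDeformation.isPullback.w, Category.assoc, closedPt_map]
  have incl_iso : E.incl ≫ h.isoPullback.hom = pullback.lift D.incl (X.hom ≫ closedPt s B) w := by
    apply pullback.hom_ext
    · rw [Category.assoc, h.isoPullback_hom_fst, hf, pullback.lift_fst]
    · rw [Category.assoc, h.isoPullback_hom_snd, E.isDeformation.isPullback.w, pullback.lift_snd]
  exact Quotient.sound ⟨h.isoPullback, h.isoPullback_hom_snd, incl_iso⟩

theorem Deformation.exists_isPullback_baseChange (φ : A →ₐ[k] B) (D : Deformation s X A) :
    ∃ f : (D.baseChange φ).total ⟶ D.total,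
      IsPullback f (D.baseChange φ).hom D.hom (prodSpecMap s φ) ∧
        (D.baseChange φ).incl ≫ f = D.incl :=
  ⟨pullback.fst _ _, IsPullback.of_hasPullback _ _, pullback.lift_fst _ _ _⟩

theorem Deformation.exists_isPullback_of_cls_eq {D : Deformation s X A} {E : Deformation s X B}
    {φ : A →ₐ[k] B} (h : E.cls = DefClass.map φ D.cls) :
    ∃ f : E.total ⟶ D.total,
      IsPullback f E.hom D.hom (prodSpecMap s φ) ∧ E.incl ≫ f = D.incl := by
  obtain ⟨e, e_hom, incl_e⟩ := Quotient.exact h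
  obtain ⟨f, hf, incl_f⟩ := D.exists_isPullback_baseChange φ
  refine ⟨e.hom ≫ f, ?_, by rw [← Category.assoc, incl_e, incl_f]⟩
  have : IsPullback e.hom E.hom (D.baseChange φ).hom (𝟙 _) :=
    IsPullback.of_horiz_isIso ⟨by rw [e_hom, Category.comp_id]⟩
  simpa using this.paste_horiz hf

@[elab_as_elim]
theorem DefClass.ind {P : DefClass s X A → Prop} (h : ∀ D : Deformation s X A, P D.cls) (a) : P a :=
  Quotient.ind h a

theorem DefClass.map_cls (φ : A →ₐ[k] B) (D : Deformation s X A) :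
    DefClass.map φ D.cls = (D.baseChange φ).cls := rfl

theorem DefClass.map_id (a : DefClass s X A) : a.map (AlgHom.id k A) = a := by
  induction a using DefClass.ind with | h D
  symm
  refine Deformation.cls_eq_of_isPullback (f := 𝟙 _) ?_ (Category.comp_id _)
  rw [prodSpecMap_id]
  exact IsPullback.of_horiz_isIso ⟨by simp⟩

theorem DefClass.map_map (φ : A →ₐ[k] B) (ψ : B →ₐ[k] C) (a : DefClass s X A) :
    (a.map φ).map ψ = a.map (ψ.comp φ) := by
  induction a using DefClass.ind with | h D
  rw [DefClass.map_cls, DefClass.map_cls]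
  obtain ⟨f, hf, incl_f⟩ := D.exists_isPullback_baseChange φ
  obtain ⟨g, hg, incl_g⟩ := (D.baseChange φ).exists_isPullback_baseChange ψ
  refine Deformation.cls_eq_of_isPullback (f := g ≫ f) ?_ (by rw [← Category.assoc, incl_g, incl_f])
  rw [prodSpecMap_comp]
  exact hg.paste_horiz hf

variable (s X A) in
/-- The trivial deformation `X ×ₖ Spec A` of a flat `S`-scheme `X`; it represents the zero tangent
vector. -/
def Deformation.trivial [Flat X.hom] : Deformation s X A where
  total := pullback X.hom (pullback.fst s (Spec.map (CommRingCat.ofHom (algebraMap k A))))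
  incl := pullback.lift (𝟙 _) (X.hom ≫ closedPt s A) (by simp)
  hom := pullback.snd _ _
  isDeformation := by
    have hp : IsPullback (pullback.lift (𝟙 _) (X.hom ≫ closedPt s A) (by simp)) X.hom
        (pullback.snd X.hom (pullback.fst s (Spec.map (CommRingCat.ofHom (algebraMap k A)))))
        (closedPt s A) := by
      refine IsPullback.of_right ?_ (pullback.lift_snd _ _ _) (IsPullback.of_hasPullback _ _)
      rw [pullback.lift_fst, closedPt_fst]
      exact IsPullback.of_horiz_isIso ⟨by simp⟩
    exact ⟨MorphismProperty.of_isPullback hp.flip inferInstance, inferInstance, hp⟩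

theorem DefClass.map_ofId_comp_aug [Flat X.hom] (a : DefClass s X A) :
    a.map ((Algebra.ofId k B).comp (aug k A)) = (Deformation.trivial s X B).cls := by
  induction a using DefClass.ind with | h D
  symm
  refine Deformation.cls_eq_of_isPullback (f := pullback.fst _ _ ≫ D.incl) ?_ ?_
  · rw [prodSpecMap_ofId_comp_aug]
    exact (IsPullback.of_hasPullback _ _).paste_horiz D.isDeformation.isPullback
  · exact (pullback.lift_fst_assoc _ _ _ _).trans (Category.id_comp _)

theorem Deformation.flat_specialFibre (D : Deformation s X A) : Flat X.hom :=
  have := D.isDeformation.flat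
  MorphismProperty.of_isPullback D.isDeformation.isPullback inferInstance

end Functoriality

section PullbackOfRings

variable {R R₁ R₂ R₀ : CommRingCat.{u}} {p₁ : R ⟶ R₁} {p₂ : R ⟶ R₂} {q₁ : R₁ ⟶ R₀} {q₂ : R₂ ⟶ R₀}

theorem isPullback_commRingCat (w : p₁ ≫ q₁ = p₂ ≫ q₂)
    (hext : ∀ a b : R, p₁ a = p₁ b → p₂ a = p₂ b → a = b)
    (hex : ∀ a₁ a₂, q₁ a₁ = q₂ a₂ → ∃ a, p₁ a = a₁ ∧ p₂ a = a₂) : IsPullback p₁ p₂ q₁ q₂ := by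
  refine IsPullback.of_map (forget CommRingCat) w ((Types.isPullback_iff _ _ _ _).mpr ⟨?_, ?_, hex⟩)
  · rw [← Functor.map_comp, w, Functor.map_comp]
  · exact fun a b h ↦ hext a b h.1 h.2

theorem exists_of_isPullback_commRingCat (h : IsPullback p₁ p₂ q₁ q₂) {a₁ : R₁} {a₂ : R₂}
    (ha : q₁ a₁ = q₂ a₂) : ∃ a, p₁ a = a₁ ∧ p₂ a = a₂ :=
  Types.exists_of_isPullback (h.map (forget CommRingCat)) a₁ a₂ ha

theorem eq_of_isPullback_commRingCat (h : IsPullback p₁ p₂ q₁ q₂) {a b : R} (h₁ : p₁ a = p₁ b)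
    (h₂ : p₂ a = p₂ b) : a = b :=
  Types.ext_of_isPullback (h.map (forget CommRingCat)) h₁ h₂

end PullbackOfRings

section SectionsAlongMorphisms

variable {X Y : Scheme.{u}}

theorem app_presheaf_map_apply (f : X ⟶ Y) {U V : Y.Opens} (h : V ≤ U) (a : Γ(Y, U)) :
    f.app V (Y.presheaf.map (homOfLE h).op a) =
      X.presheaf.map (homOfLE (f.preimage_mono h)).op (f.app U a) :=
  congr($(f.naturality (homOfLE h).op).hom a)

theorem appLE_congr_hom {f g : X ⟶ Y} (h : f = g) {U : Y.Opens} {V : X.Opens}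
    (e : V ≤ f ⁻¹ᵁ U) (e' : V ≤ g ⁻¹ᵁ U) : f.appLE U V e = g.appLE U V e' := by
  subst h
  rfl

theorem app_presheaf_map_inf_eq (f : X ⟶ Y) {U V W : Y.Opens} (hV : V ≤ U) (hW : W ≤ U)
    {a : Γ(Y, V)} {b : Γ(Y, W)} {c : Γ(X, f ⁻¹ᵁ U)}
    (ha : f.app V a = X.presheaf.map (homOfLE (f.preimage_mono hV)).op c)
    (hb : f.app W b = X.presheaf.map (homOfLE (f.preimage_mono hW)).op c) :
    f.app (V ⊓ W) (Y.presheaf.map (homOfLE inf_le_left).op a) =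
      f.app (V ⊓ W) (Y.presheaf.map (homOfLE inf_le_right).op b) := by
  rw [app_presheaf_map_apply, app_presheaf_map_apply, ha, hb, ← ConcreteCategory.comp_apply,
    ← ConcreteCategory.comp_apply, ← Functor.map_comp, ← Functor.map_comp]
  rfl

theorem app_eq_of_forall_presheaf_map_eq (f : X ⟶ Y) {ι : Type*} {U : Y.Opens} {W : ι → Y.Opens}
    (hWU : ∀ i, W i ≤ U) (hcov : U ≤ iSup W) {a : ∀ i, Γ(Y, W i)} {b : Γ(Y, U)}
    {c : Γ(X, f ⁻¹ᵁ U)} (hb : ∀ i, Y.presheaf.map (homOfLE (hWU i)).op b = a i)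
    (ha : ∀ i, f.app (W i) (a i) = X.presheaf.map (homOfLE (f.preimage_mono (hWU i))).op c) :
    f.app U b = c := by
  refine X.sheaf.eq_of_locally_eq' (fun i ↦ f ⁻¹ᵁ W i) _
    (fun i ↦ homOfLE (f.preimage_mono (hWU i))) (fun x hx ↦ ?_) _ _ fun i ↦ ?_
  · obtain ⟨i, hi⟩ := Opens.mem_iSup.mp (hcov hx)
    exact Opens.mem_iSup.mpr ⟨i, hi⟩
  · exact (app_presheaf_map_apply f (hWU i) b).symm.trans ((congrArg _ (hb i)).trans (ha i))

end SectionsAlongMorphisms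

section Pushout

variable {X D₁ D₂ Z : Scheme.{u}}

/-- A Milnor square over the open `W` of `Z`: the sections of `Z` over `W` are the pairs of
sections of `D₁` and `D₂` that agree on `X`. Agreement is tested on all opens `Q` contained in both
preimages of `W`, so that the notion makes sense without assuming `j₁ ≫ i₁ = j₂ ≫ i₂`. -/
structure IsMilnorSquareOn (j₁ : X ⟶ D₁) (j₂ : X ⟶ D₂) (i₁ : D₁ ⟶ Z) (i₂ : D₂ ⟶ Z) (W : Z.Opens) :
    Prop where
  ext : ∀ a b : Γ(Z, W), i₁.app W a = i₁.app W b → i₂.app W a = i₂.app W b → a = b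
  exists_app_eq : ∀ (a₁ : Γ(D₁, i₁ ⁻¹ᵁ W)) (a₂ : Γ(D₂, i₂ ⁻¹ᵁ W)),
    (∀ (Q : X.Opens) (h₁ : Q ≤ j₁ ⁻¹ᵁ i₁ ⁻¹ᵁ W) (h₂ : Q ≤ j₂ ⁻¹ᵁ i₂ ⁻¹ᵁ W),
      j₁.appLE _ Q h₁ a₁ = j₂.appLE _ Q h₂ a₂) → ∃ a, i₁.app W a = a₁ ∧ i₂.app W a = a₂

variable {j₁ : X ⟶ D₁} {j₂ : X ⟶ D₂} {i₁ : D₁ ⟶ Z} {i₂ : D₂ ⟶ Z}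

theorem app_ext_of_basis (hb : ∀ O : Z.Opens, ∀ z ∈ O, ∃ W ≤ O, z ∈ W ∧
      ∀ a b : Γ(Z, W), i₁.app W a = i₁.app W b → i₂.app W a = i₂.app W b → a = b)
    {U : Z.Opens} {a b : Γ(Z, U)} (h₁ : i₁.app U a = i₁.app U b) (h₂ : i₂.app U a = i₂.app U b) :
    a = b := by
  choose W hWU hzW hW using fun z : U ↦ hb U z.1 z.2
  refine Z.sheaf.eq_of_locally_eq' W U (fun z ↦ homOfLE (hWU z))
    (fun z hz ↦ Opens.mem_iSup.mpr ⟨⟨z, hz⟩, hzW _⟩) _ _ fun z ↦ hW z _ _ ?_ ?_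
  · exact (app_presheaf_map_apply i₁ _ _).trans
      ((congrArg _ h₁).trans (app_presheaf_map_apply i₁ _ _).symm)
  · exact (app_presheaf_map_apply i₂ _ _).trans
      ((congrArg _ h₂).trans (app_presheaf_map_apply i₂ _ _).symm)

theorem IsMilnorSquareOn.of_basis
    (hb : ∀ O : Z.Opens, ∀ z ∈ O, ∃ W ≤ O, z ∈ W ∧ IsMilnorSquareOn j₁ j₂ i₁ i₂ W) (U : Z.Opens) :
    IsMilnorSquareOn j₁ j₂ i₁ i₂ U := by
  have hext {O : Z.Opens} {a b : Γ(Z, O)} :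
      i₁.app O a = i₁.app O b → i₂.app O a = i₂.app O b → a = b :=
    app_ext_of_basis fun O z hz ↦ (hb O z hz).imp fun _ h ↦ ⟨h.1, h.2.1, h.2.2.ext⟩
  refine ⟨fun _ _ ↦ hext, fun a₁ a₂ h ↦ ?_⟩
  choose W hWU hzW hW using fun z : U ↦ hb U z.1 z.2
  have hcov : U ≤ iSup W := fun z hz ↦ Opens.mem_iSup.mpr ⟨⟨z, hz⟩, hzW _⟩
  have exists_local (z : U) : ∃ a : Γ(Z, W z),
      i₁.app (W z) a = D₁.presheaf.map (homOfLE (i₁.preimage_mono (hWU z))).op a₁ ∧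
      i₂.app (W z) a = D₂.presheaf.map (homOfLE (i₂.preimage_mono (hWU z))).op a₂ := by
    refine (hW z).exists_app_eq _ _ fun Q h₁ h₂ ↦ ?_
    have e₁ := congr($(j₁.map_appLE h₁ (homOfLE (i₁.preimage_mono (hWU z))).op).hom a₁)
    have e₂ := congr($(j₂.map_appLE h₂ (homOfLE (i₂.preimage_mono (hWU z))).op).hom a₂)
    exact e₁.trans ((h Q _ _).trans e₂.symm)
  choose a ha₁ ha₂ using exists_local
  obtain ⟨b, hb, -⟩ := Z.sheaf.existsUnique_gluing' W U (fun z ↦ homOfLE (hWU z)) hcov a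
    fun z z' ↦ hext (app_presheaf_map_inf_eq i₁ (hWU z) (hWU z') (ha₁ z) (ha₁ z'))
      (app_presheaf_map_inf_eq i₂ (hWU z) (hWU z') (ha₂ z) (ha₂ z'))
  exact ⟨b, app_eq_of_forall_presheaf_map_eq i₁ hWU hcov hb ha₁,
    app_eq_of_forall_presheaf_map_eq i₂ hWU hcov hb ha₂⟩

theorem preimage_preimage_eq (w : j₁ ≫ i₁ = j₂ ≫ i₂) (W : Z.Opens) :
    j₁ ⁻¹ᵁ i₁ ⁻¹ᵁ W = j₂ ⁻¹ᵁ i₂ ⁻¹ᵁ W := by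
  rw [← Scheme.Hom.comp_preimage, w, Scheme.Hom.comp_preimage]

theorem IsMilnorSquareOn.isPullback {W : Z.Opens} (h : IsMilnorSquareOn j₁ j₂ i₁ i₂ W)
    (w : j₁ ≫ i₁ = j₂ ≫ i₂) :
    IsPullback (i₁.app W) (i₂.app W) (j₁.appLE (i₁ ⁻¹ᵁ W) (j₁ ⁻¹ᵁ i₁ ⁻¹ᵁ W) le_rfl)
      (j₂.appLE (i₂ ⁻¹ᵁ W) (j₁ ⁻¹ᵁ i₁ ⁻¹ᵁ W) (preimage_preimage_eq w W).le) := by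
  refine isPullback_commRingCat ?_ h.ext fun a₁ a₂ ha ↦ h.exists_app_eq a₁ a₂ fun Q h₁ h₂ ↦ ?_
  · exact (Scheme.Hom.comp_appLE ..).symm.trans
      ((appLE_congr_hom w _ _).trans (Scheme.Hom.comp_appLE ..))
  · have e₁ := congr($(j₁.appLE_map (U := i₁ ⁻¹ᵁ W) le_rfl (homOfLE h₁).op).hom a₁)
    have e₂ := congr($(j₂.appLE_map (U := i₂ ⁻¹ᵁ W) (preimage_preimage_eq w W).le
      (homOfLE h₁).op).hom a₂)
    exact e₁.symm.trans ((congrArg _ ha).trans e₂)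

theorem hom_ext_of_app_ext (h₁ : Function.Surjective i₁)
    (hext : ∀ (W : Z.Opens) (a b : Γ(Z, W)),
      i₁.app W a = i₁.app W b → i₂.app W a = i₂.app W b → a = b)
    {T : Scheme.{u}} {f g : Z ⟶ T} (e₁ : i₁ ≫ f = i₁ ≫ g) (e₂ : i₂ ≫ f = i₂ ≫ g) : f = g := by
  have hfg : f.base = g.base := by
    ext z
    obtain ⟨y, rfl⟩ := h₁ z
    exact congr($e₁ y)
  have app_appLE_eq {D : Scheme.{u}} {i : D ⟶ Z} (e : i ≫ f = i ≫ g) {V : T.Opens} {W : Z.Opens}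
      (h : W ≤ f ⁻¹ᵁ V) (h' : W ≤ g ⁻¹ᵁ V) (a : Γ(T, V)) :
      i.app W (f.appLE V W h a) = i.app W (g.appLE V W h' a) := by
    have e := appLE_congr_hom e (U := V) (V := i ⁻¹ᵁ W) (i.preimage_mono h) (i.preimage_mono h')
    rw [← Scheme.Hom.appLE_comp_appLE (e₁ := h) (e₂ := le_rfl),
      ← Scheme.Hom.appLE_comp_appLE (e₁ := h') (e₂ := le_rfl), i.appLE_eq_app] at e
    exact congr(($e).hom a)
  refine Scheme.Hom.ext hfg fun V ↦ ?_
  have appLE_eq : f.appLE V (g ⁻¹ᵁ V) (by rw [hfg]) = g.appLE V (g ⁻¹ᵁ V) le_rfl := by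
    ext a
    exact hext _ _ _ (app_appLE_eq e₁ _ _ a) (app_appLE_eq e₂ _ _ a)
  rw [← g.appLE_eq_app, ← appLE_eq]
  rfl

section Desc

variable {D T : Scheme.{u}} {i : D ⟶ Z} {f : D ⟶ T} {b : (Z : TopCat) ⟶ (T : TopCat)}

theorem preimage_map_le (hb : ∀ y, b (i y) = f y) (V : T.Opens) :
    i ⁻¹ᵁ (Opens.map b).obj V ≤ f ⁻¹ᵁ V := fun y hy ↦ by
  have : b (i y) ∈ V := hy
  rwa [hb] at this

theorem map_comp_app_eq_of_comp_app_eq (hb : ∀ y, b (i y) = f y)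
    {c : ∀ V : T.Opens, Γ(T, V) ⟶ Γ(Z, (Opens.map b).obj V)}
    (hc : ∀ V, c V ≫ i.app _ = f.appLE V _ (preimage_map_le hb V))
    {V V' : T.Opens} (r : V' ⟶ V) :
    (T.presheaf.map r.op ≫ c V') ≫ i.app _ =
      (c V ≫ Z.presheaf.map ((Opens.map b).map r).op) ≫ i.app _ := by
  have hi := i.naturality ((Opens.map b).map r).op
  refine (Category.assoc _ _ _).trans ((congrArg _ (hc V')).trans ?_)
  refine .trans ?_ (Category.assoc _ _ _).symm
  refine .trans ?_ ((congrArg (c V ≫ ·) hi).trans (Category.assoc _ _ _).symm).symm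
  refine .trans ?_ (congrArg (· ≫ _) (hc V)).symm
  exact (f.map_appLE _ _).trans (f.appLE_map _ _).symm

theorem presheafedSpaceHom_comp_eq (hb : ∀ y, b (i y) = f y)
    {c : T.presheaf ⟶ (TopCat.Presheaf.pushforward _ b).obj Z.presheaf}
    (hc : ∀ V : T.Opens, c.app (op V) ≫ i.app _ = f.appLE V _ (preimage_map_le hb V)) :
    (i.toLRSHom.toHom ≫ (⟨b, c⟩ : PresheafedSpace.Hom Z.toPresheafedSpace T.toPresheafedSpace) :
      D.toPresheafedSpace ⟶ T.toPresheafedSpace) = f.toLRSHom.toHom := by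
  refine PresheafedSpace.ext _ _ (by ext y; exact hb y) (TopCat.Presheaf.ext fun V ↦ ?_)
  rw [NatTrans.comp_app, Functor.whiskerRight_app]
  refine .trans (congrArg (· ≫ D.presheaf.map _) (hc V)) ?_
  exact (f.appLE_map _ _).trans f.appLE_eq_app

theorem isLocalHom_stalkMap_of_comp_eq {g : PresheafedSpace.Hom Z.toPresheafedSpace
      T.toPresheafedSpace} (hi : Function.Surjective i)
    (hg : (i.toLRSHom.toHom ≫ g : D.toPresheafedSpace ⟶ T.toPresheafedSpace) = f.toLRSHom.toHom)
    (z : Z) : IsLocalHom (PresheafedSpace.Hom.stalkMap g z).hom := by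
  obtain ⟨y, rfl⟩ := hi z
  have hcomp : IsLocalHom ((i.toLRSHom.toHom ≫ g : D.toPresheafedSpace ⟶
      T.toPresheafedSpace).stalkMap y).hom := by
    rw [hg]
    exact f.toLRSHom.prop y
  rw [PresheafedSpace.stalkMap.comp i.toLRSHom.toHom g y] at hcomp
  exact @isLocalHom_of_comp _ _ _ _ _ _ _
    (PresheafedSpace.Hom.stalkMap i.toLRSHom.toHom y).hom hcomp

end Desc

theorem exists_presheafedSpaceHom_desc (w : j₁ ≫ i₁ = j₂ ≫ i₂)
    (hsq : ∀ W, IsMilnorSquareOn j₁ j₂ i₁ i₂ W) {T : Scheme.{u}} {f₁ : D₁ ⟶ T} {f₂ : D₂ ⟶ T}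
    (hf : j₁ ≫ f₁ = j₂ ≫ f₂) {b : (Z : TopCat) ⟶ (T : TopCat)} (hb₁ : ∀ y, b (i₁ y) = f₁ y)
    (hb₂ : ∀ y, b (i₂ y) = f₂ y) :
    ∃ g : PresheafedSpace.Hom Z.toPresheafedSpace T.toPresheafedSpace,
      (i₁.toLRSHom.toHom ≫ g : D₁.toPresheafedSpace ⟶ _) = f₁.toLRSHom.toHom ∧
      (i₂.toLRSHom.toHom ≫ g : D₂.toPresheafedSpace ⟶ _) = f₂.toLRSHom.toHom := by
  have exists_lift (V : T.Opens) : ∃ l : Γ(T, V) ⟶ Γ(Z, (Opens.map b).obj V),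
      l ≫ i₁.app _ = f₁.appLE V _ (preimage_map_le hb₁ V) ∧
      l ≫ i₂.app _ = f₂.appLE V _ (preimage_map_le hb₂ V) := by
    have hp := (hsq ((Opens.map b).obj V)).isPullback w
    refine ⟨hp.lift _ _ ?_, hp.lift_fst _ _ _, hp.lift_snd _ _ _⟩
    rw [Scheme.Hom.appLE_comp_appLE, Scheme.Hom.appLE_comp_appLE]
    exact appLE_congr_hom hf _ _
  choose l hl₁ hl₂ using exists_lift
  let c : T.presheaf ⟶ (TopCat.Presheaf.pushforward _ b).obj Z.presheaf :=
    { app := fun V ↦ l V.unop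
      naturality := fun _ _ r ↦ ((hsq _).isPullback w).hom_ext
        (map_comp_app_eq_of_comp_app_eq hb₁ hl₁ r.unop)
        (map_comp_app_eq_of_comp_app_eq hb₂ hl₂ r.unop) }
  exact ⟨⟨b, c⟩, presheafedSpaceHom_comp_eq hb₁ hl₁, presheafedSpaceHom_comp_eq hb₂ hl₂⟩

theorem exists_desc_of_isMilnorSquareOn (w : j₁ ≫ i₁ = j₂ ≫ i₂) (h₁ : IsHomeomorph i₁)
    (hj₂ : Function.Surjective j₂) (hsq : ∀ W, IsMilnorSquareOn j₁ j₂ i₁ i₂ W)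
    {T : Scheme.{u}} (f₁ : D₁ ⟶ T) (f₂ : D₂ ⟶ T) (hf : j₁ ≫ f₁ = j₂ ≫ f₂) :
    ∃ h : Z ⟶ T, i₁ ≫ h = f₁ ∧ i₂ ≫ h = f₂ := by
  let e : D₁ ≃ₜ Z := h₁.homeomorph
  let b : (Z : TopCat) ⟶ (T : TopCat) :=
    TopCat.ofHom ⟨f₁ ∘ e.symm, f₁.continuous.comp e.symm.continuous⟩
  have hb₁ (y : D₁) : b (i₁ y) = f₁ y := congrArg f₁ (e.symm_apply_apply y)
  have hb₂ (y : D₂) : b (i₂ y) = f₂ y := by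
    obtain ⟨x, rfl⟩ := hj₂ y
    have hx : i₂ (j₂ x) = i₁ (j₁ x) := congr($(w.symm) x)
    rw [hx, hb₁]
    exact congr($hf x)
  obtain ⟨g, hg₁, hg₂⟩ := exists_presheafedSpaceHom_desc w hsq hf hb₁ hb₂
  exact ⟨⟨⟨g, isLocalHom_stalkMap_of_comp_eq h₁.surjective hg₁⟩⟩,
    Scheme.Hom.ext' (LocallyRingedSpace.Hom.ext' hg₁),
    Scheme.Hom.ext' (LocallyRingedSpace.Hom.ext' hg₂)⟩

theorem isPushout_of_isMilnorSquareOn (w : j₁ ≫ i₁ = j₂ ≫ i₂) (h₁ : IsHomeomorph i₁)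
    (hj₂ : Function.Surjective j₂) (hsq : ∀ W, IsMilnorSquareOn j₁ j₂ i₁ i₂ W) :
    IsPushout j₁ j₂ i₁ i₂ := by
  have exists_desc (c : PushoutCocone j₁ j₂) : ∃ h : Z ⟶ c.pt, i₁ ≫ h = c.inl ∧ i₂ ≫ h = c.inr :=
    exists_desc_of_isMilnorSquareOn w h₁ hj₂ hsq c.inl c.inr c.condition
  choose desc inl_desc inr_desc using exists_desc
  exact ⟨⟨w⟩, ⟨PushoutCocone.IsColimit.mk w desc inl_desc inr_desc fun c _ hm₁ hm₂ ↦
    hom_ext_of_app_ext h₁.surjective (fun W ↦ (hsq W).ext) (hm₁.trans (inl_desc c).symm)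
      (hm₂.trans (inr_desc c).symm)⟩⟩

end Pushout

section LocalCriterion

open TensorProduct

theorem rTensor_injective_of_isTorsionBySet {C M N N' : Type*} [CommRing C] {I : Ideal C}
    [AddCommGroup M] [Module C M] [AddCommGroup N] [Module C N] [AddCommGroup N'] [Module C N']
    (h : Module.Flat (C ⧸ I) ((C ⧸ I) ⊗[C] M)) (hN : Module.IsTorsionBySet C N I)
    (f : N' →ₗ[C] N) (hf : Function.Injective f) : Function.Injective (f.rTensor M) := by
  have hN' : Module.IsTorsionBySet C N' I := fun n c ↦ hf (by rw [map_smul, hN, map_zero])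
  let := hN.module
  let := hN'.module
  let f' : N' →ₗ[C ⧸ I] N := LinearMap.extendScalarsOfSurjective Ideal.Quotient.mk_surjective f
  have hf' : Function.Injective (f'.rTensor ((C ⧸ I) ⊗[C] M)) :=
    Module.Flat.rTensor_preserves_injective_linearMap f' hf
  let e := AlgebraTensorModule.cancelBaseChange C (C ⧸ I) (C ⧸ I) N M
  let e' := AlgebraTensorModule.cancelBaseChange C (C ⧸ I) (C ⧸ I) N' M
  have he : ∀ x, f.rTensor M x = e (f'.rTensor ((C ⧸ I) ⊗[C] M) (e'.symm x)) := by
    intro x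
    induction x with
    | zero => simp
    | add x y hx hy => rw [map_add, hx, hy, map_add, map_add, map_add]
    | tmul n m =>
      simp only [e', e, LinearMap.rTensor_tmul, AlgebraTensorModule.cancelBaseChange_symm_tmul,
        AlgebraTensorModule.cancelBaseChange_tmul, one_smul]
      rfl
  intro x y hxy
  rw [he, he] at hxy
  exact e'.symm.injective (hf' (e.injective hxy))

theorem exact_inclusion_inf_rangeRestrict {C : Type*} [CommRing C] (J I : Ideal C) :
    Function.Exact (Submodule.inclusion (inf_le_left : J ⊓ I ≤ J))
      (I.mkQ ∘ₗ J.subtype).rangeRestrict := fun x ↦ by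
  constructor
  · intro hx
    have hxI : (x : C) ∈ I := (Submodule.Quotient.mk_eq_zero I).mp (congrArg Subtype.val hx)
    exact ⟨⟨x, x.2, hxI⟩, rfl⟩
  · rintro ⟨y, rfl⟩
    exact Subtype.ext ((Submodule.Quotient.mk_eq_zero I).mpr y.2.2)

theorem flat_of_mul_self_eq_bot {C M : Type*} [CommRing C] [AddCommGroup M] [Module C M]
    {I : Ideal C} (hI : I * I = ⊥) (h : Module.Flat (C ⧸ I) ((C ⧸ I) ⊗[C] M))
    (hinj : Function.Injective (I.subtype.rTensor M)) : Module.Flat C M := by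
  have hI' : Module.IsTorsionBySet C I I := fun x c ↦
    Subtype.ext ((Submodule.mem_bot C).mp (hI ▸ Ideal.mul_mem_mul c.2 x.2))
  have hq : Module.IsTorsionBySet C (C ⧸ I) I :=
    (Module.isTorsionBySet_quotient_iff I I).mpr fun x c hc ↦ I.mul_mem_right x hc
  -- Both `J ⊓ I` and the image of `J` in `C ⧸ I` are modules over `C ⧸ I`, where `M` is flat.
  refine Module.Flat.iff_rTensor_injective.mpr fun J _ ↦
    (injective_iff_map_eq_zero _).mpr fun x hx ↦ ?_
  let q : J →ₗ[C] C ⧸ I := I.mkQ ∘ₗ J.subtype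
  have hqx : q.rangeRestrict.rTensor M x = 0 := by
    apply rTensor_injective_of_isTorsionBySet h hq (LinearMap.range q).subtype
      Subtype.val_injective
    rw [map_zero, ← LinearMap.comp_apply, ← LinearMap.rTensor_comp]
    change (I.mkQ ∘ₗ J.subtype).rTensor M x = 0
    rw [LinearMap.rTensor_comp, LinearMap.comp_apply, hx, map_zero]
  obtain ⟨y, rfl⟩ := (rTensor_exact M (exact_inclusion_inf_rangeRestrict J I)
    q.surjective_rangeRestrict x).mp hqx
  have hy : (Submodule.inclusion (inf_le_right : J ⊓ I ≤ I)).rTensor M y = 0 := by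
    apply hinj
    rw [map_zero, ← LinearMap.comp_apply, ← LinearMap.rTensor_comp]
    rwa [← LinearMap.comp_apply, ← LinearMap.rTensor_comp] at hx
  rw [rTensor_injective_of_isTorsionBySet h hI' _ (Submodule.inclusion_injective _)
    (hy.trans (map_zero _).symm), map_zero]

theorem exists_eq_sum_tmul {C M N ι : Type*} [CommRing C] [AddCommGroup M] [Module C M]
    [AddCommGroup N] [Module C N] [Fintype ι] {n : ι → N}
    (hn : Submodule.span C (Set.range n) = ⊤) (x : N ⊗[C] M) :
    ∃ m : ι → M, x = ∑ i, n i ⊗ₜ m i := by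
  induction x with
  | zero => exact ⟨0, by simp⟩
  | add x y hx hy =>
    obtain ⟨m, rfl⟩ := hx
    obtain ⟨m', rfl⟩ := hy
    exact ⟨m + m', by simp [tmul_add, Finset.sum_add_distrib]⟩
  | tmul a m =>
    obtain ⟨c, rfl⟩ := (Submodule.mem_span_range_iff_exists_fun C).mp
      (hn ▸ Submodule.mem_top : a ∈ Submodule.span C (Set.range n))
    exact ⟨fun i ↦ c i • m, by simp [sum_tmul, smul_tmul]⟩

theorem tmul_eq_zero_of_mem_map {C R N : Type*} [CommRing C] [CommRing R] [Algebra C R]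
    [AddCommGroup N] [Module C N] {I : Ideal C} {n : N} (hn : ∀ c ∈ I, c • n = 0) {r : R}
    (hr : r ∈ I.map (algebraMap C R)) : n ⊗ₜ[C] r = 0 := by
  induction hr using Submodule.span_induction with
  | mem _ h =>
    obtain ⟨c, hc, rfl⟩ := h
    rw [Algebra.algebraMap_eq_smul_one, ← smul_tmul, hn c hc, zero_tmul]
  | zero => exact tmul_zero _ _
  | add _ _ _ _ h₁ h₂ => rw [tmul_add, h₁, h₂, add_zero]
  | smul a r _ h =>
    rw [smul_eq_mul, ← LinearMap.mulLeft_apply C, ← LinearMap.lTensor_tmul, h, map_zero]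

theorem map_inf_map_eq_bot_of_flat {C R : Type*} [CommRing C] [CommRing R] {f : C →+* R}
    (hf : f.Flat) {I J : Ideal C} (h : I ⊓ J = ⊥) : I.map f ⊓ J.map f = ⊥ := by
  algebraize [f]
  let g : C →ₗ[C] (C ⧸ I) × (C ⧸ J) := I.mkQ.prod J.mkQ
  have hg : Function.Injective g := by
    rw [← LinearMap.ker_eq_bot, LinearMap.ker_prod, Submodule.ker_mkQ, Submodule.ker_mkQ, h]
  rw [eq_bot_iff]
  rintro r ⟨hI, hJ⟩
  have hI : ((Ideal.Quotient.mk I 1, 0) : (C ⧸ I) × (C ⧸ J)) ⊗ₜ[C] r = 0 :=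
    tmul_eq_zero_of_mem_map (fun c hc ↦ by
      simpa [Algebra.smul_def] using Ideal.Quotient.eq_zero_iff_mem.mpr hc) hI
  have hJ : ((0, Ideal.Quotient.mk J 1) : (C ⧸ I) × (C ⧸ J)) ⊗ₜ[C] r = 0 :=
    tmul_eq_zero_of_mem_map (fun c hc ↦ by
      simpa [Algebra.smul_def] using Ideal.Quotient.eq_zero_iff_mem.mpr hc) hJ
  have h₀ : g.rTensor R (1 ⊗ₜ r) = g.rTensor R 0 := by
    have h₁ : g 1 = (Ideal.Quotient.mk I 1, 0) + (0, Ideal.Quotient.mk J 1) := by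
      rw [Prod.mk_add_mk, add_zero, zero_add]; rfl
    rw [LinearMap.rTensor_tmul, h₁, add_tmul, hI, hJ, add_zero, map_zero]
  have h₁ := Module.Flat.rTensor_preserves_injective_linearMap (M := R) g hg h₀
  simpa using congrArg (TensorProduct.lid C R) h₁

theorem flat_quotient_tensorProduct {C R C₀ R₀ : Type*} [CommRing C] [CommRing R] [CommRing C₀]
    [CommRing R₀] [Algebra C R] {φ₀ : C₀ →+* R₀} {q : C →+* C₀} {p : R →+* R₀}
    (w : p.comp (algebraMap C R) = φ₀.comp q) (hφ₀ : φ₀.Flat) (hq : Function.Surjective q)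
    (hp : Function.Surjective p) {I : Ideal C} (hkq : RingHom.ker q = I)
    (hkp : RingHom.ker p = I.map (algebraMap C R)) :
    Module.Flat (C ⧸ I) ((C ⧸ I) ⊗[C] R) := by
  let eC : C ⧸ I ≃+* C₀ :=
    (Ideal.quotEquivOfEq hkq.symm).trans (RingHom.quotientKerEquivOfSurjective hq)
  let eR : R ⧸ I.map (algebraMap C R) ≃+* R₀ :=
    (Ideal.quotEquivOfEq hkp.symm).trans (RingHom.quotientKerEquivOfSurjective hp)
  have h : algebraMap (C ⧸ I) (R ⧸ I.map (algebraMap C R)) =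
      (eR.symm.toRingHom.comp φ₀).comp eC.toRingHom := by
    ext c
    exact eR.injective (.trans (congr($w c) :) (eR.apply_symm_apply _).symm)
  have : Module.Flat (C ⧸ I) (R ⧸ I.map (algebraMap C R)) := by
    rw [← RingHom.flat_algebraMap_iff, h]
    exact .comp (.of_bijective eC.bijective) (.comp hφ₀ (.of_bijective eR.symm.bijective))
  exact .of_linearEquiv (Algebra.TensorProduct.quotIdealMapEquivQuotTensor R I).symm.toLinearEquiv

theorem rTensor_injective_of_forall_relation {C R ι : Type*} [CommRing C] [CommRing R]
    [Algebra C R] [Fintype ι] {ε : ι → C} (hε : ∀ i j, ε i * ε j = 0)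
    (hrel : ∀ r : ι → R, ∑ i, algebraMap C R (ε i) * r i = 0 →
      ∀ i, r i ∈ (Ideal.span (Set.range ε)).map (algebraMap C R)) :
    Function.Injective ((Ideal.span (Set.range ε)).subtype.rTensor R) := by
  refine (injective_iff_map_eq_zero _).mpr fun x hx ↦ ?_
  have hspan : Submodule.span C (Set.range fun i ↦
      (⟨ε i, Ideal.subset_span ⟨i, rfl⟩⟩ : Ideal.span (Set.range ε))) = ⊤ := by
    refine eq_top_iff.mpr fun ⟨y, hy⟩ _ ↦ ?_
    obtain ⟨c, hc⟩ := Ideal.mem_span_range_iff_exists_fun.mp hy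
    exact (Submodule.mem_span_range_iff_exists_fun C).mpr ⟨c, Subtype.ext (by simpa using hc)⟩
  obtain ⟨r, rfl⟩ := exists_eq_sum_tmul hspan x
  have hr : ∑ i, algebraMap C R (ε i) * r i = 0 := by
    simpa [Algebra.smul_def] using congrArg (TensorProduct.lid C R) hx
  refine Finset.sum_eq_zero fun i _ ↦ tmul_eq_zero_of_mem_map (fun c hc ↦ ?_) (hrel r hr i)
  obtain ⟨d, rfl⟩ := Ideal.mem_span_range_iff_exists_fun.mp hc
  exact Subtype.ext (by simp [Finset.sum_mul, mul_assoc, hε])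

theorem flat_of_forall_relation {C R C₀ R₀ ι : Type*} [CommRing C] [CommRing R] [CommRing C₀]
    [CommRing R₀] [Fintype ι] {φ : C →+* R} {φ₀ : C₀ →+* R₀} {q : C →+* C₀} {p : R →+* R₀}
    (w : p.comp φ = φ₀.comp q) (hφ₀ : φ₀.Flat) (hq : Function.Surjective q)
    (hp : Function.Surjective p) {ε : ι → C} (hε : ∀ i j, ε i * ε j = 0)
    (hkq : RingHom.ker q = Ideal.span (Set.range ε))
    (hkp : RingHom.ker p ≤ Ideal.span (Set.range fun i ↦ φ (ε i)))
    (hrel : ∀ r : ι → R, ∑ i, φ (ε i) * r i = 0 → ∀ i, p (r i) = 0) : φ.Flat := by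
  algebraize [φ]
  have hmap : (Ideal.span (Set.range ε)).map φ = Ideal.span (Set.range fun i ↦ φ (ε i)) := by
    rw [Ideal.map_span, ← Set.range_comp]
    rfl
  have hkp' : RingHom.ker p = (Ideal.span (Set.range ε)).map φ := by
    refine le_antisymm (hmap ▸ hkp) (Ideal.map_le_iff_le_comap.mpr fun c hc ↦ ?_)
    rw [← hkq, RingHom.mem_ker] at hc
    rw [Ideal.mem_comap, RingHom.mem_ker, ← RingHom.comp_apply, w, RingHom.comp_apply, hc, map_zero]
  refine flat_of_mul_self_eq_bot ?_ (flat_quotient_tensorProduct w hφ₀ hq hp hkq hkp')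
    (rTensor_injective_of_forall_relation hε fun r hr i ↦ ?_)
  · rw [Ideal.span_mul_span', eq_bot_iff, Ideal.span_le]
    rintro _ ⟨_, ⟨i, rfl⟩, _, ⟨j, rfl⟩, rfl⟩
    exact hε i j
  · exact hkp'.le (hrel r hr i)

end LocalCriterion

section FibreProductOfRings

variable {R R₁ R₂ R₀ : Type*} [CommRing R] [CommRing R₁] [CommRing R₂] [CommRing R₀]
  {p₁ : R →+* R₁} {p₂ : R →+* R₂} {q₁ : R₁ →+* R₀} {q₂ : R₂ →+* R₀}

theorem surjective_fst_of_fibreProduct (hex : ∀ a₁ a₂, q₁ a₁ = q₂ a₂ → ∃ a, p₁ a = a₁ ∧ p₂ a = a₂)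
    (hq₂ : Function.Surjective q₂) : Function.Surjective p₁ := fun a₁ ↦ by
  obtain ⟨a₂, h⟩ := hq₂ (q₁ a₁)
  obtain ⟨a, h, -⟩ := hex a₁ a₂ h.symm
  exact ⟨a, h⟩

theorem ker_fst_le_of_fibreProduct (hw : q₁.comp p₁ = q₂.comp p₂)
    (hext : ∀ a b, p₁ a = p₁ b → p₂ a = p₂ b → a = b) (hp₂ : Function.Surjective p₂) {I : Ideal R}
    (hI : I ≤ RingHom.ker p₁) (hk₂ : RingHom.ker q₂ ≤ I.map p₂) : RingHom.ker p₁ ≤ I := by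
  intro a ha
  rw [RingHom.mem_ker] at ha
  have h : p₂ a ∈ RingHom.ker q₂ := by
    rw [RingHom.mem_ker, ← RingHom.comp_apply, ← hw, RingHom.comp_apply, ha, map_zero]
  obtain ⟨b, hb, hab⟩ := (Ideal.mem_map_iff_of_surjective p₂ hp₂).mp (hk₂ h)
  rwa [hext a b (ha.trans (hI hb).symm) hab.symm]

theorem exists_of_ker_comp_le_sup (hw : q₁.comp p₁ = q₂.comp p₂) (hp₁ : Function.Surjective p₁)
    (hp₂ : Function.Surjective p₂)
    (hk : RingHom.ker (q₁.comp p₁) ≤ RingHom.ker p₁ ⊔ RingHom.ker p₂) (a₁ : R₁) (a₂ : R₂)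
    (h : q₁ a₁ = q₂ a₂) : ∃ a, p₁ a = a₁ ∧ p₂ a = a₂ := by
  obtain ⟨a₁, rfl⟩ := hp₁ a₁
  obtain ⟨a₂, rfl⟩ := hp₂ a₂
  have h' : a₁ - a₂ ∈ RingHom.ker (q₁.comp p₁) := by
    rw [RingHom.mem_ker, map_sub, RingHom.comp_apply, h, hw, RingHom.comp_apply, sub_self]
  obtain ⟨c₁, hc₁, c₂, hc₂, hc⟩ := Submodule.mem_sup.mp (hk h')
  refine ⟨a₁ - c₁, by rw [map_sub, (hc₁ : p₁ c₁ = 0), sub_zero], ?_⟩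
  have ha : a₁ - c₁ = a₂ + c₂ := by linear_combination -hc
  rw [ha, map_add, (hc₂ : p₂ c₂ = 0), add_zero]

theorem eq_zero_of_sum_eq_zero_of_fibreProduct {ι₁ ι₂ : Type*} [Fintype ι₁] [Fintype ι₂]
    {t : ι₁ ⊕ ι₂ → R} (hw : q₁.comp p₁ = q₂.comp p₂) (ht₁ : ∀ j, p₁ (t (.inr j)) = 0)
    (ht₂ : ∀ i, p₂ (t (.inl i)) = 0)
    (hrel₁ : ∀ r : ι₁ → R₁, ∑ i, p₁ (t (.inl i)) * r i = 0 → ∀ i, q₁ (r i) = 0)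
    (hrel₂ : ∀ r : ι₂ → R₂, ∑ j, p₂ (t (.inr j)) * r j = 0 → ∀ j, q₂ (r j) = 0)
    {r : ι₁ ⊕ ι₂ → R} (hr : ∑ x, t x * r x = 0) (x : ι₁ ⊕ ι₂) : q₁.comp p₁ (r x) = 0 := by
  rw [Fintype.sum_sum_type] at hr
  match x with
  | .inl i => exact hrel₁ (fun i ↦ p₁ (r (.inl i))) (by simpa [ht₁] using congrArg p₁ hr) i
  | .inr j =>
    rw [hw]
    exact hrel₂ (fun j ↦ p₂ (r (.inr j))) (by simpa [ht₂] using congrArg p₂ hr) j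

end FibreProductOfRings

section SquareZero

open TrivSqZeroExt

variable {k V ι : Type*} [Field k] [AddCommGroup V] [Module k V] [Module kᵐᵒᵖ V]
  [IsCentralScalar k V]

theorem ker_fstHom_eq_span {v : ι → V} (hv : Submodule.span k (Set.range v) = ⊤) :
    RingHom.ker (fstHom k k V) =
      Ideal.span (Set.range fun i ↦ (inr (v i) : TrivSqZeroExt k V)) := by
  apply le_antisymm
  · intro x hx
    have hx' : x.snd ∈ Submodule.span k (Set.range v) := hv ▸ Submodule.mem_top
    rw [← inl_fst_add_inr_snd_eq x, show x.fst = 0 from hx, inl_zero, zero_add]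
    generalize x.snd = y at hx'
    induction hx' using Submodule.span_induction with
    | mem _ h => exact Ideal.subset_span (h.imp fun _ ↦ congrArg inr)
    | zero => exact (inr_zero k (M := V)).symm ▸ Ideal.zero_mem _
    | add m m' _ _ h₁ h₂ => exact inr_add k m m' ▸ Ideal.add_mem _ h₁ h₂
    | smul c m _ h => exact inl_mul_inr c m ▸ Ideal.mul_mem_left _ _ h
  · rw [Ideal.span_le]
    rintro _ ⟨i, rfl⟩
    exact fst_inr k (v i)

theorem mem_map_ker_fstHom_of_flat_of_sum_eq_zero [Fintype ι] {v : ι → V}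
    (hv : LinearIndependent k v) {R : Type*} [CommRing R] {f : TrivSqZeroExt k V →+* R}
    (hf : f.Flat) {r : ι → R} (hr : ∑ i, f (inr (v i)) * r i = 0) (i : ι) :
    r i ∈ (RingHom.ker (fstHom k k V)).map f := by
  algebraize [f]
  obtain ⟨κ, a, y, hra, ha⟩ := Module.Flat.isTrivialRelation_of_sum_smul_eq_zero
    (R := TrivSqZeroExt k V) (f := fun i ↦ inr (v i)) (x := r) hr
  rw [hra]
  refine Ideal.sum_mem _ fun j _ ↦ Ideal.mul_mem_right _ _ (Ideal.mem_map_of_mem f ?_)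
  refine Fintype.linearIndependent_iff.mp hv (fun i ↦ (a i j).fst) ?_ i
  have hj := congrArg (sndHom k V) (ha j)
  rw [map_sum, map_zero] at hj
  exact .trans (Finset.sum_congr rfl fun i _ ↦ by simp) hj

end SquareZero

/-- The ring homomorphism `φ` is a localization at the powers of `f`: an unbundled, elementwise form
of `IsLocalization.Away` for which no algebra structure has to be fixed. -/
structure IsAway {R S : Type*} [CommRing R] [CommRing S] (φ : R →+* S) (f : R) : Prop where
  isUnit : IsUnit (φ f)
  surj : ∀ s, ∃ (n : ℕ) (a : R), s * φ f ^ n = φ a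
  exists_pow_mul : ∀ a, φ a = 0 → ∃ n : ℕ, f ^ n * a = 0

theorem IsAway.of_isLocalization {R S : Type*} [CommRing R] [CommRing S] [Algebra R S] (f : R)
    [IsLocalization.Away f S] : IsAway (algebraMap R S) f := by
  refine ⟨IsLocalization.Away.algebraMap_isUnit f, fun s ↦ ?_, fun a ha ↦ ?_⟩
  · obtain ⟨n, a, h⟩ := IsLocalization.Away.surj f s
    exact ⟨n, a, h⟩
  · obtain ⟨⟨_, n, rfl⟩, h⟩ := (IsLocalization.map_eq_zero_iff (.powers f) S a).mp ha
    exact ⟨n, h⟩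

theorem IsAway.isOpenImmersion {R S : CommRingCat.{u}} {φ : R ⟶ S} {f : R}
    (h : IsAway φ.hom f) : IsOpenImmersion (Spec.map φ) := by
  algebraize [φ.hom]
  have : IsLocalization.Away f S := by
    refine IsLocalization.Away.mk f h.isUnit h.surj fun a b hab ↦ ?_
    obtain ⟨n, hn⟩ := h.exists_pow_mul (a - b) (by rw [map_sub, sub_eq_zero]; exact hab)
    exact ⟨n, by rwa [mul_sub, sub_eq_zero] at hn⟩
  exact IsOpenImmersion.of_isLocalization f

section LocalizationOfFibreProduct

variable {R R₁ R₂ R₀ R' R₁' R₂' R₀' : Type*} [CommRing R] [CommRing R₁] [CommRing R₂]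
  [CommRing R₀] [CommRing R'] [CommRing R₁'] [CommRing R₂'] [CommRing R₀']
  {p₁ : R →+* R₁} {p₂ : R →+* R₂} {q₁ : R₁ →+* R₀} {q₂ : R₂ →+* R₀}
  {p₁' : R' →+* R₁'} {p₂' : R' →+* R₂'} {q₁' : R₁' →+* R₀'} {q₂' : R₂' →+* R₀'}
  {ρ : R →+* R'} {ρ₁ : R₁ →+* R₁'} {ρ₂ : R₂ →+* R₂'} {ρ₀ : R₀ →+* R₀'}

theorem isUnit_of_fibreProduct (hw : ∀ a, q₁' (p₁' a) = q₂' (p₂' a))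
    (hext : ∀ a b, p₁' a = p₁' b → p₂' a = p₂' b → a = b)
    (hex : ∀ a₁ a₂, q₁' a₁ = q₂' a₂ → ∃ a, p₁' a = a₁ ∧ p₂' a = a₂) {a : R'}
    (h₁ : IsUnit (p₁' a)) (h₂ : IsUnit (p₂' a)) : IsUnit a := by
  obtain ⟨u₁, hu₁⟩ := h₁.exists_right_inv
  obtain ⟨u₂, hu₂⟩ := h₂.exists_right_inv
  have hu : q₁' u₁ = q₂' u₂ := (h₁.map q₁').mul_left_cancel (by
    rw [← map_mul, hu₁, map_one, hw, ← map_mul, hu₂, map_one])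
  obtain ⟨u, rfl, rfl⟩ := hex u₁ u₂ hu
  exact .of_mul_eq_one u (hext _ _ (by rw [map_mul, hu₁, map_one]) (by rw [map_mul, hu₂, map_one]))

theorem exists_mul_pow_eq_of_fibreProduct
    (hw : ∀ a, q₁ (p₁ a) = q₂ (p₂ a)) (hw' : ∀ a, q₁' (p₁' a) = q₂' (p₂' a))
    (hex : ∀ a₁ a₂, q₁ a₁ = q₂ a₂ → ∃ a, p₁ a = a₁ ∧ p₂ a = a₂)
    (hext : ∀ a b, p₁' a = p₁' b → p₂' a = p₂' b → a = b)
    (hρ₁ : ∀ a, p₁' (ρ a) = ρ₁ (p₁ a)) (hρ₂ : ∀ a, p₂' (ρ a) = ρ₂ (p₂ a))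
    (hσ₁ : ∀ a, q₁' (ρ₁ a) = ρ₀ (q₁ a)) (hσ₂ : ∀ a, q₂' (ρ₂ a) = ρ₀ (q₂ a)) {f : R}
    (h₁ : IsAway ρ₁ (p₁ f)) (h₂ : IsAway ρ₂ (p₂ f)) (h₀ : IsAway ρ₀ (q₁ (p₁ f))) (s : R') :
    ∃ (n : ℕ) (a : R), s * ρ f ^ n = ρ a := by
  obtain ⟨n₁, a₁, ha₁⟩ := h₁.surj (p₁' s)
  obtain ⟨n₂, a₂, ha₂⟩ := h₂.surj (p₂' s)
  obtain ⟨m, hm⟩ := h₀.exists_pow_mul (q₁ (p₁ f) ^ n₂ * q₁ a₁ - q₁ (p₁ f) ^ n₁ * q₂ a₂) (by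
    simp only [map_sub, map_mul, map_pow, ← hσ₁, ← hσ₂, ← ha₁, ← ha₂]
    rw [← hw', hσ₁, hσ₂, hw]
    ring)
  obtain ⟨a, ha, ha'⟩ := hex (p₁ f ^ (m + n₂) * a₁) (p₂ f ^ (m + n₁) * a₂) (by
    simp only [map_mul, map_pow, ← hw]
    rw [← sub_eq_zero, ← hm]
    ring)
  refine ⟨n₁ + n₂ + m, a, hext _ _ ?_ ?_⟩
  · rw [hρ₁, ha, map_mul, map_mul, map_pow, map_pow, ← ha₁, hρ₁]
    ring
  · rw [hρ₂, ha', map_mul, map_mul, map_pow, map_pow, ← ha₂, hρ₂]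
    ring

theorem IsAway.fibreProduct
    (hw : ∀ a, q₁ (p₁ a) = q₂ (p₂ a)) (hw' : ∀ a, q₁' (p₁' a) = q₂' (p₂' a))
    (hext : ∀ a b, p₁ a = p₁ b → p₂ a = p₂ b → a = b)
    (hex : ∀ a₁ a₂, q₁ a₁ = q₂ a₂ → ∃ a, p₁ a = a₁ ∧ p₂ a = a₂)
    (hext' : ∀ a b, p₁' a = p₁' b → p₂' a = p₂' b → a = b)
    (hex' : ∀ a₁ a₂, q₁' a₁ = q₂' a₂ → ∃ a, p₁' a = a₁ ∧ p₂' a = a₂)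
    (hρ₁ : ∀ a, p₁' (ρ a) = ρ₁ (p₁ a)) (hρ₂ : ∀ a, p₂' (ρ a) = ρ₂ (p₂ a))
    (hσ₁ : ∀ a, q₁' (ρ₁ a) = ρ₀ (q₁ a)) (hσ₂ : ∀ a, q₂' (ρ₂ a) = ρ₀ (q₂ a)) {f : R}
    (h₁ : IsAway ρ₁ (p₁ f)) (h₂ : IsAway ρ₂ (p₂ f)) (h₀ : IsAway ρ₀ (q₁ (p₁ f))) :
    IsAway ρ f where
  isUnit := isUnit_of_fibreProduct hw' hext' hex' (hρ₁ f ▸ h₁.isUnit) (hρ₂ f ▸ h₂.isUnit)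
  surj := exists_mul_pow_eq_of_fibreProduct hw hw' hex hext' hρ₁ hρ₂ hσ₁ hσ₂ h₁ h₂ h₀
  exists_pow_mul a ha := by
    obtain ⟨n₁, hn₁⟩ := h₁.exists_pow_mul (p₁ a) (by rw [← hρ₁, ha, map_zero])
    obtain ⟨n₂, hn₂⟩ := h₂.exists_pow_mul (p₂ a) (by rw [← hρ₂, ha, map_zero])
    refine ⟨n₁ + n₂, hext _ _ ?_ ?_⟩
    · rw [map_mul, map_pow, pow_add, mul_right_comm, hn₁, zero_mul, map_zero]
    · rw [map_mul, map_pow, pow_add, mul_assoc, hn₂, mul_zero, map_zero]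

end LocalizationOfFibreProduct

section SpecOfFibreProduct

theorem ker_le_nilradical_of_surjective {R S : CommRingCat.{u}} (φ : R ⟶ S)
    (h : Function.Surjective φ) (h' : Function.Surjective (Spec.map φ)) :
    RingHom.ker φ.hom ≤ nilradical R := by
  have h₁ : Set.range (PrimeSpectrum.comap φ.hom) = Set.univ := Set.range_eq_univ.mpr h'
  rw [range_comap_of_surjective _ _ h] at h₁
  exact (PrimeSpectrum.zeroLocus_eq_univ_iff _).mp h₁

theorem isHomeomorph_specMap_fst {R R₁ R₂ R₀ : CommRingCat.{u}} {f₁ : R ⟶ R₁} {f₂ : R ⟶ R₂}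
    {g₁ : R₁ ⟶ R₀} {g₂ : R₂ ⟶ R₀} (h : IsPullback f₁ f₂ g₁ g₂)
    (hg : Function.Surjective g₂) (hg' : RingHom.ker g₂.hom ≤ nilradical R₂) :
    IsHomeomorph (Spec.map f₁) := by
  refine PrimeSpectrum.isHomeomorph_comap f₁.hom (fun x ↦ ⟨1, one_pos, ?_⟩) fun a ha ↦ ?_
  · obtain ⟨y, hy⟩ := hg (g₁ x)
    obtain ⟨a, ha, -⟩ := exists_of_isPullback_commRingCat h hy.symm
    exact ⟨a, by rw [pow_one]; exact ha⟩
  · have ha : f₁ a = 0 := ha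
    have hfa : g₁ (f₁ a) = g₂ (f₂ a) := congr($h.w a)
    rw [ha, map_zero] at hfa
    obtain ⟨n, hn⟩ := hg' hfa.symm
    refine ⟨n + 1, eq_of_isPullback_commRingCat h ?_ ?_⟩
    · rw [map_pow, ha, zero_pow n.succ_ne_zero, map_zero]
    · rw [map_pow, pow_succ, hn, zero_mul, map_zero]

end SpecOfFibreProduct

section DirectedOpens

variable {D T : Scheme.{u}} {J : Type u} [Preorder J] {O : J → D.Opens}

theorem fst_comp_eq_snd_comp_of_directed (mono : ∀ i j, i ≤ j → O i ≤ O j)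
    (dir : ∀ i j x, x ∈ O i → x ∈ O j → ∃ l, l ≤ i ∧ l ≤ j ∧ x ∈ O l)
    {g : ∀ i, (O i).toScheme ⟶ T} (hg : ∀ i j (h : i ≤ j), D.homOfLE (mono i j h) ≫ g j = g i)
    (i j : J) : pullback.fst (O i).ι (O j).ι ≫ g i = pullback.snd (O i).ι (O j).ι ≫ g j := by
  refine Scheme.hom_ext_of_forall _ _ fun x ↦ ?_
  let a := pullback.fst (O i).ι (O j).ι
  let b := pullback.snd (O i).ι (O j).ι
  have hab : a ≫ (O i).ι = b ≫ (O j).ι := pullback.condition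
  have hx : (O i).ι (a x) = (O j).ι (b x) := congr($hab x)
  obtain ⟨l, hi, hj, hl⟩ := dir i j ((O i).ι (a x)) (a x).2 (hx ▸ (b x).2)
  let Q := (a ≫ (O i).ι) ⁻¹ᵁ O l
  refine ⟨Q, hl, ?_⟩
  let r := (a ≫ (O i).ι).resLE (O l) Q le_rfl
  have ha : Q.ι ≫ a = r ≫ D.homOfLE (mono _ _ hi) := by
    rw [← cancel_mono (O i).ι, Category.assoc, Category.assoc, D.homOfLE_ι,
      Scheme.Hom.resLE_comp_ι]
  have hb : Q.ι ≫ b = r ≫ D.homOfLE (mono _ _ hj) := by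
    rw [← cancel_mono (O j).ι, Category.assoc, Category.assoc, D.homOfLE_ι,
      Scheme.Hom.resLE_comp_ι, hab]
  change Q.ι ≫ a ≫ g i = Q.ι ≫ b ≫ g j
  rw [← Category.assoc, ← Category.assoc, ha, hb, Category.assoc, Category.assoc, hg l i hi,
    hg l j hj]

theorem exists_glue_of_directed (mono : ∀ i j, i ≤ j → O i ≤ O j) (cov : ∀ x, ∃ i, x ∈ O i)
    (dir : ∀ i j x, x ∈ O i → x ∈ O j → ∃ l, l ≤ i ∧ l ≤ j ∧ x ∈ O l)
    {g : ∀ i, (O i).toScheme ⟶ T} (hg : ∀ i j (h : i ≤ j), D.homOfLE (mono i j h) ≫ g j = g i) :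
    ∃ f : D ⟶ T, ∀ i, (O i).ι ≫ f = g i := by
  let 𝒰 : D.OpenCover := D.openCoverOfIsOpenCover O
    (.mk (top_unique fun x _ ↦ Opens.mem_iSup.mpr (cov x)))
  have h := fst_comp_eq_snd_comp_of_directed mono dir hg
  exact ⟨𝒰.glueMorphisms g h, fun i ↦ 𝒰.ι_glueMorphisms g h i⟩

end DirectedOpens

section ColimitOfHomeomorphs

variable {D : Scheme.{u}} {J : Type u} [Preorder J] {F : J ⥤ Scheme.{u}} {O : J → D.Opens}
  {γ : ∀ i, (O i).toScheme ⟶ F.obj i}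

theorem map_apply_of_homOfLE_comp_eq (mono : ∀ i j, i ≤ j → O i ≤ O j)
    (nat : ∀ i j (h : i ⟶ j), D.homOfLE (mono i j h.le) ≫ γ j = γ i ≫ F.map h) {i l : J}
    (f : i ⟶ l) (y : O i) : F.map f (γ i y) = γ l ⟨y.1, mono i l f.le y.2⟩ := by
  have e : γ l (D.homOfLE (mono i l f.le) y) = F.map f (γ i y) := congr($(nat i l f) y)
  rw [← e]
  congr 1
  exact Subtype.ext (Scheme.homOfLE_apply ..)

theorem isLocallyDirected_of_opens
    (hγ : ∀ i, IsHomeomorph (γ i)) (mono : ∀ i j, i ≤ j → O i ≤ O j)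
    (nat : ∀ i j (h : i ⟶ j), D.homOfLE (mono i j h.le) ≫ γ j = γ i ≫ F.map h)
    (dir : ∀ i j x, x ∈ O i → x ∈ O j → ∃ l, l ≤ i ∧ l ≤ j ∧ x ∈ O l) :
    (F ⋙ Scheme.forget).IsLocallyDirected := by
  refine ⟨fun {i j l} fi fj xi xj h ↦ ?_⟩
  obtain ⟨y, rfl⟩ := (hγ i).surjective xi
  obtain ⟨z, rfl⟩ := (hγ j).surjective xj
  have h : F.map fi (γ i y) = F.map fj (γ j z) := h
  have h' := (map_apply_of_homOfLE_comp_eq mono nat fi y).symm.trans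
    (h.trans (map_apply_of_homOfLE_comp_eq mono nat fj z))
  have hyz := congrArg Subtype.val ((hγ l).injective h')
  obtain ⟨m, hi, hj, hm⟩ := dir i j y.1 y.2 (by rw [hyz]; exact z.2)
  refine ⟨m, homOfLE hi, homOfLE hj, γ m ⟨y.1, hm⟩, ?_, ?_⟩
  · exact map_apply_of_homOfLE_comp_eq mono nat (homOfLE hi) ⟨y.1, hm⟩
  · exact (map_apply_of_homOfLE_comp_eq mono nat (homOfLE hj) ⟨y.1, hm⟩).trans
      (congrArg _ (Subtype.ext hyz))

theorem image_eq_range_of_comp_eq (hγ : ∀ i, Function.Surjective (γ i)) {C : Scheme.{u}}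
    {c : ∀ i, F.obj i ⟶ C} {f : D ⟶ C} (hf : ∀ i, (O i).ι ≫ f = γ i ≫ c i) (i : J) :
    f '' (O i) = Set.range (c i) := by
  have hfx : ∀ x : O i, f x.1 = c i (γ i x) := fun x ↦ congr($(hf i) x)
  ext z
  constructor
  · rintro ⟨x, hx, rfl⟩
    exact ⟨_, (hfx ⟨x, hx⟩).symm⟩
  · rintro ⟨w, rfl⟩
    obtain ⟨x, rfl⟩ := hγ i w
    exact ⟨x.1, x.2, hfx x⟩

variable [∀ {i j} (f : i ⟶ j), IsOpenImmersion (F.map f)]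
  [(F ⋙ Scheme.forget).IsLocallyDirected]

theorem injective_of_comp_eq_comp_colimitι (hγ : ∀ i, IsHomeomorph (γ i))
    (mono : ∀ i j, i ≤ j → O i ≤ O j)
    (nat : ∀ i j (h : i ⟶ j), D.homOfLE (mono i j h.le) ≫ γ j = γ i ≫ F.map h)
    (cov : ∀ x, ∃ i, x ∈ O i) {f : D ⟶ colimit F}
    (hf : ∀ i, (O i).ι ≫ f = γ i ≫ colimit.ι F i) : Function.Injective f := by
  have hfx : ∀ i (x : O i), f x.1 = colimit.ι F i (γ i x) := fun i x ↦ congr($(hf i) x)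
  intro x y hxy
  obtain ⟨i, hi⟩ := cov x
  obtain ⟨j, hj⟩ := cov y
  rw [hfx i ⟨x, hi⟩, hfx j ⟨y, hj⟩, Scheme.IsLocallyDirected.ι_eq_ι_iff] at hxy
  obtain ⟨l, fi, fj, w, hwi, hwj⟩ := hxy
  obtain ⟨v, rfl⟩ := (hγ l).surjective w
  have hi' := (map_apply_of_homOfLE_comp_eq mono nat fi v).symm.trans hwi
  have hj' := (map_apply_of_homOfLE_comp_eq mono nat fj v).symm.trans hwj
  exact (congrArg Subtype.val ((hγ i).injective hi')).symm.trans
    (congrArg Subtype.val ((hγ j).injective hj'))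

theorem exists_isHomeomorph_colimit
    (hγ : ∀ i, IsHomeomorph (γ i)) (mono : ∀ i j, i ≤ j → O i ≤ O j)
    (nat : ∀ i j (h : i ⟶ j), D.homOfLE (mono i j h.le) ≫ γ j = γ i ≫ F.map h)
    (dir : ∀ i j x, x ∈ O i → x ∈ O j → ∃ l, l ≤ i ∧ l ≤ j ∧ x ∈ O l)
    (basis : ∀ (N : D.Opens), ∀ x ∈ N, ∃ i, x ∈ O i ∧ O i ≤ N) :
    ∃ f : D ⟶ colimit F, (∀ i, (O i).ι ≫ f = γ i ≫ colimit.ι F i) ∧ IsHomeomorph f ∧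
      ∀ i, f ⁻¹ᵁ (colimit.ι F i).opensRange = O i := by
  have cov : ∀ x, ∃ i, x ∈ O i := fun x ↦ (basis ⊤ x trivial).imp fun _ h ↦ h.1
  obtain ⟨f, hf⟩ := exists_glue_of_directed (g := fun i ↦ γ i ≫ colimit.ι F i) mono cov dir
    (fun i j h ↦ by rw [← Category.assoc, nat i j (homOfLE h), Category.assoc, colimit.w])
  have hinj := injective_of_comp_eq_comp_colimitι hγ mono nat cov hf
  have himg := image_eq_range_of_comp_eq (fun i ↦ (hγ i).surjective) hf
  refine ⟨f, hf, ⟨f.continuous, fun N hN ↦ ?_, hinj, fun z ↦ ?_⟩, fun i ↦ ?_⟩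
  · rw [isOpen_iff_forall_mem_open]
    rintro _ ⟨x, hx, rfl⟩
    obtain ⟨i, hi, hiN⟩ := basis ⟨N, hN⟩ x hx
    refine ⟨f '' (O i), Set.image_mono hiN, ?_, x, hi, rfl⟩
    rw [himg]
    exact (colimit.ι F i).opensRange.isOpen
  · obtain ⟨i, w, rfl⟩ := Scheme.IsLocallyDirected.ι_jointly_surjective F z
    exact ((himg i).ge ⟨w, rfl⟩).imp fun _ h ↦ h.2
  · ext x
    change f x ∈ Set.range (colimit.ι F i) ↔ x ∈ O i
    rw [← himg, hinj.mem_set_image]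
    rfl

end ColimitOfHomeomorphs

section AffineOpens

theorem isIso_toSpecΓ {X : Scheme.{u}} {U : X.Opens} (hU : IsAffineOpen U) : IsIso U.toSpecΓ := by
  rw [← hU.isoSpec_hom]
  infer_instance

theorem surjective_resLE {X Y : Scheme.{u}} (f : X ⟶ Y) [Surjective f] {U : Y.Opens} {V : X.Opens}
    (h : V = f ⁻¹ᵁ U) : Function.Surjective (f.resLE U V h.le) := by
  rintro ⟨y, hy⟩
  obtain ⟨x, rfl⟩ := f.surjective y
  refine ⟨⟨x, by rw [h]; exact hy⟩, ?_⟩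
  exact U.ι.injective congr($(f.resLE_comp_ι h.le) ⟨x, by rw [h]; exact hy⟩)

theorem surjective_specMap_of_resLE {X Y : Scheme.{u}} (f : X ⟶ Y) {U : Y.Opens} {V : X.Opens}
    (hU : IsAffineOpen U) (h : V ≤ f ⁻¹ᵁ U) (hs : Function.Surjective (f.resLE U V h)) :
    Function.Surjective (Spec.map (f.appLE U V h)) := by
  have e := Scheme.Opens.toSpecΓ_SpecMap_appLE f U V h
  have : IsIso U.toSpecΓ := isIso_toSpecΓ hU
  have h₁ : Function.Surjective (f.resLE U V h ≫ U.toSpecΓ) := by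
    rw [Scheme.Hom.comp_base, TopCat.coe_comp]
    exact U.toSpecΓ.surjective.comp hs
  rw [← e, Scheme.Hom.comp_base, TopCat.coe_comp] at h₁
  exact h₁.of_comp

theorem opens_eq_of_preimage_eq {X Y : Scheme.{u}} (f : X ⟶ Y) [Surjective f] {U V : Y.Opens}
    (h : f ⁻¹ᵁ U = f ⁻¹ᵁ V) : U = V := by
  ext y
  obtain ⟨x, rfl⟩ := f.surjective y
  exact (SetLike.ext_iff.mp h x)

theorem isAway_presheaf_map {X : Scheme.{u}} {U : X.Opens} (hU : IsAffineOpen U) (f : Γ(X, U))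
    {V : X.Opens} (h : V ≤ U) (e : V = X.basicOpen f) :
    IsAway (X.presheaf.map (homOfLE h).op).hom f := by
  algebraize [(X.presheaf.map (homOfLE h).op).hom]
  have := hU.isLocalization_of_eq_basicOpen f (homOfLE h) e
  exact IsAway.of_isLocalization f

theorem preimage_basicOpen_appLE {X Y : Scheme.{u}} (f : X ⟶ Y) {U : Y.Opens} {V : X.Opens}
    (h : V = f ⁻¹ᵁ U) (a : Γ(Y, U)) :
    f ⁻¹ᵁ Y.basicOpen a = X.basicOpen (f.appLE U V h.le a) := by
  subst h
  rw [f.appLE_eq_app, Scheme.preimage_basicOpen]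

theorem isIso_appLE_opensRange {Y Z : Scheme.{u}} (κ : Y ⟶ Z) [IsOpenImmersion κ] :
    IsIso (κ.appLE κ.opensRange ⊤ κ.preimage_opensRange.ge) := by
  have := κ.isIso_app κ.opensRange le_rfl
  have : IsIso (Y.presheaf.map (homOfLE κ.preimage_opensRange.ge).op) :=
    inferInstanceAs (IsIso (Y.presheaf.map (eqToHom κ.preimage_opensRange.symm).op))
  rw [Scheme.Hom.appLE]
  infer_instance

theorem appLE_opensRange_eq {D Z : Scheme.{u}} {R : CommRingCat.{u}} {U : D.Opens} {i : D ⟶ Z}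
    {κ : Spec R ⟶ Z} [IsOpenImmersion κ] {p : R ⟶ Γ(D, U)}
    (h : U.ι ≫ i = (U.toSpecΓ ≫ Spec.map p) ≫ κ) (hU : U ≤ i ⁻¹ᵁ κ.opensRange) :
    i.appLE κ.opensRange U hU =
      (κ.appLE κ.opensRange ⊤ (κ.preimage_opensRange.ge) ≫ (Scheme.ΓSpecIso R).hom) ≫ p := by
  have hU' : (⊤ : U.toScheme.Opens) ≤ (U.ι ≫ i) ⁻¹ᵁ κ.opensRange := fun x _ ↦ hU x.2
  have hU'' : (⊤ : U.toScheme.Opens) ≤ ((U.toSpecΓ ≫ Spec.map p) ≫ κ) ⁻¹ᵁ κ.opensRange :=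
    h ▸ hU'
  have e := appLE_congr_hom h hU' hU''
  rw [← Scheme.Hom.appLE_comp_appLE (e₁ := hU) (e₂ := U.ι_preimage_self.ge),
    ← Scheme.Hom.appLE_comp_appLE (V := ⊤) (W := ⊤)
      (e₁ := κ.preimage_opensRange.ge) (e₂ := le_rfl)] at e
  have e₂ : (U.toSpecΓ ≫ Spec.map p).appLE ⊤ ⊤ le_rfl =
      (Scheme.ΓSpecIso R).hom ≫ p ≫ U.topIso.inv := by
    refine (Scheme.Hom.appLE_eq_app _).trans ?_
    rw [← Scheme.Hom.appTop, Scheme.Hom.comp_appTop, Scheme.Opens.toSpecΓ_appTop,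
      Scheme.ΓSpecIso_naturality_assoc]
  have e₁ : U.ι.appLE U ⊤ U.ι_preimage_self.ge = U.topIso.inv := by
    rw [Scheme.Opens.ι_appLE]
    rfl
  rw [e₁, e₂] at e
  rw [← cancel_mono U.topIso.inv, e]
  simp only [Category.assoc]

end AffineOpens

section AffinePairs

variable {X D₁ D₂ : Scheme.{u}}

/-- A pair of affine opens of `D₁` and `D₂` with the same preimage in `X`. -/
@[ext]
structure AffinePair (j₁ : X ⟶ D₁) (j₂ : X ⟶ D₂) where
  U₁ : D₁.Opens
  U₂ : D₂.Opens
  preimage_eq : j₁ ⁻¹ᵁ U₁ = j₂ ⁻¹ᵁ U₂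
  isAffineOpen₁ : IsAffineOpen U₁
  isAffineOpen₂ : IsAffineOpen U₂

namespace AffinePair

variable {j₁ : X ⟶ D₁} {j₂ : X ⟶ D₂} (U V : AffinePair j₁ j₂)

/-- The restriction of sections from `U₁` to the common preimage of `U₁` and `U₂` in `X`. -/
abbrev q₁ : Γ(D₁, U.U₁) ⟶ Γ(X, j₁ ⁻¹ᵁ U.U₁) := j₁.appLE U.U₁ (j₁ ⁻¹ᵁ U.U₁) le_rfl

/-- The restriction of sections from `U₂` to the common preimage of `U₁` and `U₂` in `X`. -/
abbrev q₂ : Γ(D₂, U.U₂) ⟶ Γ(X, j₁ ⁻¹ᵁ U.U₁) := j₂.appLE U.U₂ (j₁ ⁻¹ᵁ U.U₁) U.preimage_eq.le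

/-- The ring of pairs of sections on `U₁` and `U₂` that agree on `X`: the coordinate ring of an
affine chart of the fibred sum of `D₁` and `D₂` along `X`. -/
def ring : CommRingCat.{u} := pullback U.q₁ U.q₂

/-- The projection from pairs of sections to sections on `U₁`. -/
def p₁ : U.ring ⟶ Γ(D₁, U.U₁) := pullback.fst _ _

/-- The projection from pairs of sections to sections on `U₂`. -/
def p₂ : U.ring ⟶ Γ(D₂, U.U₂) := pullback.snd _ _

theorem isPullback : IsPullback U.p₁ U.p₂ U.q₁ U.q₂ := IsPullback.of_hasPullback _ _

variable {U V}

/-- The restriction map between the rings of pairs of sections. -/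
def res (h₁ : U.U₁ ≤ V.U₁) (h₂ : U.U₂ ≤ V.U₂) : V.ring ⟶ U.ring :=
  U.isPullback.lift (V.p₁ ≫ D₁.presheaf.map (homOfLE h₁).op)
    (V.p₂ ≫ D₂.presheaf.map (homOfLE h₂).op) (by
      simpa [q₁, q₂] using V.isPullback.w =≫ X.presheaf.map (homOfLE (j₁.preimage_mono h₁)).op)

theorem res_p₁ (h₁ : U.U₁ ≤ V.U₁) (h₂ : U.U₂ ≤ V.U₂) :
    res h₁ h₂ ≫ U.p₁ = V.p₁ ≫ D₁.presheaf.map (homOfLE h₁).op := IsPullback.lift_fst ..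

theorem res_p₂ (h₁ : U.U₁ ≤ V.U₁) (h₂ : U.U₂ ≤ V.U₂) :
    res h₁ h₂ ≫ U.p₂ = V.p₂ ≫ D₂.presheaf.map (homOfLE h₂).op := IsPullback.lift_snd ..

theorem res_self (h₁ : U.U₁ ≤ U.U₁) (h₂ : U.U₂ ≤ U.U₂) : res h₁ h₂ = 𝟙 U.ring := by
  apply U.isPullback.hom_ext
  · rw [res_p₁, Category.id_comp]
    exact (congrArg _ (D₁.presheaf.map_id _)).trans (Category.comp_id _)
  · rw [res_p₂, Category.id_comp]
    exact (congrArg _ (D₂.presheaf.map_id _)).trans (Category.comp_id _)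

theorem res_res {W : AffinePair j₁ j₂} (h₁ : U.U₁ ≤ V.U₁) (h₂ : U.U₂ ≤ V.U₂)
    (h₁' : V.U₁ ≤ W.U₁) (h₂' : V.U₂ ≤ W.U₂) :
    res h₁' h₂' ≫ res h₁ h₂ = res (h₁.trans h₁') (h₂.trans h₂') := by
  apply U.isPullback.hom_ext
  · rw [Category.assoc, res_p₁, ← Category.assoc, res_p₁, res_p₁, Category.assoc,
      ← Functor.map_comp]
    rfl
  · rw [Category.assoc, res_p₂, ← Category.assoc, res_p₂, res_p₂, Category.assoc,
      ← Functor.map_comp]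
    rfl

/-- The comparison morphism of charts is required to be an open immersion, as the fibred sum is
obtained by gluing the charts along this preorder. -/
instance : Preorder (AffinePair j₁ j₂) where
  le U V := ∃ (h₁ : U.U₁ ≤ V.U₁) (h₂ : U.U₂ ≤ V.U₂), IsOpenImmersion (Spec.map (res h₁ h₂))
  le_refl U := ⟨le_rfl, le_rfl, by rw [res_self]; infer_instance⟩
  le_trans U V W := by
    rintro ⟨h₁, h₂, h⟩ ⟨h₁', h₂', h'⟩
    refine ⟨h₁.trans h₁', h₂.trans h₂', ?_⟩
    rw [← res_res h₁ h₂ h₁' h₂', Spec.map_comp]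
    infer_instance

theorem U₁_le (h : U ≤ V) : U.U₁ ≤ V.U₁ := h.choose

theorem U₂_le (h : U ≤ V) : U.U₂ ≤ V.U₂ := h.choose_spec.choose

variable (j₁ j₂) in
/-- The diagram of affine charts, whose colimit is the fibred sum. -/
def specFunctor : AffinePair j₁ j₂ ⥤ Scheme.{u} where
  obj U := Spec U.ring
  map f := Spec.map (res (U₁_le f.le) (U₂_le f.le))
  map_id U := by rw [res_self]; exact Spec.map_id _
  map_comp f g := by rw [← Spec.map_comp, res_res]

instance {U V : AffinePair j₁ j₂} (f : U ⟶ V) : IsOpenImmersion ((specFunctor j₁ j₂).map f) :=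
  f.le.choose_spec.choose_spec

/-- The morphism from `U₁` to its chart of the fibred sum. -/
def γ₁ (U : AffinePair j₁ j₂) : U.U₁.toScheme ⟶ Spec U.ring := U.U₁.toSpecΓ ≫ Spec.map U.p₁

/-- The morphism from `U₂` to its chart of the fibred sum. -/
def γ₂ (U : AffinePair j₁ j₂) : U.U₂.toScheme ⟶ Spec U.ring := U.U₂.toSpecΓ ≫ Spec.map U.p₂

theorem γ₁_naturality (f : U ⟶ V) :
    D₁.homOfLE (U₁_le f.le) ≫ V.γ₁ = U.γ₁ ≫ (specFunctor j₁ j₂).map f := by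
  rw [γ₁, γ₁, ← Scheme.Opens.toSpecΓ_SpecMap_presheaf_map_assoc, ← Spec.map_comp,
    ← res_p₁ _ (U₂_le f.le), Spec.map_comp]
  exact (Category.assoc _ _ _).symm

theorem γ₂_naturality (f : U ⟶ V) :
    D₂.homOfLE (U₂_le f.le) ≫ V.γ₂ = U.γ₂ ≫ (specFunctor j₁ j₂).map f := by
  rw [γ₂, γ₂, ← Scheme.Opens.toSpecΓ_SpecMap_presheaf_map_assoc, ← Spec.map_comp,
    ← res_p₂ (U₁_le f.le), Spec.map_comp]
  exact (Category.assoc _ _ _).symm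

theorem resLE_comp_γ₁_eq (U : AffinePair j₁ j₂) :
    j₁.resLE U.U₁ (j₁ ⁻¹ᵁ U.U₁) le_rfl ≫ U.γ₁ =
      j₂.resLE U.U₂ (j₁ ⁻¹ᵁ U.U₁) U.preimage_eq.le ≫ U.γ₂ := by
  rw [γ₁, γ₂, ← Scheme.Opens.toSpecΓ_SpecMap_appLE_assoc,
    ← Scheme.Opens.toSpecΓ_SpecMap_appLE_assoc, ← Spec.map_comp, ← Spec.map_comp, U.isPullback.w]

section ClosedImmersion

theorem q₁_surjective [IsClosedImmersion j₁] (U : AffinePair j₁ j₂) :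
    Function.Surjective U.q₁ := by
  rw [q₁, j₁.appLE_eq_app]
  exact j₁.app_surjective U.U₁ U.isAffineOpen₁

theorem q₂_surjective [IsClosedImmersion j₂] (U : AffinePair j₁ j₂) :
    Function.Surjective U.q₂ := by
  have h := U.preimage_eq
  rw [q₂]
  generalize_proofs hp
  generalize j₁ ⁻¹ᵁ U.U₁ = Q at h hp
  subst h
  rw [j₂.appLE_eq_app]
  exact j₂.app_surjective U.U₂ U.isAffineOpen₂

theorem isHomeomorph_γ₁ [IsClosedImmersion j₂] [Surjective j₂] (U : AffinePair j₁ j₂) :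
    IsHomeomorph U.γ₁ := by
  have := isIso_toSpecΓ U.isAffineOpen₁
  rw [γ₁, Scheme.Hom.comp_base, TopCat.coe_comp]
  refine (isHomeomorph_specMap_fst U.isPullback U.q₂_surjective ?_).comp
    U.U₁.toSpecΓ.homeomorph.isHomeomorph
  exact ker_le_nilradical_of_surjective _ U.q₂_surjective
    (surjective_specMap_of_resLE j₂ U.isAffineOpen₂ _ (surjective_resLE j₂ U.preimage_eq))

theorem isHomeomorph_γ₂ [IsClosedImmersion j₁] [Surjective j₁] (U : AffinePair j₁ j₂) :
    IsHomeomorph U.γ₂ := by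
  have := isIso_toSpecΓ U.isAffineOpen₂
  rw [γ₂, Scheme.Hom.comp_base, TopCat.coe_comp]
  refine (isHomeomorph_specMap_fst U.isPullback.flip U.q₁_surjective ?_).comp
    U.U₂.toSpecΓ.homeomorph.isHomeomorph
  exact ker_le_nilradical_of_surjective _ U.q₁_surjective
    (surjective_specMap_of_resLE j₁ U.isAffineOpen₁ _ (surjective_resLE j₁ rfl))

end ClosedImmersion

section Basis

theorem mem_U₁_iff_mem_U₂ (U : AffinePair j₁ j₂) (x : X) : j₁ x ∈ U.U₁ ↔ j₂ x ∈ U.U₂ :=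
  SetLike.ext_iff.mp U.preimage_eq x

/-- The basic open pair defined by an element of the ring of pairs. -/
def basicOpen (V : AffinePair j₁ j₂) (f : V.ring) : AffinePair j₁ j₂ where
  U₁ := D₁.basicOpen (V.p₁ f)
  U₂ := D₂.basicOpen (V.p₂ f)
  preimage_eq := by
    rw [preimage_basicOpen_appLE j₁ rfl, preimage_basicOpen_appLE j₂ V.preimage_eq]
    congr 1
    exact congr($V.isPullback.w f)
  isAffineOpen₁ := V.isAffineOpen₁.basicOpen _
  isAffineOpen₂ := V.isAffineOpen₂.basicOpen _

theorem basicOpen_le [IsAffineHom j₁] (V : AffinePair j₁ j₂) (f : V.ring) : V.basicOpen f ≤ V := by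
  have h₁ : (V.basicOpen f).U₁ ≤ V.U₁ := D₁.basicOpen_le _
  have h₂ : (V.basicOpen f).U₂ ≤ V.U₂ := D₂.basicOpen_le _
  refine ⟨h₁, h₂, IsAway.isOpenImmersion (f := f) ?_⟩
  let ρ₀ := X.presheaf.map (homOfLE (j₁.preimage_mono h₁)).op
  have hσ₁ : D₁.presheaf.map (homOfLE h₁).op ≫ (V.basicOpen f).q₁ = V.q₁ ≫ ρ₀ := by simp [q₁, ρ₀]
  have hσ₂ : D₂.presheaf.map (homOfLE h₂).op ≫ (V.basicOpen f).q₂ = V.q₂ ≫ ρ₀ := by simp [q₂, ρ₀]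
  exact IsAway.fibreProduct (p₁ := V.p₁.hom) (p₂ := V.p₂.hom) (q₁ := V.q₁.hom) (q₂ := V.q₂.hom)
    (p₁' := (V.basicOpen f).p₁.hom) (p₂' := (V.basicOpen f).p₂.hom)
    (q₁' := (V.basicOpen f).q₁.hom) (q₂' := (V.basicOpen f).q₂.hom)
    (fun a ↦ congr($(V.isPullback.w) a)) (fun a ↦ congr($((V.basicOpen f).isPullback.w) a))
    (fun _ _ ↦ eq_of_isPullback_commRingCat V.isPullback)
    (fun _ _ ↦ exists_of_isPullback_commRingCat V.isPullback)
    (fun _ _ ↦ eq_of_isPullback_commRingCat (V.basicOpen f).isPullback)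
    (fun _ _ ↦ exists_of_isPullback_commRingCat (V.basicOpen f).isPullback)
    (fun a ↦ congr($(res_p₁ h₁ h₂) a)) (fun a ↦ congr($(res_p₂ h₁ h₂) a))
    (fun a ↦ congr($hσ₁ a)) (fun a ↦ congr($hσ₂ a))
    (isAway_presheaf_map V.isAffineOpen₁ _ h₁ rfl)
    (isAway_presheaf_map V.isAffineOpen₂ _ h₂ rfl)
    (isAway_presheaf_map (V.isAffineOpen₁.preimage j₁) _ _ (preimage_basicOpen_appLE j₁ rfl _))

variable [IsClosedImmersion j₁] [IsClosedImmersion j₂]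

theorem exists_basicOpen_preimage (V : AffinePair j₁ j₂) (f : Γ(X, j₁ ⁻¹ᵁ V.U₁)) :
    ∃ a : V.ring, j₁ ⁻¹ᵁ (V.basicOpen a).U₁ = X.basicOpen f := by
  obtain ⟨a₁, ha₁⟩ := V.q₁_surjective f
  obtain ⟨a₂, ha₂⟩ := V.q₂_surjective f
  obtain ⟨a, h₁, -⟩ := exists_of_isPullback_commRingCat V.isPullback (ha₁.trans ha₂.symm)
  refine ⟨a, ?_⟩
  rw [basicOpen, preimage_basicOpen_appLE j₁ rfl, h₁]
  exact congrArg _ ha₁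

theorem exists_le_le [Surjective j₁] [Surjective j₂] (U V : AffinePair j₁ j₂) (x : X)
    (hU : j₁ x ∈ U.U₁) (hV : j₁ x ∈ V.U₁) : ∃ W, W ≤ U ∧ W ≤ V ∧ j₁ x ∈ W.U₁ := by
  obtain ⟨f, g, hfg, hx⟩ := exists_basicOpen_le_affine_inter (U.isAffineOpen₁.preimage j₁)
    (V.isAffineOpen₁.preimage j₁) x ⟨hU, hV⟩
  obtain ⟨a, ha⟩ := U.exists_basicOpen_preimage f
  obtain ⟨b, hb⟩ := V.exists_basicOpen_preimage g
  have hab : U.basicOpen a = V.basicOpen b :=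
    AffinePair.ext (opens_eq_of_preimage_eq j₁ (by rw [ha, hb, hfg]))
      (opens_eq_of_preimage_eq j₂ (by
        rw [← (U.basicOpen a).preimage_eq, ← (V.basicOpen b).preimage_eq, ha, hb, hfg]))
  refine ⟨U.basicOpen a, U.basicOpen_le a, hab ▸ V.basicOpen_le b, ?_⟩
  rw [← ha] at hx
  exact hx

theorem exists_le_le_mem_U₁ [Surjective j₁] [Surjective j₂] (U V : AffinePair j₁ j₂) (x : D₁)
    (hU : x ∈ U.U₁) (hV : x ∈ V.U₁) : ∃ W, W ≤ U ∧ W ≤ V ∧ x ∈ W.U₁ := by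
  obtain ⟨x, rfl⟩ := j₁.surjective x
  exact U.exists_le_le V x hU hV

theorem exists_le_le_mem_U₂ [Surjective j₁] [Surjective j₂] (U V : AffinePair j₁ j₂) (x : D₂)
    (hU : x ∈ U.U₂) (hV : x ∈ V.U₂) : ∃ W, W ≤ U ∧ W ≤ V ∧ x ∈ W.U₂ := by
  obtain ⟨x, rfl⟩ := j₂.surjective x
  obtain ⟨W, hWU, hWV, hW⟩ :=
    U.exists_le_le V x ((U.mem_U₁_iff_mem_U₂ x).mpr hU) ((V.mem_U₁_iff_mem_U₂ x).mpr hV)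
  exact ⟨W, hWU, hWV, (W.mem_U₁_iff_mem_U₂ x).mp hW⟩

variable (j₁ j₂) in
theorem exists_mem_le (x : X) {N₁ : D₁.Opens} {N₂ : D₂.Opens} (h₁ : j₁ x ∈ N₁) (h₂ : j₂ x ∈ N₂) :
    ∃ U : AffinePair j₁ j₂, j₁ x ∈ U.U₁ ∧ U.U₁ ≤ N₁ ∧ U.U₂ ≤ N₂ := by
  obtain ⟨A₁, hA₁, hxA₁, hN₁⟩ := exists_isAffineOpen_mem_and_subset h₁
  obtain ⟨A₂, hA₂, hxA₂, hN₂⟩ := exists_isAffineOpen_mem_and_subset h₂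
  obtain ⟨f, g, hfg, hx⟩ := exists_basicOpen_le_affine_inter (hA₁.preimage j₁)
    (hA₂.preimage j₂) x ⟨hxA₁, hxA₂⟩
  obtain ⟨a, rfl⟩ := j₁.app_surjective A₁ hA₁ f
  obtain ⟨b, rfl⟩ := j₂.app_surjective A₂ hA₂ g
  rw [← Scheme.preimage_basicOpen, ← Scheme.preimage_basicOpen] at hfg
  rw [← Scheme.preimage_basicOpen] at hx
  exact ⟨⟨_, _, hfg, hA₁.basicOpen a, hA₂.basicOpen b⟩, hx, (D₁.basicOpen_le _).trans hN₁,
    (D₂.basicOpen_le _).trans hN₂⟩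

variable (j₁ j₂) in
theorem exists_mem_U₁_le [Surjective j₁] (N : D₁.Opens) (x : D₁) (hx : x ∈ N) :
    ∃ U : AffinePair j₁ j₂, x ∈ U.U₁ ∧ U.U₁ ≤ N := by
  obtain ⟨x, rfl⟩ := j₁.surjective x
  obtain ⟨U, hU, hUN, -⟩ := exists_mem_le j₁ j₂ x hx (N₂ := ⊤) trivial
  exact ⟨U, hU, hUN⟩

variable (j₁ j₂) in
theorem exists_mem_U₂_le [Surjective j₂] (N : D₂.Opens) (x : D₂) (hx : x ∈ N) :
    ∃ U : AffinePair j₁ j₂, x ∈ U.U₂ ∧ U.U₂ ≤ N := by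
  obtain ⟨x, rfl⟩ := j₂.surjective x
  obtain ⟨U, hU, -, hUN⟩ := exists_mem_le j₁ j₂ x (N₁ := ⊤) trivial hx
  exact ⟨U, (U.mem_U₁_iff_mem_U₂ x).mp hU, hUN⟩

end Basis

end AffinePair

end AffinePairs

section FibredSum

variable {X D₁ D₂ : Scheme.{u}} {j₁ : X ⟶ D₁} {j₂ : X ⟶ D₂}

theorem AffinePair.isMilnorSquareOn {Z : Scheme.{u}} (U : AffinePair j₁ j₂) {i₁ : D₁ ⟶ Z}
    {i₂ : D₂ ⟶ Z} (κ : Spec U.ring ⟶ Z) [IsOpenImmersion κ] (h₁ : U.U₁.ι ≫ i₁ = U.γ₁ ≫ κ)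
    (h₂ : U.U₂.ι ≫ i₂ = U.γ₂ ≫ κ) (e₁ : i₁ ⁻¹ᵁ κ.opensRange = U.U₁)
    (e₂ : i₂ ⁻¹ᵁ κ.opensRange = U.U₂) : IsMilnorSquareOn j₁ j₂ i₁ i₂ κ.opensRange := by
  have := isIso_appLE_opensRange κ
  let e := κ.appLE κ.opensRange ⊤ κ.preimage_opensRange.ge ≫ (Scheme.ΓSpecIso U.ring).hom
  have he : Function.Bijective e := ConcreteCategory.bijective_of_isIso e
  let ρ₁ := D₁.presheaf.map (eqToHom e₁.symm).op
  let ρ₂ := D₂.presheaf.map (eqToHom e₂.symm).op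
  have hρ₁ : Function.Injective ρ₁ := (ConcreteCategory.bijective_of_isIso ρ₁).1
  have hρ₂ : Function.Injective ρ₂ := (ConcreteCategory.bijective_of_isIso ρ₂).1
  have r₁ : ∀ a, ρ₁ (i₁.app _ a) = U.p₁ (e a) := fun a ↦
    congr($(appLE_opensRange_eq h₁ e₁.ge).hom a)
  have r₂ : ∀ a, ρ₂ (i₂.app _ a) = U.p₂ (e a) := fun a ↦
    congr($(appLE_opensRange_eq h₂ e₂.ge).hom a)
  refine ⟨fun a b ha₁ ha₂ ↦ ?_, fun a₁ a₂ ha ↦ ?_⟩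
  · exact he.1 (eq_of_isPullback_commRingCat U.isPullback
      (by rw [← r₁, ← r₁, ha₁]) (by rw [← r₂, ← r₂, ha₂]))
  · have hq : U.q₁ (ρ₁ a₁) = U.q₂ (ρ₂ a₂) := by
      refine .trans ?_ ((ha (j₁ ⁻¹ᵁ U.U₁) (by rw [e₁]) (by rw [e₂, U.preimage_eq])).trans ?_)
      · exact congr($(j₁.map_appLE le_rfl (eqToHom e₁.symm).op) a₁)
      · exact congr($(j₂.map_appLE U.preimage_eq.le (eqToHom e₂.symm).op) a₂).symm
    obtain ⟨b, hb₁, hb₂⟩ := exists_of_isPullback_commRingCat U.isPullback hq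
    obtain ⟨a, rfl⟩ := he.2 b
    exact ⟨a, hρ₁ ((r₁ a).trans hb₁), hρ₂ ((r₂ a).trans hb₂)⟩

theorem AffinePair.comp_eq_comp_of_ι_comp_eq [Surjective j₁] [IsClosedImmersion j₁]
    [IsClosedImmersion j₂] {Z : Scheme.{u}} {i₁ : D₁ ⟶ Z} {i₂ : D₂ ⟶ Z}
    {κ : ∀ U : AffinePair j₁ j₂, Spec U.ring ⟶ Z} (h₁ : ∀ U, U.U₁.ι ≫ i₁ = U.γ₁ ≫ κ U)
    (h₂ : ∀ U, U.U₂.ι ≫ i₂ = U.γ₂ ≫ κ U) : j₁ ≫ i₁ = j₂ ≫ i₂ := by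
  refine Scheme.hom_ext_of_forall _ _ fun x ↦ ?_
  obtain ⟨U, hU, -⟩ := AffinePair.exists_mem_U₁_le j₁ j₂ ⊤ (j₁ x) trivial
  refine ⟨j₁ ⁻¹ᵁ U.U₁, hU, ?_⟩
  have e₁ := Scheme.Hom.resLE_comp_ι j₁ (U := U.U₁) (V := j₁ ⁻¹ᵁ U.U₁) le_rfl
  have e₂ := Scheme.Hom.resLE_comp_ι j₂ (U := U.U₂) (V := j₁ ⁻¹ᵁ U.U₁) U.preimage_eq.le
  rw [← Category.assoc, ← Category.assoc, ← e₁, ← e₂, Category.assoc, Category.assoc, h₁, h₂,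
    ← Category.assoc, ← Category.assoc, U.resLE_comp_γ₁_eq]

theorem exists_isMilnorSquareOn (j₁ : X ⟶ D₁) (j₂ : X ⟶ D₂) [IsClosedImmersion j₁]
    [IsClosedImmersion j₂] [Surjective j₁] [Surjective j₂] :
    ∃ (Z : Scheme.{u}) (i₁ : D₁ ⟶ Z) (i₂ : D₂ ⟶ Z), j₁ ≫ i₁ = j₂ ≫ i₂ ∧ IsHomeomorph i₁ ∧
      IsHomeomorph i₂ ∧ ∀ (O : Z.Opens), ∀ z ∈ O, ∃ W ≤ O, z ∈ W ∧ IsAffineOpen W ∧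
        IsAffineOpen (i₁ ⁻¹ᵁ W) ∧ IsAffineOpen (i₂ ⁻¹ᵁ W) ∧
          IsMilnorSquareOn j₁ j₂ i₁ i₂ W := by
  let F := AffinePair.specFunctor j₁ j₂
  have : (F ⋙ Scheme.forget).IsLocallyDirected :=
    isLocallyDirected_of_opens (γ := AffinePair.γ₁) AffinePair.isHomeomorph_γ₁
      (fun _ _ ↦ AffinePair.U₁_le) (fun _ _ ↦ AffinePair.γ₁_naturality)
      AffinePair.exists_le_le_mem_U₁
  have : ∀ {i j} (f : i ⟶ j), IsOpenImmersion (F.map f) := fun f ↦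
    inferInstanceAs (IsOpenImmersion ((AffinePair.specFunctor j₁ j₂).map f))
  obtain ⟨i₁, hi₁, hh₁, hp₁⟩ := exists_isHomeomorph_colimit (F := F) (γ := AffinePair.γ₁)
    AffinePair.isHomeomorph_γ₁ (fun _ _ ↦ AffinePair.U₁_le) (fun _ _ ↦ AffinePair.γ₁_naturality)
    AffinePair.exists_le_le_mem_U₁ (AffinePair.exists_mem_U₁_le j₁ j₂)
  obtain ⟨i₂, hi₂, hh₂, hp₂⟩ := exists_isHomeomorph_colimit (F := F) (γ := AffinePair.γ₂)
    AffinePair.isHomeomorph_γ₂ (fun _ _ ↦ AffinePair.U₂_le) (fun _ _ ↦ AffinePair.γ₂_naturality)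
    AffinePair.exists_le_le_mem_U₂ (AffinePair.exists_mem_U₂_le j₁ j₂)
  refine ⟨colimit F, i₁, i₂, AffinePair.comp_eq_comp_of_ι_comp_eq hi₁ hi₂, hh₁, hh₂,
    fun O z hz ↦ ?_⟩
  obtain ⟨y, rfl⟩ := hh₁.surjective z
  obtain ⟨U, hU, hUO⟩ := AffinePair.exists_mem_U₁_le j₁ j₂ (i₁ ⁻¹ᵁ O) y hz
  let κ : Spec U.ring ⟶ colimit F := colimit.ι F U
  have : IsOpenImmersion κ := inferInstanceAs (IsOpenImmersion (colimit.ι F U))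
  have hκ₁ : i₁ ⁻¹ᵁ κ.opensRange = U.U₁ := hp₁ U
  have hκ₂ : i₂ ⁻¹ᵁ κ.opensRange = U.U₂ := hp₂ U
  refine ⟨κ.opensRange, fun z hz ↦ ?_, (SetLike.ext_iff.mp hκ₁ y).mpr hU,
    isAffineOpen_opensRange κ, hκ₁ ▸ U.isAffineOpen₁, hκ₂ ▸ U.isAffineOpen₂,
    U.isMilnorSquareOn κ (hi₁ U) (hi₂ U) hκ₁ hκ₂⟩
  obtain ⟨x, rfl⟩ := hh₁.surjective z
  exact hUO ((SetLike.ext_iff.mp hκ₁ x).mp hz)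

end FibredSum

section BaseHom

variable {A B : Type u} [CommRing A] [CommRing B] {Z E : Scheme.{u}}

theorem le_preimage_top (f : E ⟶ Z) (V : E.Opens) : V ≤ f ⁻¹ᵁ ⊤ := le_top

/-- The ring homomorphism `A → Γ(Z, W)`, for a scheme `Z` over `Spec A`. -/
def baseHom (σ : Z ⟶ Spec (.of A)) (W : Z.Opens) : A →+* Γ(Z, W) :=
  ((Scheme.ΓSpecIso (.of A)).inv ≫ σ.appLE ⊤ W (le_preimage_top _ _)).hom

variable {σ : Z ⟶ Spec (.of A)} {f : E ⟶ Z} {g : E ⟶ Spec (.of B)} {φ : A →+* B}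

theorem appLE_baseHom (w : f ≫ σ = g ≫ Spec.map (CommRingCat.ofHom φ)) {W : Z.Opens}
    {V : E.Opens} (h : V ≤ f ⁻¹ᵁ W) (a : A) :
    f.appLE W V h (baseHom σ W a) = baseHom g V (φ a) := by
  have e : (Scheme.ΓSpecIso (.of A)).inv ≫ σ.appLE ⊤ W (le_preimage_top _ _) ≫ f.appLE W V h =
      CommRingCat.ofHom φ ≫ (Scheme.ΓSpecIso (.of B)).inv ≫ g.appLE ⊤ V (le_preimage_top _ _) := by
    rw [Scheme.Hom.appLE_comp_appLE, appLE_congr_hom w _ (le_preimage_top _ _),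
      Scheme.ΓSpecIso_inv_naturality_assoc,
      ← Scheme.Hom.appLE_comp_appLE (V := ⊤) (e₁ := le_preimage_top _ _)
      (e₂ := le_preimage_top _ _)]
    congr 2
  exact congr($e a)

theorem appLE_baseHom_of_comp_eq {g : E ⟶ Spec (.of A)} (w : f ≫ σ = g) {W : Z.Opens}
    {V : E.Opens} (h : V ≤ f ⁻¹ᵁ W) (a : A) : f.appLE W V h (baseHom σ W a) = baseHom g V a := by
  refine appLE_baseHom (φ := RingHom.id A) ?_ h a
  rw [w]
  exact ((congrArg _ (Spec.map_id _)).trans (Category.comp_id _)).symm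

theorem app_baseHom (w : f ≫ σ = g ≫ Spec.map (CommRingCat.ofHom φ)) (W : Z.Opens) (a : A) :
    f.app W (baseHom σ W a) = baseHom g (f ⁻¹ᵁ W) (φ a) := by
  rw [← f.appLE_eq_app]
  exact appLE_baseHom w _ a

theorem flat_baseHom (σ : Z ⟶ Spec (.of A)) [Flat σ] {W : Z.Opens} (hW : IsAffineOpen W) :
    (baseHom σ W).Flat := by
  have h : (σ.appLE ⊤ W (le_preimage_top _ _)).hom.Flat :=
    HasRingHomProperty.appLE @Flat σ inferInstance ⟨⊤, isAffineOpen_top _⟩ ⟨W, hW⟩ le_top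
  rw [baseHom, CommRingCat.hom_comp]
  exact RingHom.Flat.comp (.of_bijective
    (ConcreteCategory.bijective_of_isIso (Scheme.ΓSpecIso (.of A)).inv)) h

theorem isClosedImmersion_of_isPullback (h : IsPullback f g σ (Spec.map (CommRingCat.ofHom φ)))
    (hφ : Function.Surjective φ) : IsClosedImmersion f := by
  have : IsClosedImmersion (Spec.map (CommRingCat.ofHom φ)) :=
    IsClosedImmersion.spec_of_surjective _ hφ
  exact MorphismProperty.of_isPullback h.flip inferInstance

theorem isPushout_baseHom_of_isPullback (h : IsPullback f g σ (Spec.map (CommRingCat.ofHom φ)))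
    {W : Z.Opens} (hW : IsAffineOpen W) :
    IsPushout (CommRingCat.ofHom (baseHom σ W)) (CommRingCat.ofHom φ) (f.app W)
      (CommRingCat.ofHom (baseHom g (f ⁻¹ᵁ W))) := by
  have hp : IsPushout (σ.appLE ⊤ W (le_preimage_top _ _))
      ((Spec.map (CommRingCat.ofHom φ)).appLE ⊤ ⊤ (le_preimage_top _ _))
      (f.appLE W (f ⁻¹ᵁ W) le_rfl) (g.appLE ⊤ (f ⁻¹ᵁ W) (le_preimage_top _ _)) :=
    (isIso_pushoutSection_iff (US := ⊤) (UT := ⊤) (UX := W) (UY := f ⁻¹ᵁ W) h le_top le_top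
      (by simp)).mp (isIso_pushoutSection_of_isAffineOpen (US := ⊤) (UT := ⊤) (UX := W)
        (UY := f ⁻¹ᵁ W) h le_top le_top (by simp) (isAffineOpen_top _) (isAffineOpen_top _) hW)
  refine hp.of_iso (Scheme.ΓSpecIso (.of A)) (Iso.refl _) (Scheme.ΓSpecIso (.of B)) (Iso.refl _)
    ?_ ?_ ?_ ?_
  · exact (Iso.hom_inv_id_assoc _ _).symm
  · refine Eq.trans ?_ (Scheme.ΓSpecIso_naturality (CommRingCat.ofHom φ))
    exact congrArg (· ≫ (Scheme.ΓSpecIso (.of B)).hom) (Scheme.Hom.appLE_eq_app _)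
  · exact (Category.comp_id _).trans ((f.appLE_eq_app).trans (Category.id_comp _).symm)
  · exact (Iso.hom_inv_id_assoc _ _).symm

theorem ker_app_of_isPullback (h : IsPullback f g σ (Spec.map (CommRingCat.ofHom φ)))
    (hφ : Function.Surjective φ) {W : Z.Opens} (hW : IsAffineOpen W) :
    RingHom.ker (f.app W).hom = (RingHom.ker φ).map (baseHom σ W) := by
  refine le_antisymm (fun a ha ↦ ?_) (Ideal.map_le_iff_le_comap.mpr fun x hx ↦ ?_)
  · let J := (RingHom.ker φ).map (baseHom σ W)
    let ψ : {ψ : A →+* Γ(Z, W) ⧸ J // RingHom.ker φ ≤ RingHom.ker ψ} :=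
      ⟨(Ideal.Quotient.mk J).comp (baseHom σ W), fun x hx ↦
        Ideal.Quotient.eq_zero_iff_mem.mpr (Ideal.mem_map_of_mem _ hx)⟩
    let l : B →+* Γ(Z, W) ⧸ J := RingHom.liftOfSurjective φ hφ ψ
    have hl : ψ.1 = l.comp φ :=
      (RingHom.liftOfRightInverse_comp φ _ (Function.rightInverse_surjInv hφ) ψ).symm
    have hp := isPushout_baseHom_of_isPullback h hW
    have w : CommRingCat.ofHom (baseHom σ W) ≫ CommRingCat.ofHom (Ideal.Quotient.mk J) =
      CommRingCat.ofHom φ ≫ CommRingCat.ofHom l := congrArg CommRingCat.ofHom hl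
    have hm : hp.desc _ _ w (f.app W a) = Ideal.Quotient.mk J a := congr($(hp.inl_desc _ _ w) a)
    rw [(ha : f.app W a = 0), map_zero] at hm
    exact Ideal.Quotient.eq_zero_iff_mem.mp hm.symm
  · rw [Ideal.mem_comap, RingHom.mem_ker]
    refine (app_baseHom h.w W x).trans ?_
    rw [(hx : φ x = 0), map_zero]

theorem isPullback_of_ker_app_le (w : f ≫ σ = g ≫ Spec.map (CommRingCat.ofHom φ))
    (hφ : Function.Surjective φ) [IsClosedImmersion f] (h : ∀ z : Z, ∃ W : Z.Opens, z ∈ W ∧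
      IsAffineOpen W ∧ RingHom.ker (f.app W).hom ≤ (RingHom.ker φ).map (baseHom σ W)) :
    IsPullback f g σ (Spec.map (CommRingCat.ofHom φ)) := by
  let fst := pullback.fst σ (Spec.map (CommRingCat.ofHom φ))
  have hP : IsPullback fst _ σ (Spec.map (CommRingCat.ofHom φ)) := .of_hasPullback _ _
  have : IsClosedImmersion fst := isClosedImmersion_of_isPullback hP hφ
  have hle : fst.ker ≥ f.ker := by
    choose W hzW hW hk using h
    refine Scheme.IdealSheafData.le_of_iSup_eq_top (fun z ↦ ⟨W z, hW z⟩)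
      (top_unique fun z _ ↦ Opens.mem_iSup.mpr ⟨z, hzW z⟩) fun z ↦ ?_
    rw [Scheme.Hom.ker_apply, Scheme.Hom.ker_apply, ker_app_of_isPullback hP hφ (hW z)]
    exact hk z
  have hge : fst.ker ≤ f.ker := by
    simpa only [hP.lift_fst] using Scheme.Hom.le_ker_comp (hP.lift f g w) fst
  have := IsClosedImmersion.isIso_of_ker_eq f fst (hP.lift f g w) (hP.lift_fst _ _ _)
    (le_antisymm hle hge)
  exact hP.of_iso (asIso (hP.lift f g w)).symm (Iso.refl _) (Iso.refl _) (Iso.refl _)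
    (by simp) (by simp) (by simp) (by simp)

end BaseHom

theorem appLE_comp_app_hom {X Y Z : Scheme.{u}} {f : X ⟶ Y} {g : Y ⟶ Z} {h : X ⟶ Z}
    (w : f ≫ g = h) {W : Z.Opens} {Q : X.Opens} (e : Q ≤ f ⁻¹ᵁ g ⁻¹ᵁ W) (e' : Q ≤ h ⁻¹ᵁ W) :
    (f.appLE (g ⁻¹ᵁ W) Q e).hom.comp (g.app W).hom = (h.appLE W Q e').hom := by
  subst w
  rw [Scheme.Hom.comp_appLE, CommRingCat.hom_comp]

section Squares

variable {k : Type u} [Field k] {S : Scheme.{u}} {s : S ⟶ Spec (.of k)} {X : Over S}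
  {A B : Type u} [CommRing A] [Algebra k A] [CommRing B] [Algebra k B]

instance : Flat s := by
  have : IsIntegral (Spec (.of k)) := inferInstance
  have : Subsingleton (Spec (.of k)) := inferInstanceAs (Subsingleton (PrimeSpectrum k))
  infer_instance

theorem isPullback_prodSpecMap (φ : A →ₐ[k] B) :
    IsPullback (prodSpecMap s φ) (pullback.snd _ _) (pullback.snd _ _)
      (Spec.map (CommRingCat.ofHom φ.toRingHom)) := by
  refine (IsPullback.of_bot (v₁₁ := prodSpecMap s φ) (v₂₁ := pullback.fst _ _)
    (h₃₁ := s) (h₁₁ := pullback.snd _ _) (h₂₁ := pullback.snd _ _)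
    (v₁₂ := Spec.map (CommRingCat.ofHom φ.toRingHom))
    (v₂₂ := Spec.map (CommRingCat.ofHom (algebraMap k A))) ?_ ?_
    (IsPullback.of_hasPullback _ _).flip).flip
  · have hφ : φ.toRingHom.comp (algebraMap k A) = algebraMap k B := φ.comp_algebraMap
    rw [prodSpecMap_fst, ← Spec.map_comp, ← CommRingCat.ofHom_comp, hφ]
    exact (IsPullback.of_hasPullback _ _).flip
  · exact (pullback.lift_snd _ _ _).symm

theorem surjective_of_isPullback_specMap [IsLocalRing A] [IsArtinianRing A] [Nontrivial B]
    {Z E : Scheme.{u}} {σ : Z ⟶ Spec (.of A)} {f : E ⟶ Z} {g : E ⟶ Spec (.of B)} {φ : A →+* B}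
    (h : IsPullback f g σ (Spec.map (CommRingCat.ofHom φ))) : Surjective f := by
  have : Subsingleton (Spec (.of A)) := inferInstanceAs (Subsingleton (PrimeSpectrum A))
  have : Nonempty (Spec (.of B)) := inferInstanceAs (Nonempty (PrimeSpectrum B))
  have : Surjective (Spec.map (CommRingCat.ofHom φ)) := inferInstance
  exact MorphismProperty.of_isPullback h.flip this

variable [IsArtAlg k A] [IsArtAlg k B]

theorem isPullback_closedPt :
    IsPullback (closedPt s A) s (pullback.snd _ _)
      (Spec.map (CommRingCat.ofHom (aug k A).toRingHom)) := by
  refine (IsPullback.of_bot (v₁₁ := closedPt s A) (v₂₁ := pullback.fst _ _)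
    (h₃₁ := s) (h₁₁ := s) (h₂₁ := pullback.snd _ _)
    (v₁₂ := Spec.map (CommRingCat.ofHom (aug k A).toRingHom))
    (v₂₂ := Spec.map (CommRingCat.ofHom (algebraMap k A))) ?_ ?_
    (IsPullback.of_hasPullback _ _).flip).flip
  · have hA : (aug k A).toRingHom.comp (algebraMap k A) = RingHom.id k := (aug k A).comp_algebraMap
    have hid : Spec.map (CommRingCat.ofHom (RingHom.id k)) = 𝟙 (Spec (.of k)) := Spec.map_id _
    rw [closedPt_fst, ← Spec.map_comp, ← CommRingCat.ofHom_comp, hA, hid]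
    exact IsPullback.of_vert_isIso ⟨by simp⟩
  · exact (pullback.lift_snd _ _ _).symm

theorem aug_surjective : Function.Surjective (aug k A).toRingHom := fun c ↦
  ⟨algebraMap k A c, (aug k A).commutes c⟩

namespace Deformation

/-- The structure morphism to `Spec A` of a deformation over `A`. -/
def specHom (D : Deformation s X A) : D.total ⟶ Spec (.of A) := D.hom ≫ pullback.snd _ _

instance (D : Deformation s X A) : Flat D.specHom := by
  have := D.isDeformation.flat
  rw [specHom]
  infer_instance

instance (D : Deformation s X A) : IsClosedImmersion D.incl := D.isDeformation.isClosedImmersion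

theorem isPullback_specHom {D : Deformation s X A} {E : Deformation s X B} {φ : A →ₐ[k] B}
    {f : E.total ⟶ D.total} (h : IsPullback f E.hom D.hom (prodSpecMap s φ)) :
    IsPullback f E.specHom D.specHom (Spec.map (CommRingCat.ofHom φ.toRingHom)) :=
  h.paste_vert (isPullback_prodSpecMap φ)

theorem isPullback_incl (D : Deformation s X A) :
    IsPullback D.incl (X.hom ≫ s) D.specHom (Spec.map (CommRingCat.ofHom (aug k A).toRingHom)) :=
  D.isDeformation.isPullback.paste_vert isPullback_closedPt

instance (D : Deformation s X A) : Surjective D.incl :=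
  have := IsArtAlg.toIsLocalRing (k := k) (A := A)
  have : IsArtinianRing A := ‹IsArtAlg k A›.2
  surjective_of_isPullback_specMap D.isPullback_incl

end Deformation

end Squares

section SquareZeroExtensions

open TrivSqZeroExt

variable {k : Type u} [Field k] {U V W : Type u}
  [AddCommGroup U] [Module k U] [Module kᵐᵒᵖ U] [IsCentralScalar k U]
  [AddCommGroup V] [Module k V] [Module kᵐᵒᵖ V] [IsCentralScalar k V]
  [AddCommGroup W] [Module k W] [Module kᵐᵒᵖ W] [IsCentralScalar k W]

theorem trivSqZeroExt_map_surjective {l : V →ₗ[k] W} (hl : Function.Surjective l) :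
    Function.Surjective (TrivSqZeroExt.map l).toRingHom := fun x ↦ by
  obtain ⟨v, hv⟩ := hl x.snd
  exact ⟨inl x.fst + inr v, by ext <;> simp [hv]⟩

theorem ker_map_fst_inf_ker_map_snd :
    RingHom.ker (TrivSqZeroExt.map (LinearMap.fst k V W)).toRingHom ⊓
      RingHom.ker (TrivSqZeroExt.map (LinearMap.snd k V W)).toRingHom = ⊥ := by
  rw [eq_bot_iff]
  rintro x ⟨h₁, h₂⟩
  have h₁ : TrivSqZeroExt.map (LinearMap.fst k V W) x = 0 := h₁
  have h₂ : TrivSqZeroExt.map (LinearMap.snd k V W) x = 0 := h₂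
  refine TrivSqZeroExt.ext ?_ (Prod.ext ?_ ?_)
  · rw [← fst_map (LinearMap.fst k V W), h₁]
    rfl
  · exact (snd_map (LinearMap.fst k V W) x).symm.trans (congrArg snd h₁)
  · exact (snd_map (LinearMap.snd k V W) x).symm.trans (congrArg snd h₂)

variable [Module.Finite k V]

theorem ker_aug_eq_ker_fstHom :
    RingHom.ker (aug k (TrivSqZeroExt k V)).toRingHom = RingHom.ker (fstHom k k V) := by
  rw [← algHom_eq_aug (fstHom k k V)]
  rfl

theorem eq_inr_of_mem_ker_aug {x : TrivSqZeroExt k V}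
    (hx : x ∈ RingHom.ker (aug k (TrivSqZeroExt k V)).toRingHom) : x = inr x.snd := by
  rw [ker_aug_eq_ker_fstHom] at hx
  exact TrivSqZeroExt.ext hx rfl

theorem ker_aug_eq_span {ι : Type*} (b : Module.Basis ι k V) :
    RingHom.ker (aug k (TrivSqZeroExt k V)).toRingHom =
      Ideal.span (Set.range fun i ↦ (inr (b i) : TrivSqZeroExt k V)) :=
  ker_aug_eq_ker_fstHom.trans (ker_fstHom_eq_span b.span_eq)

theorem ker_aug_le_map_ker_map {l : U →ₗ[k] W} {m : U →ₗ[k] V}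
    (h : ∀ v, ∃ u, l u = 0 ∧ m u = v) :
    RingHom.ker (aug k (TrivSqZeroExt k V)).toRingHom ≤
      (RingHom.ker (TrivSqZeroExt.map l).toRingHom).map (TrivSqZeroExt.map m).toRingHom := by
  intro x hx
  obtain ⟨u, hl, hm⟩ := h x.snd
  have hxu : x = TrivSqZeroExt.map m (inr u) := by rw [map_inr, hm, ← eq_inr_of_mem_ker_aug hx]
  rw [hxu]
  refine Ideal.mem_map_of_mem (TrivSqZeroExt.map m).toRingHom (RingHom.mem_ker.mpr ?_)
  exact (map_inr l u).trans (by rw [hl, inr_zero])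

theorem ker_aug_le_ker_map_fst_sup_ker_map_snd [Module.Finite k W] :
    RingHom.ker (aug k (TrivSqZeroExt k (V × W))).toRingHom ≤
      RingHom.ker (TrivSqZeroExt.map (LinearMap.fst k V W)).toRingHom ⊔
        RingHom.ker (TrivSqZeroExt.map (LinearMap.snd k V W)).toRingHom := by
  intro x hx
  have hx' : x = inr (0, x.snd.2) + inr (x.snd.1, 0) := by
    rw [← inr_add, Prod.mk_add_mk, zero_add, add_zero]
    exact eq_inr_of_mem_ker_aug hx
  rw [hx']
  exact Submodule.add_mem_sup (map_inr (LinearMap.fst k V W) _) (map_inr (LinearMap.snd k V W) _)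

theorem baseHom_inr_mul_baseHom_inr {Z : Scheme.{u}} (σ : Z ⟶ Spec (.of (TrivSqZeroExt k U)))
    (O : Z.Opens) (v v' : U) : baseHom σ O (inr v) * baseHom σ O (inr v') = 0 := by
  rw [← map_mul, inr_mul_inr, map_zero]

theorem app_baseHom_inr {Z E : Scheme.{u}} {σ : Z ⟶ Spec (.of (TrivSqZeroExt k U))} {f : E ⟶ Z}
    {g : E ⟶ Spec (.of (TrivSqZeroExt k W))} {l : U →ₗ[k] W}
    (w : f ≫ σ = g ≫ Spec.map (CommRingCat.ofHom (TrivSqZeroExt.map l).toRingHom))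
    (O : Z.Opens) (v : U) : f.app O (baseHom σ O (inr v)) = baseHom g (f ⁻¹ᵁ O) (inr (l v)) :=
  (app_baseHom w O _).trans (congrArg _ (map_inr l v))

theorem ker_app_eq_span {ι : Type*} (b : Module.Basis ι k V) {Z E : Scheme.{u}}
    {σ : Z ⟶ Spec (.of (TrivSqZeroExt k V))} {f : E ⟶ Z} {g : E ⟶ Spec (.of k)}
    (h : IsPullback f g σ (Spec.map (CommRingCat.ofHom (aug k (TrivSqZeroExt k V)).toRingHom)))
    {O : Z.Opens} (hO : IsAffineOpen O) :
    RingHom.ker (f.app O).hom = Ideal.span (Set.range fun i ↦ baseHom σ O (inr (b i))) := by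
  rw [ker_app_of_isPullback h aug_surjective hO, ker_aug_eq_span b, Ideal.map_span,
    ← Set.range_comp]
  rfl

theorem Deformation.appLE_eq_zero_of_sum_eq_zero {S : Scheme.{u}} {s : S ⟶ Spec (.of k)}
    {X : Over S} (D : Deformation s X (TrivSqZeroExt k V)) {ι : Type*} [Fintype ι] {v : ι → V}
    (hv : LinearIndependent k v) {O : D.total.Opens} (hO : IsAffineOpen O) {Q : X.left.Opens}
    (h : Q = D.incl ⁻¹ᵁ O) {r : ι → Γ(D.total, O)}
    (hr : ∑ i, baseHom D.specHom O (inr (v i)) * r i = 0) (i : ι) :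
    D.incl.appLE O Q h.le (r i) = 0 := by
  subst h
  rw [D.incl.appLE_eq_app]
  change r i ∈ RingHom.ker (D.incl.app O).hom
  rw [ker_app_of_isPullback D.isPullback_incl aug_surjective hO, ker_aug_eq_ker_fstHom]
  exact mem_map_ker_fstHom_of_flat_of_sum_eq_zero hv (flat_baseHom D.specHom hO) hr i

end SquareZeroExtensions

section Pushout

theorem isHomeomorph_of_isClosedImmersion {X Y : Scheme.{u}} (f : X ⟶ Y) [IsClosedImmersion f]
    [Surjective f] : IsHomeomorph f :=
  isHomeomorph_iff_isEmbedding_surjective.mpr ⟨f.isClosedEmbedding.isEmbedding, f.surjective⟩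

variable {k : Type u} [Field k] {S : Scheme.{u}} {s : S ⟶ Spec (.of k)} {X : Over S}
  {A A₁ A₂ : Type u} [CommRing A] [Algebra k A] [IsArtAlg k A]
  [CommRing A₁] [Algebra k A₁] [IsArtAlg k A₁] [CommRing A₂] [Algebra k A₂] [IsArtAlg k A₂]
  {φ₁ : A →ₐ[k] A₁} {φ₂ : A →ₐ[k] A₂} {Z : Deformation s X A} {D₁ : Deformation s X A₁}
  {D₂ : Deformation s X A₂} {i₁ : D₁.total ⟶ Z.total} {i₂ : D₂.total ⟶ Z.total}

theorem isMilnorSquareOn_of_isPullback (h₁ : IsPullback i₁ D₁.hom Z.hom (prodSpecMap s φ₁))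
    (h₂ : IsPullback i₂ D₂.hom Z.hom (prodSpecMap s φ₂)) (w₁ : D₁.incl ≫ i₁ = Z.incl)
    (w₂ : D₂.incl ≫ i₂ = Z.incl) (hφ₁ : Function.Surjective φ₁.toRingHom)
    (hφ₂ : Function.Surjective φ₂.toRingHom)
    (hinf : RingHom.ker φ₁.toRingHom ⊓ RingHom.ker φ₂.toRingHom = ⊥)
    (hsup : RingHom.ker (aug k A).toRingHom ≤
      RingHom.ker φ₁.toRingHom ⊔ RingHom.ker φ₂.toRingHom)
    {O : Z.total.Opens} (hO : IsAffineOpen O) : IsMilnorSquareOn D₁.incl D₂.incl i₁ i₂ O := by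
  have g₁ := Deformation.isPullback_specHom h₁
  have g₂ := Deformation.isPullback_specHom h₂
  have := isClosedImmersion_of_isPullback g₁ hφ₁
  have := isClosedImmersion_of_isPullback g₂ hφ₂
  have hk₁ := ker_app_of_isPullback g₁ hφ₁ hO
  have hk₂ := ker_app_of_isPullback g₂ hφ₂ hO
  refine ⟨fun a b h h' ↦ ?_, fun a₁ a₂ ha ↦ ?_⟩
  · have hab : a - b ∈ RingHom.ker (i₁.app O).hom ⊓ RingHom.ker (i₂.app O).hom :=
      ⟨(RingHom.sub_mem_ker_iff _).mpr h, (RingHom.sub_mem_ker_iff _).mpr h'⟩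
    rw [hk₁, hk₂, map_inf_map_eq_bot_of_flat (flat_baseHom Z.specHom hO) hinf] at hab
    exact sub_eq_zero.mp hab
  · let Q := Z.incl ⁻¹ᵁ O
    have e₁ : Q ≤ D₁.incl ⁻¹ᵁ i₁ ⁻¹ᵁ O := by rw [← Scheme.Hom.comp_preimage, w₁]
    have e₂ : Q ≤ D₂.incl ⁻¹ᵁ i₂ ⁻¹ᵁ O := by rw [← Scheme.Hom.comp_preimage, w₂]
    have hq₁ := appLE_comp_app_hom w₁ e₁ le_rfl
    have hq₂ := appLE_comp_app_hom w₂ e₂ le_rfl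
    refine exists_of_ker_comp_le_sup (hq₁.trans hq₂.symm) (i₁.app_surjective O hO)
      (i₂.app_surjective O hO) ?_ a₁ a₂ (ha Q e₁ e₂)
    rw [hq₁, hk₁, hk₂, ← Ideal.map_sup, Z.incl.appLE_eq_app,
      ker_app_of_isPullback Z.isPullback_incl aug_surjective hO]
    exact Ideal.map_mono hsup

theorem isPushout_of_isPullback (h₁ : IsPullback i₁ D₁.hom Z.hom (prodSpecMap s φ₁))
    (h₂ : IsPullback i₂ D₂.hom Z.hom (prodSpecMap s φ₂)) (w₁ : D₁.incl ≫ i₁ = Z.incl)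
    (w₂ : D₂.incl ≫ i₂ = Z.incl) (hφ₁ : Function.Surjective φ₁.toRingHom)
    (hφ₂ : Function.Surjective φ₂.toRingHom)
    (hinf : RingHom.ker φ₁.toRingHom ⊓ RingHom.ker φ₂.toRingHom = ⊥)
    (hsup : RingHom.ker (aug k A).toRingHom ≤
      RingHom.ker φ₁.toRingHom ⊔ RingHom.ker φ₂.toRingHom) :
    IsPushout D₁.incl D₂.incl i₁ i₂ := by
  have g₁ := Deformation.isPullback_specHom h₁
  have := IsArtAlg.toIsLocalRing (k := k) (A := A)
  have := IsArtAlg.toIsLocalRing (k := k) (A := A₁)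
  have : IsArtinianRing A := ‹IsArtAlg k A›.2
  have := isClosedImmersion_of_isPullback g₁ hφ₁
  have := surjective_of_isPullback_specMap g₁
  refine isPushout_of_isMilnorSquareOn (w₁.trans w₂.symm) (isHomeomorph_of_isClosedImmersion i₁)
    D₂.incl.surjective (IsMilnorSquareOn.of_basis fun O z hz ↦ ?_)
  obtain ⟨O', hO', hz', hle⟩ := exists_isAffineOpen_mem_and_subset hz
  exact ⟨O', hle, hz', isMilnorSquareOn_of_isPullback h₁ h₂ w₁ w₂ hφ₁ hφ₂ hinf hsup hO'⟩

end Pushout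

section Flat

open TrivSqZeroExt

variable {k : Type u} [Field k] {S E Z : Scheme.{u}} {s : S ⟶ Spec (.of k)} {f : E ⟶ S} [Flat f]
  {V : Type u} [AddCommGroup V] [Module k V] [Module kᵐᵒᵖ V] [IsCentralScalar k V]
  [Module.Finite k V] {ι : Type*} [Fintype ι] (b : Module.Basis ι k V)
  {σ : Z ⟶ prodSpec s (TrivSqZeroExt k V)} {incl : E ⟶ Z}

include b

theorem flat_appLE_of_forall_relation (h : IsPullback incl f σ (closedPt s (TrivSqZeroExt k V)))
    {P : (prodSpec s (TrivSqZeroExt k V)).Opens} (hP : IsAffineOpen P) {O : Z.Opens}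
    (hO : IsAffineOpen O) (hOP : O ≤ σ ⁻¹ᵁ P)
    (hrel : ∀ r : ι → Γ(Z, O), ∑ i, baseHom (σ ≫ pullback.snd _ _) O (inr (b i)) * r i = 0 →
      ∀ i, incl.app O (r i) = 0) : (σ.appLE P O hOP).hom.Flat := by
  have : IsClosedImmersion incl := MorphismProperty.of_isPullback h.flip inferInstance
  have hQ : incl ⁻¹ᵁ O ≤ f ⁻¹ᵁ closedPt s (TrivSqZeroExt k V) ⁻¹ᵁ P := by
    rw [← Scheme.Hom.comp_preimage, ← h.w]
    exact incl.preimage_mono hOP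
  have hε (i) : σ.appLE P O hOP (baseHom (pullback.snd _ _) P (inr (b i))) =
      baseHom (σ ≫ pullback.snd _ _) O (inr (b i)) := appLE_baseHom_of_comp_eq rfl hOP _
  refine flat_of_forall_relation (q := ((closedPt s (TrivSqZeroExt k V)).app P).hom)
    (p := (incl.app O).hom) (φ₀ := (f.appLE _ (incl ⁻¹ᵁ O) hQ).hom)
    (ε := fun i ↦ baseHom (pullback.snd _ _) P (inr (b i))) ?_
    (HasRingHomProperty.appLE @Flat f inferInstance
      ⟨_, hP.preimage (closedPt s (TrivSqZeroExt k V))⟩ ⟨_, hO.preimage incl⟩ hQ)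
    ((closedPt s _).app_surjective P hP) (incl.app_surjective O hO)
    (fun i j ↦ baseHom_inr_mul_baseHom_inr _ _ _ _) (ker_app_eq_span b isPullback_closedPt hP)
    ?_ fun r hr ↦ hrel r (by simpa only [hε] using hr)
  · rw [← CommRingCat.hom_comp, ← CommRingCat.hom_comp, ← incl.appLE_eq_app,
      ← Scheme.Hom.appLE_eq_app, Scheme.Hom.appLE_comp_appLE, Scheme.Hom.appLE_comp_appLE,
      appLE_congr_hom h.w]
  · simp only [hε]
    exact (ker_app_eq_span b (h.paste_vert isPullback_closedPt) hO).le

theorem flat_of_isPullback_closedPt (h : IsPullback incl f σ (closedPt s (TrivSqZeroExt k V)))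
    (hrel : ∀ U : Z.Opens, ∀ z ∈ U, ∃ O ≤ U, z ∈ O ∧ IsAffineOpen O ∧ ∀ r : ι → Γ(Z, O),
      ∑ i, baseHom (σ ≫ pullback.snd _ _) O (inr (b i)) * r i = 0 →
        ∀ i, incl.app O (r i) = 0) : Flat σ := by
  refine (HasRingHomProperty.iff_exists_appLE (P := @Flat)
    (RingHom.Flat.stableUnderComposition.stableUnderCompositionWithLocalizationAway
      RingHom.Flat.holdsForLocalizationAway).left).mpr fun z ↦ ?_
  obtain ⟨P, hP, hzP, -⟩ := exists_isAffineOpen_mem_and_subset (Opens.mem_top (σ z))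
  obtain ⟨O, hOP, hz, hO, hr⟩ := hrel (σ ⁻¹ᵁ P) z hzP
  exact ⟨⟨P, hP⟩, ⟨O, hO⟩, hz, hOP, flat_appLE_of_forall_relation b h hP hO hOP hr⟩

end Flat

section Gluing

theorem isClosedImmersion_of_forall_exists {X Y : Scheme.{u}} (f : X ⟶ Y)
    (h : ∀ y : Y, ∃ W : Y.Opens, y ∈ W ∧ IsAffineOpen W ∧ IsAffineOpen (f ⁻¹ᵁ W) ∧
      Function.Surjective (f.app W)) : IsClosedImmersion f := by
  choose W hy hW hW' hs using h
  refine IsZariskiLocalAtTarget.of_iSup_eq_top W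
    (top_unique fun y _ ↦ Opens.mem_iSup.mpr ⟨y, hy y⟩) fun y ↦ ?_
  have : IsAffine (W y) := hW y
  have : IsAffine (f ⁻¹ᵁ W y) := hW' y
  refine IsClosedImmersion.of_surjective_of_isAffine _ ?_
  rw [morphismRestrict_appTop]
  have hs' : Function.Surjective (f.app ((W y).ι ''ᵁ ⊤)) := by
    rw [(W y).ι_image_top]
    exact hs y
  exact (ConcreteCategory.bijective_of_isIso
    (X.presheaf.map (eqToHom (image_morphismRestrict_preimage f (W y) ⊤)).op)).2.comp hs'

section IsMilnorSquareOn

variable {X D₁ D₂ Z : Scheme.{u}} {j₁ : X ⟶ D₁} {j₂ : X ⟶ D₂} {i₁ : D₁ ⟶ Z} {i₂ : D₂ ⟶ Z}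
  {W : Z.Opens}

theorem appLE_comp_app_comm (w : j₁ ≫ i₁ = j₂ ≫ i₂) {Q : X.Opens} (h₁ : Q ≤ j₁ ⁻¹ᵁ i₁ ⁻¹ᵁ W)
    (h₂ : Q ≤ j₂ ⁻¹ᵁ i₂ ⁻¹ᵁ W) :
    (j₁.appLE (i₁ ⁻¹ᵁ W) Q h₁).hom.comp (i₁.app W).hom =
      (j₂.appLE (i₂ ⁻¹ᵁ W) Q h₂).hom.comp (i₂.app W).hom :=
  (appLE_comp_app_hom w h₁ (by rwa [Scheme.Hom.comp_preimage])).trans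
    (appLE_comp_app_hom rfl h₂ (by rwa [Scheme.Hom.comp_preimage])).symm

theorem IsMilnorSquareOn.symm (h : IsMilnorSquareOn j₁ j₂ i₁ i₂ W) :
    IsMilnorSquareOn j₂ j₁ i₂ i₁ W :=
  ⟨fun a b h₂ h₁ ↦ h.ext a b h₁ h₂, fun a₂ a₁ ha ↦
    (h.exists_app_eq a₁ a₂ fun Q h₁ h₂ ↦ (ha Q h₂ h₁).symm).imp fun _ ↦ And.symm⟩

theorem IsMilnorSquareOn.app_surjective (h : IsMilnorSquareOn j₁ j₂ i₁ i₂ W)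
    (w : j₁ ≫ i₁ = j₂ ≫ i₂) [IsClosedImmersion j₂] (hW : IsAffineOpen (i₂ ⁻¹ᵁ W)) :
    Function.Surjective (i₁.app W) := by
  refine surjective_fst_of_fibreProduct (p₁ := (i₁.app W).hom)
    (fun _ _ ↦ exists_of_isPullback_commRingCat (h.isPullback w)) ?_
  generalize_proofs hQ
  revert hQ
  rw [preimage_preimage_eq w W]
  intro hQ
  rw [j₂.appLE_eq_app]
  exact j₂.app_surjective _ hW

end IsMilnorSquareOn

variable {k : Type u} [Field k] {S : Scheme.{u}} {s : S ⟶ Spec (.of k)} {X : Over S}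
  {A A₁ A₂ : Type u} [CommRing A] [Algebra k A]
  [CommRing A₁] [Algebra k A₁] [IsArtAlg k A₁] [CommRing A₂] [Algebra k A₂] [IsArtAlg k A₂]

theorem Deformation.comp_snd_eq (D : Deformation s X A₁) {φ : A →ₐ[k] A₁} {Z : Scheme.{u}}
    {i : D.total ⟶ Z} {σ : Z ⟶ prodSpec s A} (h : i ≫ σ = D.hom ≫ prodSpecMap s φ) :
    i ≫ σ ≫ pullback.snd _ _ = D.specHom ≫ Spec.map (CommRingCat.ofHom φ.toRingHom) := by
  rw [← Category.assoc, h, Category.assoc, (isPullback_prodSpecMap φ).w, Deformation.specHom,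
    Category.assoc]

variable {φ₁ : A →ₐ[k] A₁} {φ₂ : A →ₐ[k] A₂} {D₁ : Deformation s X A₁} {D₂ : Deformation s X A₂}
  {Z : Scheme.{u}} {i₁ : D₁.total ⟶ Z} {i₂ : D₂.total ⟶ Z}

theorem ker_app_le_of_isMilnorSquareOn {τ : Z ⟶ Spec (.of A)}
    (w : D₁.incl ≫ i₁ = D₂.incl ≫ i₂)
    (hτ₁ : i₁ ≫ τ = D₁.specHom ≫ Spec.map (CommRingCat.ofHom φ₁.toRingHom))
    (hτ₂ : i₂ ≫ τ = D₂.specHom ≫ Spec.map (CommRingCat.ofHom φ₂.toRingHom))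
    (hker : RingHom.ker (aug k A₂).toRingHom ≤ (RingHom.ker φ₁.toRingHom).map φ₂.toRingHom)
    {O : Z.Opens} (hO₁ : IsAffineOpen (i₁ ⁻¹ᵁ O)) (hO₂ : IsAffineOpen (i₂ ⁻¹ᵁ O))
    (h : IsMilnorSquareOn D₁.incl D₂.incl i₁ i₂ O) :
    RingHom.ker (i₁.app O).hom ≤ (RingHom.ker φ₁.toRingHom).map (baseHom τ O) := by
  have hp₂ : Function.Surjective (i₂.app O).hom := h.symm.app_surjective w.symm hO₁
  have hq : (D₁.incl.appLE (i₁ ⁻¹ᵁ O) (D₂.incl ⁻¹ᵁ i₂ ⁻¹ᵁ O) (preimage_preimage_eq w O).ge).hom.comp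
      (i₁.app O).hom = (D₂.incl.app (i₂ ⁻¹ᵁ O)).hom.comp (i₂.app O).hom := by
    rw [← D₂.incl.appLE_eq_app]
    exact appLE_comp_app_comm w _ _
  refine ker_fst_le_of_fibreProduct hq h.ext hp₂ (Ideal.map_le_iff_le_comap.mpr fun a ha ↦ ?_) ?_
  · refine (app_baseHom hτ₁ O a).trans ?_
    rw [(ha : φ₁.toRingHom a = 0), map_zero]
  · have hp : (i₂.app O).hom.comp (baseHom τ O) =
        (baseHom D₂.specHom (i₂ ⁻¹ᵁ O)).comp φ₂.toRingHom := RingHom.ext fun a ↦ app_baseHom hτ₂ O a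
    rw [Ideal.map_map, hp, ← Ideal.map_map,
      ker_app_of_isPullback D₂.isPullback_incl aug_surjective hO₂]
    exact Ideal.map_mono hker

theorem isPullback_of_isMilnorSquareOn {σ : Z ⟶ prodSpec s A} (w : D₁.incl ≫ i₁ = D₂.incl ≫ i₂)
    (hσ₁ : i₁ ≫ σ = D₁.hom ≫ prodSpecMap s φ₁) (hσ₂ : i₂ ≫ σ = D₂.hom ≫ prodSpecMap s φ₂)
    (hφ₁ : Function.Surjective φ₁.toRingHom)
    (hker : RingHom.ker (aug k A₂).toRingHom ≤ (RingHom.ker φ₁.toRingHom).map φ₂.toRingHom)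
    (h : ∀ z : Z, ∃ O : Z.Opens, z ∈ O ∧ IsAffineOpen O ∧ IsAffineOpen (i₁ ⁻¹ᵁ O) ∧
      IsAffineOpen (i₂ ⁻¹ᵁ O) ∧ IsMilnorSquareOn D₁.incl D₂.incl i₁ i₂ O) :
    IsPullback i₁ D₁.hom σ (prodSpecMap s φ₁) := by
  have : IsClosedImmersion i₁ := isClosedImmersion_of_forall_exists i₁ fun z ↦
    (h z).imp fun O ⟨hz, hO, hO₁, hO₂, hM⟩ ↦ ⟨hz, hO, hO₁, hM.app_surjective w hO₂⟩
  refine IsPullback.of_bot ?_ hσ₁ (isPullback_prodSpecMap φ₁)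
  exact isPullback_of_ker_app_le (D₁.comp_snd_eq hσ₁) hφ₁ fun z ↦
    (h z).imp fun O ⟨hz, hO, hO₁, hO₂, hM⟩ ↦ ⟨hz, hO, ker_app_le_of_isMilnorSquareOn w
      (D₁.comp_snd_eq hσ₁) (D₂.comp_snd_eq hσ₂) hker hO₁ hO₂ hM⟩

theorem Deformation.incl_comp_hom_comp_prodSpecMap [IsArtAlg k A]
    (D : Deformation s X A₁) (φ : A →ₐ[k] A₁) :
    D.incl ≫ D.hom ≫ prodSpecMap s φ = X.hom ≫ closedPt s A := by
  rw [← Category.assoc, D.isDeformation.isPullback.w, Category.assoc, closedPt_map]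

end Gluing

section GluingSquareZero

open TrivSqZeroExt

variable {k : Type u} [Field k] {S : Scheme.{u}} {s : S ⟶ Spec (.of k)} {X : Over S}
  {V W : Type u} [AddCommGroup V] [Module k V] [Module kᵐᵒᵖ V] [IsCentralScalar k V]
  [AddCommGroup W] [Module k W] [Module kᵐᵒᵖ W] [IsCentralScalar k W]
  [Module.Finite k V] [Module.Finite k W]

theorem app_eq_zero_of_sum_prod_eq_zero {D₁ : Deformation s X (TrivSqZeroExt k V)}
    {D₂ : Deformation s X (TrivSqZeroExt k W)} {Z : Scheme.{u}} {i₁ : D₁.total ⟶ Z}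
    {i₂ : D₂.total ⟶ Z} {τ : Z ⟶ Spec (.of (TrivSqZeroExt k (V × W)))}
    (w : D₁.incl ≫ i₁ = D₂.incl ≫ i₂)
    (hτ₁ : i₁ ≫ τ = D₁.specHom ≫
      Spec.map (CommRingCat.ofHom (TrivSqZeroExt.map (LinearMap.fst k V W)).toRingHom))
    (hτ₂ : i₂ ≫ τ = D₂.specHom ≫
      Spec.map (CommRingCat.ofHom (TrivSqZeroExt.map (LinearMap.snd k V W)).toRingHom))
    {O : Z.Opens} (hO₁ : IsAffineOpen (i₁ ⁻¹ᵁ O)) (hO₂ : IsAffineOpen (i₂ ⁻¹ᵁ O))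
    {ι κ : Type*} [Fintype ι] [Fintype κ] (b : Module.Basis ι k V) (c : Module.Basis κ k W)
    {r : ι ⊕ κ → Γ(Z, O)} (hr : ∑ x, baseHom τ O (inr (b.prod c x)) * r x = 0) (x : ι ⊕ κ) :
    (D₁.incl ≫ i₁).app O (r x) = 0 := by
  have hq : (D₁.incl.appLE _ _ le_rfl).hom.comp (i₁.app O).hom = ((D₁.incl ≫ i₁).app O).hom := by
    rw [← (D₁.incl ≫ i₁).appLE_eq_app]
    exact appLE_comp_app_hom rfl _ _
  have hw := appLE_comp_app_comm w (W := O) le_rfl (preimage_preimage_eq w O).le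
  have h₁ (y : V × W) := app_baseHom_inr hτ₁ O y
  have h₂ (y : V × W) := app_baseHom_inr hτ₂ O y
  refine congr($hq (r x)).symm.trans (eq_zero_of_sum_eq_zero_of_fibreProduct
    (t := fun y ↦ baseHom τ O (inr (b.prod c y))) hw ?_ ?_ ?_ ?_ hr x)
  · exact fun j ↦ (h₁ _).trans (by simp [Module.Basis.prod_apply])
  · exact fun i ↦ (h₂ _).trans (by simp [Module.Basis.prod_apply])
  · refine fun r hr ↦ D₁.appLE_eq_zero_of_sum_eq_zero b.linearIndependent hO₁ rfl ?_
    simpa [h₁, Module.Basis.prod_apply] using hr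
  · refine fun r hr ↦ D₂.appLE_eq_zero_of_sum_eq_zero c.linearIndependent hO₂
      (preimage_preimage_eq w O) ?_
    simpa [h₂, Module.Basis.prod_apply] using hr

theorem Deformation.exists_isPushout (D₁ : Deformation s X (TrivSqZeroExt k V))
    (D₂ : Deformation s X (TrivSqZeroExt k W)) :
    ∃ (Z : Deformation s X (TrivSqZeroExt k (V × W))) (i₁ : D₁.total ⟶ Z.total)
      (i₂ : D₂.total ⟶ Z.total),
      IsPushout D₁.incl D₂.incl i₁ i₂ ∧ D₁.incl ≫ i₁ = Z.incl ∧
      IsPullback i₁ D₁.hom Z.hom (prodSpecMap s (TrivSqZeroExt.map (LinearMap.fst k V W))) ∧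
      IsPullback i₂ D₂.hom Z.hom (prodSpecMap s (TrivSqZeroExt.map (LinearMap.snd k V W))) := by
  obtain ⟨Z, i₁, i₂, w, hi₁, -, hb⟩ := exists_isMilnorSquareOn D₁.incl D₂.incl
  have hpo : IsPushout D₁.incl D₂.incl i₁ i₂ :=
    isPushout_of_isMilnorSquareOn w hi₁ D₂.incl.surjective (.of_basis fun O z hz ↦
      (hb O z hz).imp fun _ h ↦ ⟨h.1, h.2.1, h.2.2.2.2.2⟩)
  let σ : Z ⟶ prodSpec s (TrivSqZeroExt k (V × W)) := hpo.desc _ _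
    ((D₁.incl_comp_hom_comp_prodSpecMap (TrivSqZeroExt.map (LinearMap.fst k V W))).trans
      (D₂.incl_comp_hom_comp_prodSpecMap (TrivSqZeroExt.map (LinearMap.snd k V W))).symm)
  have hσ₁ : i₁ ≫ σ = D₁.hom ≫ prodSpecMap s _ := hpo.inl_desc _ _ _
  have hσ₂ : i₂ ≫ σ = D₂.hom ≫ prodSpecMap s _ := hpo.inr_desc _ _ _
  have P₁ : IsPullback i₁ D₁.hom σ (prodSpecMap s (TrivSqZeroExt.map (LinearMap.fst k V W))) :=
    isPullback_of_isMilnorSquareOn w hσ₁ hσ₂ (trivSqZeroExt_map_surjective Prod.fst_surjective)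
      (ker_aug_le_map_ker_map fun y ↦ ⟨(0, y), rfl, rfl⟩) fun z ↦
      (hb ⊤ z (Opens.mem_top z)).imp fun _ h ↦ h.2
  have P₂ : IsPullback i₂ D₂.hom σ (prodSpecMap s (TrivSqZeroExt.map (LinearMap.snd k V W))) :=
    isPullback_of_isMilnorSquareOn w.symm hσ₂ hσ₁
      (trivSqZeroExt_map_surjective Prod.snd_surjective)
      (ker_aug_le_map_ker_map fun x ↦ ⟨(x, 0), rfl, rfl⟩) fun z ↦
      (hb ⊤ z (Opens.mem_top z)).imp fun _ ⟨_, hz, hO, hO₁, hO₂, h⟩ ↦ ⟨hz, hO, hO₂, hO₁, h.symm⟩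
  have P₀ : IsPullback (D₁.incl ≫ i₁) X.hom σ (closedPt s _) := by
    rw [← closedPt_map s (TrivSqZeroExt.map (LinearMap.fst k V W))]
    exact D₁.isDeformation.isPullback.paste_horiz P₁
  have : Flat X.hom := D₁.flat_specialFibre
  have hσ : Flat σ := flat_of_isPullback_closedPt
    ((Module.finBasis k V).prod (Module.finBasis k W)) P₀ fun U z hz ↦
    (hb U z hz).imp fun O ⟨hOU, hz, hO, hO₁, hO₂, _⟩ ↦ ⟨hOU, hz, hO, fun _ ↦
      app_eq_zero_of_sum_prod_eq_zero w (D₁.comp_snd_eq hσ₁) (D₂.comp_snd_eq hσ₂) hO₁ hO₂ _ _⟩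
  have : IsClosedImmersion (D₁.incl ≫ i₁) := MorphismProperty.of_isPullback P₀.flip inferInstance
  exact ⟨⟨Z, D₁.incl ≫ i₁, σ, this, hσ, P₀⟩, i₁, i₂, hpo, rfl, P₁, P₂⟩

end GluingSquareZero

section Pairs

variable {k : Type u} [Field k] {S : Scheme.{u}} {s : S ⟶ Spec (.of k)} {X : Over S}

theorem Deformation.cls_eq_of_isPushout {A : Type u} [CommRing A] [Algebra k A] [IsArtAlg k A]
    {Z Z' : Deformation s X A} {D₁ D₂ : Scheme.{u}} {j₁ : X.left ⟶ D₁} {j₂ : X.left ⟶ D₂}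
    {i₁ : D₁ ⟶ Z.total} {i₂ : D₂ ⟶ Z.total} {i₁' : D₁ ⟶ Z'.total} {i₂' : D₂ ⟶ Z'.total}
    (h : IsPushout j₁ j₂ i₁ i₂) (h' : IsPushout j₁ j₂ i₁' i₂') (w : j₁ ≫ i₁ = Z.incl)
    (w' : j₁ ≫ i₁' = Z'.incl) (e₁ : i₁ ≫ Z.hom = i₁' ≫ Z'.hom) (e₂ : i₂ ≫ Z.hom = i₂' ≫ Z'.hom) :
    Z.cls = Z'.cls := by
  refine Quotient.sound ⟨h.isoIsPushout _ _ h', h.hom_ext ?_ ?_, ?_⟩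
  · rw [IsPushout.inl_isoIsPushout_hom_assoc, e₁]
  · rw [IsPushout.inr_isoIsPushout_hom_assoc, e₂]
  · rw [← w, Category.assoc, IsPushout.inl_isoIsPushout_hom, w']

variable {V W U : Type u} [AddCommGroup V] [Module k V] [Module kᵐᵒᵖ V] [IsCentralScalar k V]
  [AddCommGroup W] [Module k W] [Module kᵐᵒᵖ W] [IsCentralScalar k W]
  [AddCommGroup U] [Module k U] [Module kᵐᵒᵖ U] [IsCentralScalar k U]
  [Module.Finite k V] [Module.Finite k W] [Module.Finite k U]

namespace DefClass

/-- The functoriality of `V ↦ DefClass s X (TrivSqZeroExt k V)` in linear maps, through which all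
operations on first order deformation classes are expressed. -/
def lin (a : DefClass s X (TrivSqZeroExt k V)) (l : V →ₗ[k] W) :
    DefClass s X (TrivSqZeroExt k W) :=
  a.map (TrivSqZeroExt.map l)

theorem lin_id (a : DefClass s X (TrivSqZeroExt k V)) : a.lin LinearMap.id = a := by
  rw [lin, TrivSqZeroExt.map_id, map_id]

theorem lin_lin (a : DefClass s X (TrivSqZeroExt k V)) (l : V →ₗ[k] W) (m : W →ₗ[k] U) :
    (a.lin l).lin m = a.lin (m ∘ₗ l) := by
  rw [lin, lin, lin, map_map, TrivSqZeroExt.map_comp_map]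

theorem lin_zero [Flat X.hom] (a : DefClass s X (TrivSqZeroExt k V)) :
    a.lin (0 : V →ₗ[k] W) = (Deformation.trivial s X (TrivSqZeroExt k W)).cls := by
  rw [← map_ofId_comp_aug a, lin]
  congr 1
  rw [← algHom_eq_aug (TrivSqZeroExt.fstHom k k V)]
  ext x <;> simp

theorem exists_pair (a : DefClass s X (TrivSqZeroExt k V))
    (b : DefClass s X (TrivSqZeroExt k W)) : ∃ z : DefClass s X (TrivSqZeroExt k (V × W)),
      z.lin (LinearMap.fst k V W) = a ∧ z.lin (LinearMap.snd k V W) = b := by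
  induction a using DefClass.ind with | _ D₁
  induction b using DefClass.ind with | _ D₂
  obtain ⟨Z, i₁, i₂, hp, w₁, h₁, h₂⟩ := D₁.exists_isPushout D₂
  exact ⟨Z.cls, (Deformation.cls_eq_of_isPullback h₁ w₁).symm,
    (Deformation.cls_eq_of_isPullback h₂ (hp.w.symm.trans w₁)).symm⟩

theorem pair_ext {z z' : DefClass s X (TrivSqZeroExt k (V × W))}
    (h₁ : z.lin (LinearMap.fst k V W) = z'.lin (LinearMap.fst k V W))
    (h₂ : z.lin (LinearMap.snd k V W) = z'.lin (LinearMap.snd k V W)) : z = z' := by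
  induction z using DefClass.ind with | _ Z
  induction z' using DefClass.ind with | _ Z'
  let D₁ := Z.baseChange (TrivSqZeroExt.map (LinearMap.fst k V W))
  let D₂ := Z.baseChange (TrivSqZeroExt.map (LinearMap.snd k V W))
  have hpush {Z' : Deformation s X (TrivSqZeroExt k (V × W))} {i₁ : D₁.total ⟶ Z'.total}
      {i₂ : D₂.total ⟶ Z'.total} (h₁ : IsPullback i₁ D₁.hom Z'.hom (prodSpecMap s _))
      (h₂ : IsPullback i₂ D₂.hom Z'.hom (prodSpecMap s _)) (w₁ : D₁.incl ≫ i₁ = Z'.incl)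
      (w₂ : D₂.incl ≫ i₂ = Z'.incl) : IsPushout D₁.incl D₂.incl i₁ i₂ :=
    isPushout_of_isPullback h₁ h₂ w₁ w₂ (trivSqZeroExt_map_surjective Prod.fst_surjective)
      (trivSqZeroExt_map_surjective Prod.snd_surjective) ker_map_fst_inf_ker_map_snd
      ker_aug_le_ker_map_fst_sup_ker_map_snd
  obtain ⟨i₁, hi₁, w₁⟩ := Z.exists_isPullback_baseChange (TrivSqZeroExt.map (.fst k V W))
  obtain ⟨i₂, hi₂, w₂⟩ := Z.exists_isPullback_baseChange (TrivSqZeroExt.map (.snd k V W))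
  obtain ⟨i₁', hi₁', w₁'⟩ := Deformation.exists_isPullback_of_cls_eq (E := D₁) h₁
  obtain ⟨i₂', hi₂', w₂'⟩ := Deformation.exists_isPullback_of_cls_eq (E := D₂) h₂
  exact Deformation.cls_eq_of_isPushout (hpush hi₁ hi₂ w₁ w₂) (hpush hi₁' hi₂' w₁' w₂') w₁ w₁'
    (hi₁.w.trans hi₁'.w.symm) (hi₂.w.trans hi₂'.w.symm)

end DefClass

end Pairs

section Tangent

open scoped DualNumber

variable {k : Type u} [Field k] {S : Scheme.{u}} {s : S ⟶ Spec (.of k)} {X : Over S}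
  {V : Type u} [AddCommGroup V] [Module k V] [Module kᵐᵒᵖ V] [IsCentralScalar k V]
  [Module.Finite k V]

theorem IsGluing.lin_eq {D₁ D₂ : Deformation s X k[ε]} {Z : Deformation s X (DualSq k)}
    (h : IsGluing D₁ D₂ Z) : Z.cls.lin (LinearMap.fst k k k) = D₁.cls ∧
      Z.cls.lin (LinearMap.snd k k k) = D₂.cls := by
  obtain ⟨i₁, i₂, hp, w, h₁, h₂⟩ := h
  obtain ⟨Z', i₁', i₂', hp', w', h₁', h₂'⟩ := D₁.exists_isPushout D₂
  have hcls : Z.cls = Z'.cls := Deformation.cls_eq_of_isPushout hp hp' w w'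
    (h₁.trans h₁'.w.symm) (h₂.trans h₂'.w.symm)
  rw [hcls]
  exact ⟨(Deformation.cls_eq_of_isPullback h₁' w').symm,
    (Deformation.cls_eq_of_isPullback h₂' (hp'.w.symm.trans w')).symm⟩

theorem exists_isGluing (D₁ D₂ : Deformation s X k[ε]) : ∃ Z, IsGluing D₁ D₂ Z :=
  let ⟨Z, i₁, i₂, hp, w, h₁, h₂⟩ := D₁.exists_isPushout D₂
  ⟨Z, i₁, i₂, hp, w, h₁.w, h₂.w⟩

namespace DefClass

/-- The sum of two first order deformation classes: the pushforward along `(v, w) ↦ v + w` of the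
unique class over `k[k × k]` that restricts to the two given ones. -/
def add (a b : DefClass s X k[ε]) : DefClass s X k[ε] :=
  (exists_pair a b).choose.lin (LinearMap.fst k k k + LinearMap.snd k k k)

theorem add_eq {a b : DefClass s X k[ε]} {z : DefClass s X (DualSq k)}
    (h₁ : z.lin (LinearMap.fst k k k) = a) (h₂ : z.lin (LinearMap.snd k k k) = b) :
    a.add b = z.lin (LinearMap.fst k k k + LinearMap.snd k k k) := by
  have h := (exists_pair a b).choose_spec
  rw [add, pair_ext (h.1.trans h₁.symm) (h.2.trans h₂.symm)]

theorem lin_add_lin (z : DefClass s X (TrivSqZeroExt k V)) (l m : V →ₗ[k] k) :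
    add (z.lin l) (z.lin m) = z.lin (l + m) := by
  have h₁ : (z.lin (l.prod m)).lin (LinearMap.fst k k k) = z.lin l := by
    rw [lin_lin, LinearMap.fst_prod]
  have h₂ : (z.lin (l.prod m)).lin (LinearMap.snd k k k) = z.lin m := by
    rw [lin_lin, LinearMap.snd_prod]
  rw [add_eq h₁ h₂, lin_lin, LinearMap.add_comp, LinearMap.fst_prod, LinearMap.snd_prod]

theorem add_eq_iff_isSum (a b c : DefClass s X k[ε]) : a.add b = c ↔ IsSum a b c := by
  constructor
  · rintro rfl
    induction a using DefClass.ind with | _ D₁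
    induction b using DefClass.ind with | _ D₂
    obtain ⟨Z, hZ⟩ := exists_isGluing D₁ D₂
    exact ⟨D₁, D₂, Z, rfl, rfl, hZ, (add_eq hZ.lin_eq.1 hZ.lin_eq.2).symm⟩
  · rintro ⟨D₁, D₂, Z, rfl, rfl, hZ, rfl⟩
    exact add_eq hZ.lin_eq.1 hZ.lin_eq.2

protected theorem add_assoc (a b c : DefClass s X k[ε]) : (a.add b).add c = a.add (b.add c) := by
  obtain ⟨x, rfl, rfl⟩ := a.exists_pair b
  obtain ⟨z, rfl, rfl⟩ := x.exists_pair c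
  simp only [lin_lin, lin_add_lin, add_assoc]

protected theorem add_comm (a b : DefClass s X k[ε]) : a.add b = b.add a := by
  obtain ⟨x, rfl, rfl⟩ := a.exists_pair b
  simp only [lin_add_lin, add_comm]

theorem trivial_add [Flat X.hom] (a : DefClass s X k[ε]) :
    (Deformation.trivial s X k[ε]).cls.add a = a := calc
  (Deformation.trivial s X k[ε]).cls.add a = (a.lin (0 : k →ₗ[k] k)).add (a.lin .id) := by
    rw [lin_zero, lin_id]
  _ = a := by rw [lin_add_lin, zero_add, lin_id]

theorem lin_neg_id_add [Flat X.hom] (a : DefClass s X k[ε]) :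
    (a.lin (-.id : k →ₗ[k] k)).add a = (Deformation.trivial s X k[ε]).cls := calc
  (a.lin (-.id : k →ₗ[k] k)).add a = (a.lin (-.id : k →ₗ[k] k)).add (a.lin .id) := by rw [lin_id]
  _ = (Deformation.trivial s X k[ε]).cls := by rw [lin_add_lin, neg_add_cancel, lin_zero]

theorem lin_trivial [Flat X.hom] (l : V →ₗ[k] k) :
    (Deformation.trivial s X (TrivSqZeroExt k V)).cls.lin l =
      (Deformation.trivial s X k[ε]).cls := by
  rw [← lin_zero (Deformation.trivial s X (TrivSqZeroExt k V)).cls, lin_lin, LinearMap.comp_zero,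
    lin_zero]

theorem add_lin (a b : DefClass s X k[ε]) (l : k →ₗ[k] k) :
    (a.add b).lin l = (a.lin l).add (b.lin l) := by
  obtain ⟨x, rfl, rfl⟩ := a.exists_pair b
  simp only [lin_lin, lin_add_lin, LinearMap.comp_add]

end DefClass

variable (s X) [Flat X.hom]

/-- The group structure on the first order deformation classes of a flat scheme; its zero is the
class of the trivial deformation. -/
abbrev tangentAddCommGroup : AddCommGroup (DefClass s X k[ε]) :=
  letI : Add (DefClass s X k[ε]) := ⟨DefClass.add⟩
  letI : Zero (DefClass s X k[ε]) := ⟨(Deformation.trivial s X k[ε]).cls⟩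
  letI : Neg (DefClass s X k[ε]) := ⟨fun a ↦ a.lin (-.id : k →ₗ[k] k)⟩
  { AddGroup.ofLeftAxioms DefClass.add_assoc DefClass.trivial_add DefClass.lin_neg_id_add with
    add_comm := DefClass.add_comm }

/-- The vector space structure on the first order deformation classes of a flat scheme, in which
`c` acts by base change along `ε ↦ c • ε`. -/
abbrev tangentModule :
    letI := tangentAddCommGroup s X
    Module k (DefClass s X k[ε]) :=
  letI := tangentAddCommGroup s X
  { smul c a := a.lin (c • .id : k →ₗ[k] k)
    one_smul a := by
      change a.lin ((1 : k) • .id) = a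
      rw [one_smul, DefClass.lin_id]
    mul_smul c d a := by
      change a.lin ((c * d) • .id) = (a.lin (d • .id)).lin (c • .id)
      rw [DefClass.lin_lin, LinearMap.smul_comp, LinearMap.id_comp, mul_smul]
    smul_zero c := DefClass.lin_trivial _
    smul_add c a b := by
      change (a.add b).lin (c • .id) = (a.lin (c • .id)).add (b.lin (c • .id))
      rw [DefClass.add_lin]
    add_smul c d a := by
      change a.lin ((c + d) • .id) = (a.lin (c • .id)).add (a.lin (d • .id))
      rw [DefClass.lin_add_lin, add_smul]
    zero_smul a := by
      change a.lin ((0 : k) • .id) = (Deformation.trivial s X k[ε]).cls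
      rw [zero_smul, DefClass.lin_zero] }

theorem isTangentSpace :
    letI := tangentAddCommGroup s X
    letI := tangentModule s X
    IsTangentSpace s X :=
  letI := tangentAddCommGroup s X
  letI := tangentModule s X
  ⟨DefClass.add_eq_iff_isSum, fun _ _ ↦ rfl⟩

end Tangent

section Image

open scoped DualNumber

variable {k : Type u} [Field k] {S T : Scheme.{u}} {s : S ⟶ Spec (.of k)} {t : T ⟶ Spec (.of k)}
  {F : Over S ⥤ Over T} {p : NatProj s t F} {X : Over S} {A B : Type u} [CommRing A] [Algebra k A]
  [IsArtAlg k A] [CommRing B] [Algebra k B] [IsArtAlg k B]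

/-- A morphism between the total spaces of two deformations of `X`, possibly over different
Artinian algebras, regarded as a morphism of `S`-schemes so that `F` can be applied to it. -/
def Deformation.overHom {D : Deformation s X A} {E : Deformation s X B} {φ : A →ₐ[k] B}
    (f : E.total ⟶ D.total) (w : f ≫ D.hom = E.hom ≫ prodSpecMap s φ) : E.toOver ⟶ D.toOver :=
  Over.homMk f (by
    change f ≫ D.hom ≫ _ = E.hom ≫ _
    rw [reassoc_of% w, prodSpecMap_fst])

theorem map_inclOver_comp_imageHom (D : Deformation s X A) :
    (F.map D.inclOver).left ≫ imageHom p D = (F.obj X).hom ≫ closedPt t A := by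
  apply pullback.hom_ext
  · rw [Category.assoc, Category.assoc, closedPt_fst, imageHom, pullback.lift_fst,
      Category.comp_id, Over.w]
  · have h : D.inclOver.left ≫ D.hom = X.hom ≫ closedPt s A := D.isDeformation.isPullback.w
    rw [Category.assoc, Category.assoc, imageHom, pullback.lift_snd, ← Category.assoc,
      p.naturality, Category.assoc, reassoc_of% h, closedPt, closedPt, pullback.lift_snd,
      pullback.lift_snd]
    simpa only [Category.assoc] using p.comm X =≫ _

theorem map_overHom_comp_imageHom {D : Deformation s X A} {E : Deformation s X B}
    {φ : A →ₐ[k] B} (f : E.total ⟶ D.total) (w : f ≫ D.hom = E.hom ≫ prodSpecMap s φ) :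
    (F.map (Deformation.overHom f w)).left ≫ imageHom p D = imageHom p E ≫ prodSpecMap t φ := by
  apply pullback.hom_ext
  · rw [Category.assoc, Category.assoc, prodSpecMap_fst, imageHom, imageHom, pullback.lift_fst,
      pullback.lift_fst, Over.w]
  · have h : (Deformation.overHom f w).left ≫ D.hom = E.hom ≫ prodSpecMap s φ := w
    rw [Category.assoc, Category.assoc, imageHom, imageHom, pullback.lift_snd, ← Category.assoc,
      p.naturality, Category.assoc, reassoc_of% h, prodSpecMap, prodSpecMap, pullback.lift_snd,
      pullback.lift_snd, pullback.lift_snd_assoc, Category.assoc, Category.assoc]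

/-- The functor `F` commutes with base change of deformations along morphisms of Artinian algebras:
it takes the cartesian square of such a base change to a cartesian square. -/
def PreservesBaseChange (p : NatProj s t F) : Prop :=
  ∀ (X : Over S) (A B : Type u) [CommRing A] [Algebra k A] [IsArtAlg k A] [CommRing B]
    [Algebra k B] [IsArtAlg k B] (D : Deformation s X A) (E : Deformation s X B) (φ : A →ₐ[k] B)
    (f : E.total ⟶ D.total) (hf : IsPullback f E.hom D.hom (prodSpecMap s φ)),
    IsPullback (F.map (Deformation.overHom f hf.w)).left (imageHom p E) (imageHom p D)
      (prodSpecMap t φ)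

namespace PreservesDeformations

variable (h : PreservesDeformations p) (hbc : PreservesBaseChange p)

include hbc in
theorem cls_image_eq_map {D : Deformation s X A} {E : Deformation s X B} {φ : A →ₐ[k] B}
    (e : E.cls = D.cls.map φ) : (h.image E).cls = (h.image D).cls.map φ := by
  obtain ⟨f, hf, w⟩ := Deformation.exists_isPullback_of_cls_eq e
  refine Deformation.cls_eq_of_isPullback (hbc X A B D E φ f hf) ?_
  change (F.map E.inclOver).left ≫ (F.map _).left = (F.map D.inclOver).left
  rw [← Over.comp_left, ← F.map_comp]
  congr 2
  ext
  exact w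

/-- The map on deformation classes induced by `F`. -/
def imageClass (A : Type u) [CommRing A] [Algebra k A] [IsArtAlg k A] (a : DefClass s X A) :
    DefClass t (F.obj X) A :=
  Quotient.lift (fun D ↦ (h.image D).cls) (fun D E e ↦ by
    have hcls : D.cls = E.cls.map (AlgHom.id k A) := (Quotient.sound e).trans E.cls.map_id.symm
    exact (h.cls_image_eq_map hbc hcls).trans (h.image E).cls.map_id) a

theorem imageClass_cls (D : Deformation s X A) :
    h.imageClass hbc A D.cls = (h.image D).cls := rfl

theorem imageClass_map (φ : A →ₐ[k] B) (a : DefClass s X A) :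
    h.imageClass hbc B (a.map φ) = (h.imageClass hbc A a).map φ := by
  induction a using DefClass.ind with | _ D
  exact h.cls_image_eq_map hbc rfl

theorem imageClass_add (a b : DefClass s X k[ε]) :
    h.imageClass hbc k[ε] (a.add b) = (h.imageClass hbc k[ε] a).add (h.imageClass hbc k[ε] b) := by
  obtain ⟨z, rfl, rfl⟩ := a.exists_pair b
  rw [DefClass.lin_add_lin, DefClass.lin, DefClass.lin, DefClass.lin, imageClass_map,
    imageClass_map, imageClass_map]
  exact (DefClass.lin_add_lin (h.imageClass hbc _ z) _ _).symm

end PreservesDeformations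

theorem IsSmoothFunctor.of_preservesBaseChange (h : PreservesDeformations p)
    (hbc : PreservesBaseChange p) (hF : ∀ X : Over S, Flat X.hom → Flat (F.obj X).hom) :
    IsSmoothFunctor p := by
  refine ⟨h, fun X hX ↦ ?_⟩
  have := hF X hX
  refine ⟨tangentAddCommGroup s X, tangentModule s X, tangentAddCommGroup t _, tangentModule t _,
    isTangentSpace s X, isTangentSpace t _, ?_⟩
  let := tangentAddCommGroup s X
  let := tangentModule s X
  let := tangentAddCommGroup t (F.obj X)
  let := tangentModule t (F.obj X)
  exact ⟨{ toFun := h.imageClass hbc k[ε]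
           map_add' := h.imageClass_add hbc
           map_smul' := fun c a ↦ h.imageClass_map hbc _ a }, h.imageClass_cls hbc⟩

end Image

section FibreProduct

variable {k : Type u} [Field k] {S Y : Scheme.{u}} (s : S ⟶ Spec (.of k)) (g : Y ⟶ S)

/-- The morphism `g × Spec A : Y ×ₖ Spec A ⟶ S ×ₖ Spec A`. -/
def prodSpecBase (A : Type u) [CommRing A] [Algebra k A] : prodSpec (g ≫ s) A ⟶ prodSpec s A :=
  pullback.lift (pullback.fst _ _ ≫ g) (pullback.snd _ _) (by
    rw [Category.assoc, pullback.condition])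

section ProdSpecBase

variable (A : Type u) [CommRing A] [Algebra k A]

theorem prodSpecBase_fst :
    prodSpecBase s g A ≫ pullback.fst _ _ = pullback.fst _ _ ≫ g :=
  pullback.lift_fst _ _ _

theorem prodSpecBase_snd : prodSpecBase s g A ≫ pullback.snd _ _ = pullback.snd _ _ :=
  pullback.lift_snd _ _ _

theorem isPullback_prodSpecBase :
    IsPullback (prodSpecBase s g A) (pullback.fst _ _) (pullback.fst _ _) g := by
  refine (IsPullback.of_right (h₁₂ := pullback.snd s _) (h₂₂ := s) ?_
    (prodSpecBase_fst s g A) (IsPullback.of_hasPullback _ _).flip)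
  rw [prodSpecBase_snd]
  exact (IsPullback.of_hasPullback _ _).flip

theorem closedPt_comp_prodSpecBase [IsArtAlg k A] :
    closedPt (g ≫ s) A ≫ prodSpecBase s g A = g ≫ closedPt s A := by
  apply pullback.hom_ext
  · rw [Category.assoc, Category.assoc, prodSpecBase_fst, closedPt_fst, ← Category.assoc,
      closedPt_fst, Category.id_comp, Category.comp_id]
  · rw [Category.assoc, Category.assoc, prodSpecBase_snd, closedPt, closedPt, pullback.lift_snd,
      pullback.lift_snd, Category.assoc]

theorem isPullback_closedPt_prodSpecBase [IsArtAlg k A] :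
    IsPullback (closedPt (g ≫ s) A) g (prodSpecBase s g A) (closedPt s A) := by
  refine IsPullback.of_right ?_ (closedPt_comp_prodSpecBase s g A)
    (isPullback_prodSpecBase s g A).flip
  rw [closedPt_fst, closedPt_fst]
  exact IsPullback.of_horiz_isIso ⟨by simp⟩

variable {A} {B : Type u} [CommRing B] [Algebra k B] (φ : A →ₐ[k] B)

theorem prodSpecMap_comp_prodSpecBase :
    prodSpecMap (g ≫ s) φ ≫ prodSpecBase s g A = prodSpecBase s g B ≫ prodSpecMap s φ := by
  apply pullback.hom_ext
  · rw [Category.assoc, Category.assoc, prodSpecBase_fst, prodSpecMap_fst, ← Category.assoc,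
      prodSpecMap_fst, prodSpecBase_fst]
  · rw [Category.assoc, Category.assoc, prodSpecBase_snd, prodSpecMap, prodSpecMap,
      pullback.lift_snd, pullback.lift_snd, ← Category.assoc, prodSpecBase_snd]

theorem isPullback_prodSpecMap_prodSpecBase :
    IsPullback (prodSpecMap (g ≫ s) φ) (prodSpecBase s g B) (prodSpecBase s g A)
      (prodSpecMap s φ) := by
  refine IsPullback.of_right ?_ (prodSpecMap_comp_prodSpecBase s g φ)
    (isPullback_prodSpecBase s g A).flip
  rw [prodSpecMap_fst, prodSpecMap_fst]
  exact (isPullback_prodSpecBase s g B).flip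

end ProdSpecBase

section ImageHom

variable {s} {A : Type u} [CommRing A] [Algebra k A] [IsArtAlg k A] {X : Over S}

theorem imageHom_fibreProduct_comp_prodSpecBase (D : Deformation s X A) :
    imageHom (fibreProduct s g) D ≫ prodSpecBase s g A = pullback.fst _ _ ≫ D.hom := by
  apply pullback.hom_ext
  · rw [Category.assoc, Category.assoc, prodSpecBase_fst, imageHom, pullback.lift_fst_assoc]
    exact pullback.condition.symm
  · rw [Category.assoc, Category.assoc, prodSpecBase_snd, imageHom, pullback.lift_snd]
    rfl

theorem imageHom_fibreProductOver (D : Deformation s X A) :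
    imageHom (fibreProductOver s g) D = imageHom (fibreProduct s g) D ≫ prodSpecBase s g A := by
  rw [imageHom_fibreProduct_comp_prodSpecBase]
  apply pullback.hom_ext
  · rw [imageHom, pullback.lift_fst, Category.assoc]
    exact pullback.condition.symm
  · rw [imageHom, pullback.lift_snd, Category.assoc]
    rfl

theorem isPullback_imageHom_fibreProduct (D : Deformation s X A) :
    IsPullback (pullback.fst D.toOver.hom g) (imageHom (fibreProduct s g) D) D.hom
      (prodSpecBase s g A) := by
  refine IsPullback.of_bot (v₂₁ := pullback.fst _ _) (v₂₂ := pullback.fst _ _) (h₃₁ := g) ?_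
    (imageHom_fibreProduct_comp_prodSpecBase g D).symm (isPullback_prodSpecBase s g A)
  rw [imageHom, pullback.lift_fst]
  exact IsPullback.of_hasPullback _ _

end ImageHom

theorem preservesDeformations_fibreProduct : PreservesDeformations (fibreProduct s g) := by
  intro X A _ _ _ D
  have hD := D.isDeformation
  have hf := hD.flat
  have hi := isPullback_imageHom_fibreProduct g D
  have hp : IsPullback ((Over.pullback g).map D.inclOver).left ((Over.pullback g).obj X).hom
      (imageHom (fibreProduct s g) D) (closedPt (g ≫ s) A) := by
    refine IsPullback.of_right (h₁₂ := (fibreProduct s g).app D.toOver) ?_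
      (map_inclOver_comp_imageHom D) hi
    rw [closedPt_comp_prodSpecBase, (fibreProduct s g).naturality D.inclOver]
    exact (IsPullback.of_hasPullback _ _).paste_horiz hD.isPullback
  exact ⟨MorphismProperty.of_isPullback hp.flip inferInstance,
    MorphismProperty.of_isPullback hi hf, hp⟩

theorem preservesDeformations_fibreProductOver [Flat g] :
    PreservesDeformations (fibreProductOver s g) := by
  intro X A _ _ _ D
  obtain ⟨hc, hf, hp⟩ := preservesDeformations_fibreProduct s g X A D
  have hb : Flat (prodSpecBase s g A) :=
    MorphismProperty.of_isPullback (isPullback_prodSpecBase s g A).flip inferInstance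
  refine ⟨hc, ?_, ?_⟩
  · rw [imageHom_fibreProductOver]
    infer_instance
  · rw [imageHom_fibreProductOver]
    exact hp.paste_vert (isPullback_closedPt_prodSpecBase s g A)

theorem preservesBaseChange_fibreProduct : PreservesBaseChange (fibreProduct s g) := by
  intro X A B _ _ _ _ _ _ D E φ f hf
  refine IsPullback.of_right (h₁₂ := (fibreProduct s g).app D.toOver) ?_
    (map_overHom_comp_imageHom f hf.w) (isPullback_imageHom_fibreProduct g D)
  rw [prodSpecMap_comp_prodSpecBase, (fibreProduct s g).naturality (Deformation.overHom f hf.w)]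
  exact (isPullback_imageHom_fibreProduct g E).paste_horiz hf

theorem preservesBaseChange_fibreProductOver : PreservesBaseChange (fibreProductOver s g) := by
  intro X A B _ _ _ _ _ _ D E φ f hf
  rw [imageHom_fibreProductOver, imageHom_fibreProductOver]
  exact (preservesBaseChange_fibreProduct s g X A B D E φ f hf).paste_vert
    (isPullback_prodSpecMap_prodSpecBase s g φ)

end FibreProduct

end

end SmoothFunctor

theorem mainTheorem3 {k : Type u} [Field k] {S Y : Scheme.{u}} (s : S ⟶ Spec (.of k))
    (g : Y ⟶ S) (hg : Flat g) :
    SmoothFunctor.IsSmoothFunctor (F := Over.pullback g) (SmoothFunctor.fibreProduct s g) ∧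
    SmoothFunctor.IsSmoothFunctor (F := Over.pullback g ⋙ Over.map g)
      (SmoothFunctor.fibreProductOver s g) := by
  have hF (X : Over S) (hX : Flat X.hom) : Flat ((Over.pullback g).obj X).hom :=
    MorphismProperty.of_isPullback (IsPullback.of_hasPullback X.hom g) hX
  refine ⟨.of_preservesBaseChange (SmoothFunctor.preservesDeformations_fibreProduct s g)
      (SmoothFunctor.preservesBaseChange_fibreProduct s g) hF,
    .of_preservesBaseChange (SmoothFunctor.preservesDeformations_fibreProductOver s g)
      (SmoothFunctor.preservesBaseChange_fibreProductOver s g) fun X hX ↦ ?_⟩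
  have := hF X hX
  exact inferInstanceAs (Flat (((Over.pullback g).obj X).hom ≫ g))
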